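/- Let $g\ge 0$ and $k\ge 1$ be integers. Let $\boldsymbol\mu=(\mu^1,\dots,\mu^k)$ run over the $k$-tuples of partitions of one and the same integer $n=|\boldsymbol\mu|\ge 0$, and let $m_{\boldsymbol\mu}=m_{\mu^1}(\mathbf x_1)\cdots m_{\mu^k}(\mathbf x_k)$ be the product of the monomial symmetric functions in $k$ disjoint infinite sets of variables $\mathbf x_i=\{x_{i,1},x_{i,2},\dots\}$. For a prime power $q$, let $G_{\boldsymbol\mu}(q)$ be the number of orbits of $\mathrm{GL}_n(\mathbb F_q)$ on $$\mathrm{Mat}_n(\mathbb F_q)^g\times\prod_{i=1}^k\mathcal F_{\mu^i}(\mathbb F_q),$$ where $\mathcal F_\lambda(\mathbb F_q)$, for a partition $\lambda=(\lambda_1\ge\dots\ge\lambda_r>0)$ of $n$, is the set of partial flags $\mathbb F_q^n=E^0\supseteq E^1\supseteq\dots\supseteq E^r=0$ with $\dim(E^{j-1}/E^j)=\lambda_j$, and the group acts by simultaneous conjugation on the matrices and in the natural way on the flags. For $n>0$ let $\Gamma_{\boldsymbol\mu}$ be the comet-shaped quiver with vertices $0$ and $[i,j]$ ($1\le i\le k$,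 $1\le j\le l(\mu^i)-1$), with $g$ loops at $0$ and one arrow $[i,j]\to[i,j-1]$ for all $i,j$, where $[i,0]=0$. Let $\mathbf v_{\boldsymbol\mu}$ be its dimension vector with entry $n$ at $0$ and $n-\sum_{r=1}^j\mu^i_r$ at $[i,j]$, and let $A_{\boldsymbol\mu}(q)$ be the number of isomorphism classes of absolutely indecomposable representations of $\Gamma_{\boldsymbol\mu}$ over $\mathbb F_q$ of dimension vector $\mathbf v_{\boldsymbol\mu}$. For power series $f$ in the variables $x_{i,j}$ whose coefficients are functions of $q$, put $\psi_n(f)(x_{i,j};q)=f(x_{i,j}^n;q^n)$, and for $f$ with constant term $1$ put $\mathrm{Log}(f)=\sum_{n\ge1}\frac{\mu(n)}{n}\psi_n(\log f)$, where $\mu(n)$ is the Möbius function. Then $$\mathrm{Log}\Big(\sum_{\boldsymbol\mu}G_{\boldsymbol\mu}(q)\,m_{\boldsymbol\mu}\Big)=\sum_{\boldsymbol\mu\ne0}A_{\boldsymbol\mu}(q)\,m_{\boldsymbol\mu}$$ as power series whose coefficients are functions of the prime power $q$. The identity also holds with coefficients in $\mathbb Q[q]$, where $q$ is an indeterminate and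 $\psi_n(q)=q^n$: if $A_{\boldsymbol\mu}\in\mathbb Z[q]$ denote the $A$-polynomials of $(\Gamma_{\boldsymbol\mu},\mathbf v_{\boldsymbol\mu})$, that is, the polynomials that take the value $A_{\boldsymbol\mu}(q)$ defined above at every prime power $q$, then there are polynomials $G_{\boldsymbol\mu}\in\mathbb Q[q]$ that take the value $G_{\boldsymbol\mu}(q)$ defined above at every prime power $q$, and these satisfy the displayed identity. -/

import Mathlib

noncomputable section

/-! ### Plethystic logarithm -/

namespace Plethysm

variable {R σ : Type*} [CommRing R] [Algebra ℚ R]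

/-- The Adams operation `ψ_n` on power series in the variables `x_s`, where `ψ` is the family of
Adams operations of the coefficient ring: apply `ψ_n` to the coefficients, and replace `x_s` by
`x_s ^ n`. -/
def adams (ψ : ℕ+ → R →+* R) (n : ℕ+) (f : MvPowerSeries σ R) : MvPowerSeries σ R :=
  MvPowerSeries.expand n n.ne_zero (MvPowerSeries.map (ψ n) f)

/-- `log f = (f - 1) - (f - 1)²/2 + (f - 1)³/3 - ⋯`, for `f` with constant term `1`. -/
def log (f : MvPowerSeries σ R) : MvPowerSeries σ R :=
  (PowerSeries.log R).subst (f - 1)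

/-- `Ψ⁻¹ f = ∑_{n ≥ 1} μ(n)/n ψ_n(f)` with `μ` the Möbius function, for `f` with constant term
`0`. As `ψ_n(f)` has no nonzero terms in degrees strictly between `0` and `n`, only the summands
with `n ≤ deg a` contribute to the coefficient of `x ^ a`. -/
def psiInv (ψ : ℕ+ → R →+* R) (f : MvPowerSeries σ R) : MvPowerSeries σ R := fun a =>
  ∑ n ∈ Finset.range a.degree,
    ((ArithmeticFunction.moebius (n + 1) : ℚ) / ((n + 1 : ℕ) : ℚ)) •
      MvPowerSeries.coeff a (adams ψ n.succPNat f)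

/-- The plethystic logarithm `Log f = Ψ⁻¹ (log f)`, for `f` with constant term `1`. -/
def Log (ψ : ℕ+ → R →+* R) (f : MvPowerSeries σ R) : MvPowerSeries σ R :=
  psiInv ψ (log f)

end Plethysm

/-! ### Prime powers and functions of `q` -/

/-- The prime powers `q`, i.e. the cardinalities of finite fields. -/
abbrev PrimePower : Type := {q : ℕ // IsPrimePow q}

namespace PrimePower

/-- The prime power `q ^ n`. -/
def pow (q : PrimePower) (n : ℕ+) : PrimePower := ⟨q.1 ^ (n : ℕ), q.2.pow n.ne_zero⟩

/-- The characteristic of the field with `q` elements. -/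
def char (q : PrimePower) : ℕ := q.1.minFac

instance (q : PrimePower) : Fact q.char.Prime := ⟨Nat.minFac_prime q.2.ne_one⟩

/-- The finite field `𝔽_q`. -/
abbrev Fq (q : PrimePower) : Type := GaloisField q.char (q.1.factorization q.char)

theorem card_Fq (q : PrimePower) : Nat.card q.Fq = q.1 := by
  have h : q.char ^ q.1.factorization q.char = q.1 := q.2.minFac_pow_factorization_eq
  rw [GaloisField.card, h]
  intro h0
  rw [h0, pow_zero] at h
  exact q.2.ne_one h.symm

/-- The Adams operation `(ψ_n f)(q) = f(q ^ n)` on functions of `q`. -/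
def adams (n : ℕ+) : (PrimePower → ℚ) →+* (PrimePower → ℚ) :=
  RingHom.pi fun q => Pi.evalRingHom (fun _ : PrimePower => ℚ) (q.pow n)

end PrimePower

/-- The Adams operation `ψ_n : q ↦ q ^ n` on polynomials in `q`. -/
def polyAdams (n : ℕ+) : Polynomial ℚ →+* Polynomial ℚ := (Polynomial.expand ℚ (n : ℕ)).toRingHom

/-! ### Multipartitions and monomial symmetric functions -/

namespace Nat.Partition

variable {n : ℕ} (lam : n.Partition)

/-- The length `l(λ)`, the number of (nonzero) parts. -/
def len : ℕ := Multiset.card lam.parts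

/-- `λ_{j+1} + λ_{j+2} + ⋯ = n - (λ_1 + ⋯ + λ_j)`, where `λ_1 ≥ λ_2 ≥ ⋯` are the parts in
non-increasing order. -/
def tail (j : ℕ) : ℕ := ((lam.parts.sort (· ≥ ·)).drop j).sum

end Nat.Partition

/-- `k`-tuples `(μ^1, …, μ^k)` of partitions of one and the same natural number, which is the
first component. -/
abbrev MultiPartition (k : ℕ) : Type := Σ n : ℕ, Fin k → n.Partition

/-- The monomial symmetric function `m_λ` in the variables `x_0, x_1, …`, the sum of all monomials
whose multiset of nonzero exponents is the multiset of parts of `λ`. -/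
def monomialSymm (R : Type*) [CommRing R] {n : ℕ} (lam : n.Partition) : MvPowerSeries ℕ R :=
  fun a => if a.support.val.map a = lam.parts then 1 else 0

/-- `m_μ = m_{μ^1}(x_1) ⋯ m_{μ^k}(x_k)` with `x_i = (x_{i,0}, x_{i,1}, …)`. The sets of
variables being disjoint, the coefficient of a monomial is the product over `i` of the coefficients
in `m_{μ^i}` of its parts in the variables `x_i`. -/
def multiMonomialSymm (R : Type*) [CommRing R] {k : ℕ} (mu : MultiPartition k) :
    MvPowerSeries (Fin k × ℕ) R :=
  fun a => ∏ i, MvPowerSeries.coeff (a.curry i) (monomialSymm R (mu.2 i))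

/-- The series `∑_μ c_μ m_μ`. For `k > 0` every monomial occurs in at most one `m_μ`, so the sum
that defines a coefficient is finite. -/
def multiMonomialSeries {R : Type*} [CommRing R] {k : ℕ} (c : MultiPartition k → R) :
    MvPowerSeries (Fin k × ℕ) R :=
  fun a => ∑ᶠ mu, c mu * MvPowerSeries.coeff a (multiMonomialSymm R mu)

/-! ### Orbits on tuples of matrices and partial flags -/

/-- A partial flag `F^n = E^0 ⊇ E^1 ⊇ ⋯ ⊇ E^r = 0` of type `λ = (λ_1 ≥ ⋯ ≥ λ_r)`, that is with
`dim E^j = λ_{j+1} + ⋯ + λ_r`, equivalently `dim (E^{j-1} / E^j) = λ_j` for all `j`. -/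
@[ext]
structure PartialFlag (F : Type*) [Field F] {n : ℕ} (lam : n.Partition) where
  E : Fin (lam.len + 1) → Submodule F (Fin n → F)
  antitone : Antitone E
  finrank_eq : ∀ j, Module.finrank F (E j) = lam.tail j

/-- The set `Mat_n(F)^g × ∏_i 𝓕_{μ^i}(F)`. -/
@[ext]
structure FlagConfig (F : Type*) [Field F] (g : ℕ) {k : ℕ} (mu : MultiPartition k) where
  mat : Fin g → Matrix (Fin mu.1) (Fin mu.1) F
  flag : ∀ i, PartialFlag F (mu.2 i)

/-- `GL_n(F)` acts on flags by taking images of subspaces. -/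
instance {F : Type*} [Field F] {n : ℕ} {lam : n.Partition} :
    MulAction (GL (Fin n) F) (PartialFlag F lam) where
  smul h X :=
    { E := fun j => (X.E j).map (Matrix.mulVecLin (h : Matrix (Fin n) (Fin n) F))
      antitone := fun _ _ hij => Submodule.map_mono (X.antitone hij)
      finrank_eq := fun j => by
        rw [← X.finrank_eq j]
        exact (LinearEquiv.finrank_eq (Submodule.equivMapOfInjective _
          (Matrix.mulVec_injective_of_isUnit h.isUnit) (X.E j))).symm }
  one_smul X := by
    refine PartialFlag.ext (funext fun j => ?_)
    change (X.E j).map (Matrix.mulVecLin (1 : Matrix (Fin n) (Fin n) F)) = X.E j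
    rw [Matrix.mulVecLin_one, Submodule.map_id]
  mul_smul h h' X := by
    refine PartialFlag.ext (funext fun j => ?_)
    change (X.E j).map (Matrix.mulVecLin ((h * h' : GL (Fin n) F) : Matrix (Fin n) (Fin n) F)) =
      ((X.E j).map (Matrix.mulVecLin (h' : Matrix (Fin n) (Fin n) F))).map
        (Matrix.mulVecLin (h : Matrix (Fin n) (Fin n) F))
    rw [Units.val_mul, Matrix.mulVecLin_mul, Submodule.map_comp]

/-- `GL_n(F)` acts on matrices by conjugation and on flags by taking images. -/
instance {F : Type*} [Field F] {g k : ℕ} {mu : MultiPartition k} :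
    MulAction (GL (Fin mu.1) F) (FlagConfig F g mu) where
  smul h X :=
    ⟨fun a => h.val * X.mat a * (h⁻¹).val, fun i => h • X.flag i⟩
  one_smul X := by
    refine FlagConfig.ext (funext fun a => ?_) (funext fun i => one_smul _ (X.flag i))
    change (1 : GL (Fin mu.1) F).val * X.mat a * ((1 : GL (Fin mu.1) F)⁻¹).val = X.mat a
    simp
  mul_smul h h' X := by
    refine FlagConfig.ext (funext fun a => ?_) (funext fun i => mul_smul h h' (X.flag i))
    change (h * h').val * X.mat a * ((h * h')⁻¹).val =
      h.val * (h'.val * X.mat a * (h'⁻¹).val) * (h⁻¹).val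
    rw [mul_inv_rev, Units.val_mul, Units.val_mul]
    simp only [mul_assoc]

/-- The number of `GL_n(F)`-orbits on `Mat_n(F)^g × ∏_i 𝓕_{μ^i}(F)`. -/
def orbitCount (F : Type*) [Field F] (g : ℕ) {k : ℕ} (mu : MultiPartition k) : ℕ :=
  Nat.card (MulAction.orbitRel.Quotient (GL (Fin mu.1) F) (FlagConfig F g mu))

/-! ### Representations of quivers -/

/-- Representations over `K` of dimension vector `v`: a linear map `K^{v_i} → K^{v_j}`, given by its
matrix, for each arrow `i ⟶ j`. -/
def QuiverRep (K : Type*) [Field K] {V : Type*} [Quiver V] (v : V → ℕ) : Type _ :=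
  ∀ ⦃i j : V⦄, (i ⟶ j) → Matrix (Fin (v j)) (Fin (v i)) K

namespace QuiverRep

open scoped Matrix

variable {K : Type*} [Field K] {V : Type*} [Quiver V] {v w : V → ℕ}

/-- Isomorphism of representations. -/
def Iso (φ : QuiverRep K v) (ψ : QuiverRep K w) : Prop :=
  ∃ f : ∀ i, (Fin (v i) → K) ≃ₗ[K] (Fin (w i) → K),
    ∀ ⦃i j : V⦄ (a : i ⟶ j) (x : Fin (v i) → K), f j (φ a *ᵥ x) = ψ a *ᵥ f i x

/-- Direct sum of representations. -/
def directSum (φ : QuiverRep K v) (ψ : QuiverRep K w) : QuiverRep K (v + w) :=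
  fun _ _ a => Matrix.reindex finSumFinEquiv finSumFinEquiv (Matrix.fromBlocks (φ a) 0 0 (ψ a))

/-- Extension of scalars. -/
def baseChange (L : Type*) [Field L] [Algebra K L] (φ : QuiverRep K v) : QuiverRep L v :=
  fun _ _ a => (φ a).map (algebraMap K L)

/-- A representation is indecomposable if it is nonzero and not isomorphic to a direct sum of two
nonzero representations. -/
def Indecomposable (φ : QuiverRep K v) : Prop :=
  v ≠ 0 ∧ ∀ (v₁ v₂ : V → ℕ) (φ₁ : QuiverRep K v₁) (φ₂ : QuiverRep K v₂),
    φ.Iso (φ₁.directSum φ₂) → v₁ = 0 ∨ v₂ = 0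

/-- A representation is absolutely indecomposable if it is indecomposable over every finite
extension of the base field. -/
def AbsolutelyIndecomposable {K : Type} [Field K] (φ : QuiverRep K v) : Prop :=
  ∀ (L : Type) [Field L] [Algebra K L] [FiniteDimensional K L], (φ.baseChange L).Indecomposable

/-- Isomorphism as an equivalence relation on the representations of a given dimension vector. -/
def isoSetoid (K : Type*) [Field K] {V : Type*} [Quiver V] (v : V → ℕ) :
    Setoid (QuiverRep K v) where
  r := Iso
  iseqv :=
    { refl := fun φ => ⟨fun _ => LinearEquiv.refl K _, fun _ _ _ _ => rfl⟩
      symm := by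
        rintro φ ψ ⟨f, hf⟩
        refine ⟨fun i => (f i).symm, fun i j a x => ?_⟩
        rw [LinearEquiv.symm_apply_eq, hf, LinearEquiv.apply_symm_apply]
      trans := by
        rintro φ ψ χ ⟨f, hf⟩ ⟨f', hf'⟩
        refine ⟨fun i => (f i).trans (f' i), fun i j a x => ?_⟩
        simp only [LinearEquiv.trans_apply, hf, hf'] }

end QuiverRep

/-- The number of isomorphism classes of absolutely indecomposable representations over `F` of
dimension vector `v`. -/
def absIndecCount (F : Type) [Field F] {V : Type*} [Quiver V] (v : V → ℕ) : ℕ :=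
  Nat.card (Quotient ((QuiverRep.isoSetoid F v).comap
    (Subtype.val : {φ : QuiverRep F v // φ.AbsolutelyIndecomposable} → QuiverRep F v)))

/-- `P` is the `A`-polynomial of the quiver `V` and the dimension vector `v`: its value at `q` is the
number of isomorphism classes of absolutely indecomposable representations over any field with `q`
elements. -/
def IsAPolynomial {V : Type*} [Quiver V] (v : V → ℕ) (P : Polynomial ℤ) : Prop :=
  ∀ (F : Type) [Field F] [Finite F], P.eval (Nat.card F : ℤ) = absIndecCount F v

/-! ### Comet-shaped quivers -/

/-- The vertices of the comet-shaped quiver with `g` loops and `k` legs of lengths `s_1, …, s_k`: the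
central vertex, and the vertices `[i, j + 1]` for `j < s_i`. -/
inductive CometVertex (g : ℕ) {k : ℕ} (s : Fin k → ℕ) : Type
  | center : CometVertex g s
  | leg (i : Fin k) (j : Fin (s i)) : CometVertex g s

/-- The arrows are `g` loops at the center, an arrow from the first vertex of each leg to the
center, and an arrow from the `(j+1)`-st vertex of a leg to the `j`-th one. -/
instance (g : ℕ) {k : ℕ} (s : Fin k → ℕ) : Quiver.{0} (CometVertex g s) where
  Hom
    | .center, .center => Fin g
    | .center, .leg _ _ => Empty
    | .leg _ j, .center => PLift (j.val = 0)
    | .leg i j, .leg i' j' => PLift (i = i' ∧ j.val = j'.val + 1)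

/-- The comet-shaped quiver `Γ_μ`, with `g` loops and legs of lengths `l(μ^i) - 1`. -/
abbrev CometQuiver (g : ℕ) {k : ℕ} (mu : MultiPartition k) : Type :=
  CometVertex g fun i => (mu.2 i).len - 1

/-- The dimension vector `v_μ`, with `n` at the center and `n - (μ^i_1 + ⋯ + μ^i_j)` at the `j`-th
vertex of the `i`-th leg. -/
def cometDim (g : ℕ) {k : ℕ} (mu : MultiPartition k) : CometQuiver g mu → ℕ
  | .center => mu.1
  | .leg i j => (mu.2 i).tail (j.val + 1)

/-! ### The counting functions -/

/-- `q ↦ G_μ(q)`, the number of `GL_n(𝔽_q)`-orbits on `Mat_n(𝔽_q)^g × ∏_i 𝓕_{μ^i}(𝔽_q)`. -/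
def GFun (g : ℕ) {k : ℕ} (mu : MultiPartition k) : PrimePower → ℚ :=
  fun q => orbitCount q.Fq g mu

/-- `q ↦ A_μ(q)`, the number of isomorphism classes of absolutely indecomposable representations
of `Γ_μ` over `𝔽_q` of dimension vector `v_μ`. -/
def AFun (g : ℕ) {k : ℕ} (mu : MultiPartition k) : PrimePower → ℚ :=
  fun q => absIndecCount q.Fq (cometDim g mu)

end

/-! Both sides count the same kind of object: a finite-dimensional space over `𝔽_q` with `g`
operators and `k` flags, that is a `LinSys` with a `HasType`. The dimension drops of the flags are
recorded as the exponent of a monomial. The orbits of `GL_n` are the isomorphism classes of these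
objects (`orbitCount_eq_classCount`). In an indecomposable representation of the comet that is
nonzero at the center, all maps to the center are injective
(`QuiverRep.Indecomposable.legsInjective`), so the legs are flags and `A_μ` counts the absolutely
indecomposable objects (`absIndecCount_eq_absCount`). What remains is that the plethystic logarithm
of the series of all classes is the series of absolutely indecomposable ones
(`IsoClass.Log_classSeries`).

Over an algebraic closure of the prime field, the Krull–Schmidt theorem
(`IsoClass.multiset_eq_of_sum_eq`) identifies classes with multisets of indecomposable ones. The
Frobenius `σ` of `𝔽_q` permutes the indecomposables and preserves types. The classes over `𝔽_{q^n}`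
are exactly the classes fixed by `σ ^ n`: extension of scalars is injective on classes by the
Noether–Deuring theorem (`IsoClass.baseChange_injective`), and a fixed class descends
(`IsoClass.exists_baseChange_eq_iff`) because the fixed vectors of a Frobenius-semilinear
automorphism span the space (`span_fixed_eq_top`). Hence `ψ_n` of the absolutely indecomposable
series counts the indecomposables fixed by `σ ^ n`.

Multisets fixed by a permutation have as generating series an Euler product over its finite orbits,
and the logarithm of that product is `∑_n ψ_n / n` of the count of fixed indecomposables. No
infinite product is formed: `Plethysm.Log_eq_iff` restates `Log f = g` through the Euler derivation,
and in that form the claim is a bijection, `FixedMultiset.degree_mul_card`.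

This identity runs over all exponents. To collect monomials into the `m_μ`, the coefficients must
not depend on the order of the drops. For the class counts, Burnside's lemma reduces this to
counting flags of submodules of a finite-dimensional `K[X]`-module; adjacent drops can be swapped
since such a module, and each of its subquotients, is self-dual and so has as many submodules of
dimension `b` as of codimension `b`. The absolutely indecomposable counts inherit the symmetry
because `Log` commutes with permutations of the variables.

For polynomials, the series of the `A_μ` is the `Log` of some series over `ℚ[q]`. Evaluation at
prime powers is injective and respects the Adams operations, and `Log` is injective, so the
coefficients of that series take the values `G_μ(q)`. -/

noncomputable section

/-! ### The plethystic logarithm via the Euler derivation -/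

namespace Plethysm

open MvPowerSeries

variable {R σ : Type*} [CommRing R]

/-- The Euler derivation, multiplying the coefficient of `x ^ a` by the degree of `a`. -/
def euler (f : MvPowerSeries σ R) : MvPowerSeries σ R := fun a => a.degree • coeff a f

theorem coeff_euler (f : MvPowerSeries σ R) (a : σ →₀ ℕ) :
    coeff a (euler f) = a.degree • coeff a f := rfl

theorem euler_mul (f h : MvPowerSeries σ R) : euler (f * h) = euler f * h + f * euler h := by
  classical
  ext a
  rw [coeff_euler, map_add, coeff_mul, coeff_mul, coeff_mul, Finset.smul_sum,
    ← Finset.sum_add_distrib]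
  refine Finset.sum_congr rfl fun p hp => ?_
  rw [coeff_euler, coeff_euler, ← Finset.HasAntidiagonal.mem_antidiagonal.mp hp, map_add, add_smul,
    smul_mul_assoc, mul_smul_comm]

theorem euler_sub_one (f : MvPowerSeries σ R) : euler (f - 1) = euler f := by
  classical
  ext a
  rw [coeff_euler, coeff_euler, map_sub, coeff_one]
  split_ifs with h
  · simp [h]
  · simp

theorem euler_one : euler (1 : MvPowerSeries σ R) = 0 := by
  classical
  ext a
  rw [coeff_euler, coeff_one]
  split_ifs with h
  · simp [h]
  · simp

theorem euler_pow (f : MvPowerSeries σ R) (n : ℕ) :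
    euler (f ^ (n + 1)) = (n + 1) • (f ^ n * euler f) := by
  induction n with
  | zero => simp
  | succ n ih =>
    rw [pow_succ, euler_mul, ih, pow_succ f n, succ_nsmul (n := n + 1)]
    simp only [nsmul_eq_mul]
    ring

theorem coeff_pow_eq_zero {u : MvPowerSeries σ R} (hu : constantCoeff u = 0) {a : σ →₀ ℕ} {n : ℕ}
    (h : a.degree < n) : coeff a (u ^ n) = 0 :=
  coeff_eq_zero_of_constantCoeff_nilpotent (m := 1) (by simp [hu]) (by omega)

theorem coeff_subst_eq_sum {u : MvPowerSeries σ R} (hu : constantCoeff u = 0) (F : PowerSeries R)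
    {a : σ →₀ ℕ} {N : ℕ} (hN : a.degree < N) :
    coeff a (F.subst u) = ∑ n ∈ Finset.range N, PowerSeries.coeff n F * coeff a (u ^ n) := by
  rw [PowerSeries.coeff_subst (PowerSeries.HasSubst.of_constantCoeff_zero hu)]
  refine finsum_eq_sum_of_support_subset _ fun n hn => ?_
  by_contra h
  simp only [Finset.coe_range, Set.mem_Iio, not_lt] at h
  exact hn (by simp only [coeff_pow_eq_zero hu (show a.degree < n by omega), smul_zero])

/-- This is the chain rule. Because `u` has no constant term, only the powers `u ^ n` with `n ≤ deg
a` reach the coefficient of `x ^ a`; both sides are thus finite sums, matched term by term through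
`euler_pow`. -/
theorem euler_subst {u : MvPowerSeries σ R} (hu : constantCoeff u = 0) (F : PowerSeries R) :
    euler (F.subst u) = (PowerSeries.derivative R F).subst u * euler u := by
  classical
  ext a
  have hle : ∀ p ∈ Finset.HasAntidiagonal.antidiagonal a, p.1.degree < a.degree + 1 := fun p hp => by
    rw [← Finset.HasAntidiagonal.mem_antidiagonal.mp hp, map_add]; omega
  have h1 : coeff a ((PowerSeries.derivative R F).subst u * euler u) =
      ∑ n ∈ Finset.range (a.degree + 1), ∑ p ∈ Finset.HasAntidiagonal.antidiagonal a,
        PowerSeries.coeff n (PowerSeries.derivative R F) * coeff p.1 (u ^ n) *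
          coeff p.2 (euler u) := by
    rw [coeff_mul, Finset.sum_comm]
    refine Finset.sum_congr rfl fun p hp => ?_
    rw [coeff_subst_eq_sum hu _ (hle p hp), Finset.sum_mul]
  rw [h1, coeff_euler, coeff_subst_eq_sum hu F (N := a.degree + 1 + 1) (by omega), Finset.smul_sum,
    Finset.sum_range_succ']
  have h0 : a.degree • (PowerSeries.coeff 0 F * coeff a (u ^ 0)) = 0 := by
    rw [← mul_smul_comm, ← coeff_euler, pow_zero, euler_one]; simp
  rw [h0, add_zero]
  refine Finset.sum_congr rfl fun n _ => ?_
  rw [← mul_smul_comm, ← coeff_euler, euler_pow, map_nsmul, coeff_mul, PowerSeries.coeff_derivative,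
    nsmul_eq_mul, ← mul_assoc, Finset.mul_sum]
  refine Finset.sum_congr rfl fun p _ => ?_
  push_cast
  ring

variable [Algebra ℚ R]

/-- Away from the constant term, the Euler derivation loses nothing, since degrees are invertible in
a `ℚ`-algebra. -/
theorem smul_left_injective_of_degree {a : σ →₀ ℕ} (ha : a ≠ 0) {x y : R}
    (h : a.degree • x = a.degree • y) : x = y := by
  have hd : a.degree ≠ 0 := fun h0 => ha ((Finsupp.degree_eq_zero_iff a).mp h0)
  have : ((a.degree : ℚ)) • x = (a.degree : ℚ) • y := by
    rwa [Nat.cast_smul_eq_nsmul, Nat.cast_smul_eq_nsmul]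
  have hc : (a.degree : ℚ) ≠ 0 := Nat.cast_ne_zero.mpr hd
  rw [← inv_smul_smul₀ hc x, this, inv_smul_smul₀ hc]

theorem constantCoeff_log {f : MvPowerSeries σ R} (hf : constantCoeff f = 1) :
    constantCoeff (log f) = 0 :=
  PowerSeries.constantCoeff_subst_eq_zero (by simp [hf]) _ PowerSeries.constantCoeff_log

/-- The equation `euler (log f) = euler f / f` with the denominator cleared. It comes from `(1 + X)
· log' = 1` by substituting `f - 1` for `X`, followed by the chain rule. -/
theorem mul_euler_log {f : MvPowerSeries σ R} (hf : constantCoeff f = 1) :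
    f * euler (log f) = euler f := by
  have hu : constantCoeff (f - 1) = 0 := by simp [hf]
  have hs : PowerSeries.HasSubst (f - 1) := PowerSeries.HasSubst.of_constantCoeff_zero hu
  have h1 : (1 + PowerSeries.X) * PowerSeries.derivative R (PowerSeries.log R) = 1 := by
    rw [PowerSeries.deriv_log]
    ext n
    rcases n with _ | n
    · simp [add_mul]
    · rw [add_mul, one_mul, map_add, PowerSeries.coeff_succ_X_mul, PowerSeries.coeff_mk,
        PowerSeries.coeff_mk, ← map_add, PowerSeries.coeff_one, pow_succ]
      simp
  have h2 : f * (PowerSeries.derivative R (PowerSeries.log R)).subst (f - 1) = 1 := by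
    have h3 := congrArg (PowerSeries.substAlgHom hs) h1
    rw [map_mul, map_add, map_one, PowerSeries.coe_substAlgHom, PowerSeries.subst_X hs] at h3
    simpa using h3
  rw [log, euler_subst hu, euler_sub_one, ← mul_assoc, h2, one_mul]

theorem eq_of_mul_euler_eq {f g h : MvPowerSeries σ R} (hf : constantCoeff f = 1)
    (hg : constantCoeff g = 0) (hh : constantCoeff h = 0) (e : f * euler g = f * euler h) :
    g = h := by
  have hu : IsUnit f := by rw [MvPowerSeries.isUnit_iff_constantCoeff, hf]; exact isUnit_one
  have e' := hu.mul_left_cancel e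
  ext a
  by_cases ha : a = 0
  · subst ha; simp [hg, hh]
  · exact smul_left_injective_of_degree ha (by rw [← coeff_euler, e', coeff_euler])

/-- The logarithm is characterised by its Euler derivative. -/
theorem log_eq_iff {f g : MvPowerSeries σ R} (hf : constantCoeff f = 1)
    (hg : constantCoeff g = 0) : log f = g ↔ f * euler g = euler f :=
  ⟨fun h => h ▸ mul_euler_log hf,
    fun h => eq_of_mul_euler_eq hf (constantCoeff_log hf) hg ((mul_euler_log hf).trans h.symm)⟩

/-- The equation is a recursion: `deg a` times the coefficient of `f` at `a` is a combination of
coefficients at exponents of smaller degree, because `euler g` has no constant term. The constant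
term therefore determines `f`. -/
theorem eq_of_euler {f f' g : MvPowerSeries σ R} (hf : constantCoeff f = constantCoeff f')
    (h : f * euler g = euler f) (h' : f' * euler g = euler f') : f = f' := by
  classical
  ext a
  induction hn : a.degree using Nat.strong_induction_on generalizing a with
  | _ n ih =>
    by_cases ha : a = 0
    · subst ha; simpa using hf
    refine smul_left_injective_of_degree ha ?_
    rw [← coeff_euler, ← coeff_euler, ← h, ← h', coeff_mul, coeff_mul]
    refine Finset.sum_congr rfl fun p hp => ?_
    by_cases h2 : p.2 = 0
    · simp [coeff_euler, h2]
    · have h3 : p.2.degree ≠ 0 := fun h0 => h2 ((Finsupp.degree_eq_zero_iff _).mp h0)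
      have h4 := congrArg Finsupp.degree (Finset.HasAntidiagonal.mem_antidiagonal.mp hp)
      rw [map_add] at h4
      rw [ih _ (by omega) p.1 rfl]

/-- The coefficients of the exponential of `∑ c_b x ^ b`. -/
def expCoeff (c : (σ →₀ ℕ) → R) : ℕ → (σ →₀ ℕ) → R
  | 0, _ => 1
  | N + 1, a => by
      classical
      exact if a = 0 then 1 else
        ((a.degree : ℚ)⁻¹) • ∑ p ∈ (Finset.HasAntidiagonal.antidiagonal a).filter (fun p => p.2 ≠ 0),
          expCoeff c N p.1 * (p.2.degree • c p.2)

/-- The first argument of `expCoeff` is fuel that makes the recursion structural. The summands have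
`p.2 ≠ 0`, so each call lowers the degree, and any fuel at least the degree gives the same value. -/
theorem expCoeff_stable (c : (σ →₀ ℕ) → R) (a : σ →₀ ℕ) : ∀ N M, a.degree ≤ N → a.degree ≤ M →
    expCoeff c N a = expCoeff c M a := by
  classical
  intro N
  induction N generalizing a with
  | zero =>
    intro M h _
    have : a = 0 := (Finsupp.degree_eq_zero_iff a).mp (by omega)
    subst this
    cases M <;> simp [expCoeff]
  | succ N ih =>
    intro M hN hM
    cases M with
    | zero =>
      have : a = 0 := (Finsupp.degree_eq_zero_iff a).mp (by omega)
      subst this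
      simp [expCoeff]
    | succ M =>
      simp only [expCoeff]
      split_ifs with h0
      · rfl
      congr 1
      refine Finset.sum_congr rfl fun p hp => ?_
      rw [Finset.mem_filter] at hp
      have h3 : p.2.degree ≠ 0 := fun h0 => hp.2 ((Finsupp.degree_eq_zero_iff _).mp h0)
      have h4 := congrArg Finsupp.degree (Finset.HasAntidiagonal.mem_antidiagonal.mp hp.1)
      rw [map_add] at h4
      rw [ih _ M (by omega) (by omega)]

/-- The recursion that defines `expCoeff` is `f * euler g = euler f` read off coefficient by
coefficient, so `log_eq_iff` applies to the series with these coefficients. -/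
theorem exists_log_eq {g : MvPowerSeries σ R} (hg : constantCoeff g = 0) :
    ∃ f : MvPowerSeries σ R, constantCoeff f = 1 ∧ log f = g := by
  classical
  let f : MvPowerSeries σ R := fun a => expCoeff (fun b => coeff b g) a.degree a
  have hfc : ∀ a, coeff a f = expCoeff (fun b => coeff b g) a.degree a := fun _ => rfl
  have hf : constantCoeff f = 1 := by
    rw [← coeff_zero_eq_constantCoeff_apply, hfc]; simp [expCoeff]
  refine ⟨f, hf, (log_eq_iff hf hg).mpr ?_⟩
  ext a
  by_cases ha : a = 0
  · subst ha
    rw [coeff_euler, coeff_mul]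
    simp [coeff_euler]
  · have hd : a.degree ≠ 0 := fun h0 => ha ((Finsupp.degree_eq_zero_iff a).mp h0)
    rw [coeff_euler, hfc, ← Nat.cast_smul_eq_nsmul ℚ,
      expCoeff_stable _ a a.degree (a.degree + 1) le_rfl (by omega), expCoeff, if_neg ha,
      smul_inv_smul₀ (Nat.cast_ne_zero.mpr hd), coeff_mul, Finset.sum_filter]
    refine Finset.sum_congr rfl fun p hp => ?_
    split_ifs with h
    · have h4 := congrArg Finsupp.degree (Finset.HasAntidiagonal.mem_antidiagonal.mp hp)
      rw [map_add] at h4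
      rw [hfc, coeff_euler, expCoeff_stable _ p.1 p.1.degree a.degree le_rfl (by omega)]
    · simp only [not_not] at h
      simp [coeff_euler, h]

end Plethysm

end

/-! ### Sums of Adams operations, Dirichlet convolution and Möbius inversion. -/

noncomputable section

namespace Plethysm

open MvPowerSeries

variable {R σ : Type*} [CommRing R]

theorem coeff_smul_adams (ψ : ℕ+ → R →+* R) (n : ℕ+) (f : MvPowerSeries σ R) (a : σ →₀ ℕ) :
    coeff ((n : ℕ) • a) (adams ψ n f) = ψ n (coeff a f) := by
  rw [adams, coeff_expand_smul, coeff_map]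

variable [Algebra ℚ R]

/-- Here `d` is the greatest common divisor of the exponents. It controls which `ψ_n` can reach the
monomial `x ^ a`: exactly those with `n ∣ d`. -/
theorem exists_primitive {a : σ →₀ ℕ} (ha : a ≠ 0) : ∃ (d : ℕ) (b : σ →₀ ℕ), a = d • b ∧ d ≠ 0 ∧
    ∀ n, (∀ i, n ∣ a i) → n ∣ d := by
  refine ⟨a.support.gcd a, a.mapRange (· / a.support.gcd a) (by simp), ?_, ?_, ?_⟩
  · ext i
    simp only [Finsupp.smul_apply, Finsupp.mapRange_apply, smul_eq_mul]
    by_cases h : i ∈ a.support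
    · rw [Nat.mul_div_cancel' (Finset.gcd_dvd h)]
    · simp [Finsupp.notMem_support_iff.mp h]
  · intro h
    rw [Finset.gcd_eq_zero_iff] at h
    apply ha
    ext i
    by_cases hi : i ∈ a.support
    · exact h i hi
    · simpa using hi
  · exact fun n hn => Finset.dvd_gcd fun i _ => hn i

/-- The series `∑_n u(n) ψ_n(f)`. -/
def adamsSum (ψ : ℕ+ → R →+* R) (u : ArithmeticFunction ℚ) (f : MvPowerSeries σ R) :
    MvPowerSeries σ R := fun a =>
  ∑ n ∈ Finset.range a.degree, u (n + 1) • coeff a (adams ψ n.succPNat f)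

theorem coeff_adamsSum (ψ : ℕ+ → R →+* R) (u : ArithmeticFunction ℚ) (f : MvPowerSeries σ R)
    (a : σ →₀ ℕ) : coeff a (adamsSum ψ u f) =
      ∑ n ∈ Finset.range a.degree, u (n + 1) • coeff a (adams ψ n.succPNat f) := rfl

theorem constantCoeff_adamsSum (ψ : ℕ+ → R →+* R) (u : ArithmeticFunction ℚ)
    (f : MvPowerSeries σ R) : constantCoeff (adamsSum ψ u f) = 0 := by
  rw [← coeff_zero_eq_constantCoeff_apply, coeff_adamsSum]
  simp

theorem sum_range_comp_succ {M : Type*} [AddCommMonoid M] (F : ℕ → M) {n : ℕ} :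
    ∑ i ∈ Finset.range n, F (i + 1) = ∑ i ∈ Finset.Ico 1 (n + 1), F i := by
  rw [Finset.sum_Ico_eq_sum_range]
  simp [add_comm]

/-- The series `ψ_n(f)` only has exponents divisible by `n`, so by `h` only the divisors of `d`
contribute. They all lie in the range of summation since `d ≤ deg (d • b)`. Coefficients of
`adamsSum` thus become divisor sums, on which Dirichlet convolution can act. -/
theorem coeff_smul_adamsSum (ψ : ℕ+ → R →+* R) (u : ArithmeticFunction ℚ) (f : MvPowerSeries σ R)
    {b : σ →₀ ℕ} {d : ℕ} (hb : b ≠ 0) (hd : d ≠ 0) (h : ∀ n, (∀ i, n ∣ (d • b) i) → n ∣ d) :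
    coeff (d • b) (adamsSum ψ u f) =
      ∑ p ∈ d.divisorsAntidiagonal, u p.1 • ψ p.1.toPNat' (coeff (p.2 • b) f) := by
  have hle : d ≤ (d • b).degree := by
    have : b.degree ≠ 0 := fun h0 => hb ((Finsupp.degree_eq_zero_iff b).mp h0)
    rw [map_nsmul, smul_eq_mul]
    exact Nat.le_mul_of_pos_right _ (Nat.pos_of_ne_zero this)
  rw [coeff_adamsSum, Nat.sum_divisorsAntidiagonal
    fun i j => u i • ψ i.toPNat' (coeff (j • b) f)]
  have h1 : ∀ n, u (n + 1) • coeff (d • b) (adams ψ n.succPNat f) =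
      (fun m => u m • coeff (d • b) (adams ψ m.toPNat' f)) (n + 1) := fun n => rfl
  rw [Finset.sum_congr rfl fun n _ => h1 n,
    sum_range_comp_succ (fun m => u m • coeff (d • b) (adams ψ m.toPNat' f))]
  symm
  refine Finset.sum_subset_zero_on_sdiff ?_ ?_ ?_
  · intro m hm
    rw [Nat.mem_divisors] at hm
    have := Nat.le_of_dvd (Nat.pos_of_ne_zero hd) hm.1
    have := Nat.pos_of_dvd_of_pos hm.1 (Nat.pos_of_ne_zero hd)
    rw [Finset.mem_Ico]
    omega
  · intro m hm
    rw [Finset.mem_sdiff, Finset.mem_Ico, Nat.mem_divisors] at hm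
    have h2 : ¬ m ∣ d := fun h' => hm.2 ⟨h', hd⟩
    have h3 : ∃ i, ¬ m ∣ (d • b) i := by
      by_contra h'
      push Not at h'
      exact h2 (h m h')
    obtain ⟨i, hi⟩ := h3
    have h4 : ((m.toPNat' : ℕ+) : ℕ) = m := Nat.toPNat'_coe m ▸ if_pos (by omega)
    rw [adams, coeff_expand_of_not_dvd _ _ _ (i := i) (by rwa [h4]), smul_zero]
  · intro m hm
    rw [Nat.mem_divisors] at hm
    have hm0 : 0 < m := Nat.pos_of_dvd_of_pos hm.1 (Nat.pos_of_ne_zero hd)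
    have h4 : ((m.toPNat' : ℕ+) : ℕ) = m := Nat.toPNat'_coe m ▸ if_pos (by omega)
    congr 1
    rw [← coeff_smul_adams, h4, smul_smul, Nat.mul_div_cancel' hm.1]

/-- Adams operations on the coefficients: `ψ_1 = 1` and `ψ_m ψ_n = ψ_{mn}`. -/
structure IsAdams (ψ : ℕ+ → R →+* R) : Prop where
  one : ∀ x, ψ 1 x = x
  mul : ∀ m n x, ψ m (ψ n x) = ψ (m * n) x

/-- Since `ψ_m ψ_n = ψ_{mn}`, arithmetic functions act on series through Dirichlet convolution.
Inverting `∑ ψ_n / n` then amounts to inverting the function `n ↦ 1 / n`. -/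
theorem adamsSum_adamsSum {ψ : ℕ+ → R →+* R} (hψ : IsAdams ψ) (u v : ArithmeticFunction ℚ)
    (f : MvPowerSeries σ R) : adamsSum ψ u (adamsSum ψ v f) = adamsSum ψ (u * v) f := by
  ext a
  by_cases ha : a = 0
  · subst ha; simp [coeff_adamsSum]
  obtain ⟨d, b, rfl, hd, h⟩ := exists_primitive ha
  have hb : b ≠ 0 := by rintro rfl; simp at ha
  rw [coeff_smul_adamsSum ψ _ _ hb hd h, coeff_smul_adamsSum ψ _ _ hb hd h]
  have h1 : ∀ p ∈ d.divisorsAntidiagonal, u p.1 • ψ p.1.toPNat' (coeff (p.2 • b) (adamsSum ψ v f)) =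
      ∑ s ∈ p.2.divisorsAntidiagonal,
        (u p.1 * v s.1) • ψ (p.1 * s.1).toPNat' (coeff (s.2 • b) f) := by
    intro p hp
    rw [Nat.mem_divisorsAntidiagonal] at hp
    have hp1 : p.1 ≠ 0 := by rintro h0; rw [h0, zero_mul] at hp; omega
    have hp2 : p.2 ≠ 0 := by rintro h0; rw [h0, mul_zero] at hp; omega
    rw [coeff_smul_adamsSum ψ _ _ hb hp2, map_sum, Finset.smul_sum]
    · refine Finset.sum_congr rfl fun s hs => ?_
      rw [Nat.mem_divisorsAntidiagonal] at hs
      have hs1 : s.1 ≠ 0 := by rintro h0; rw [h0, zero_mul] at hs; omega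
      have h2 : (p.1 * s.1).toPNat' = p.1.toPNat' * s.1.toPNat' := by
        apply PNat.coe_injective
        rw [PNat.mul_coe, Nat.toPNat'_coe, Nat.toPNat'_coe, Nat.toPNat'_coe,
          if_pos (by positivity), if_pos (by positivity), if_pos (by positivity)]
      rw [map_rat_smul, hψ.mul, h2, smul_smul]
    -- The inner formula needs `p.2` to be divisible by every common divisor of the exponents of
    -- `p.2 • b`. Multiplying such a divisor by `p.1` gives one for `d • b`.
    · intro n hn
      have h3 := h (p.1 * n) fun i => by
        have := hn i
        rw [Finsupp.smul_apply, smul_eq_mul] at this ⊢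
        rw [← hp.1, mul_assoc]
        exact Nat.mul_dvd_mul_left _ this
      rw [← hp.1] at h3
      exact Nat.dvd_of_mul_dvd_mul_left (Nat.pos_of_ne_zero hp1) h3
  have h2 : ∀ p ∈ d.divisorsAntidiagonal, (u * v) p.1 • ψ p.1.toPNat' (coeff (p.2 • b) f) =
      ∑ s ∈ p.1.divisorsAntidiagonal, (u s.1 * v s.2) • ψ p.1.toPNat' (coeff (p.2 • b) f) := by
    intro p _
    rw [ArithmeticFunction.mul_apply, Finset.sum_smul]
  rw [Finset.sum_congr rfl h1, Finset.sum_congr rfl h2, Finset.sum_sigma', Finset.sum_sigma']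
  -- Both sides are sums over factorizations of `d` into three factors; the bijection regroups them.
  refine Finset.sum_nbij' (fun x => ⟨(x.1.1 * x.2.1, x.2.2), (x.1.1, x.2.1)⟩)
    (fun x => ⟨(x.2.1, x.2.2 * x.1.2), (x.2.2, x.1.2)⟩) ?_ ?_ ?_ ?_ ?_
  · rintro ⟨⟨i, j⟩, ⟨k, l⟩⟩ hx
    simp only [Finset.mem_sigma, Nat.mem_divisorsAntidiagonal] at hx ⊢
    obtain ⟨⟨rfl, h1⟩, ⟨rfl, h2⟩⟩ := hx
    simp_all [mul_assoc]
  · rintro ⟨⟨i, j⟩, ⟨k, l⟩⟩ hx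
    simp only [Finset.mem_sigma, Nat.mem_divisorsAntidiagonal] at hx ⊢
    obtain ⟨⟨rfl, h1⟩, ⟨rfl, h2⟩⟩ := hx
    simp_all [mul_assoc]
  · rintro ⟨⟨i, j⟩, ⟨k, l⟩⟩ hx
    simp only [Finset.mem_sigma, Nat.mem_divisorsAntidiagonal] at hx
    obtain ⟨⟨rfl, h1⟩, ⟨rfl, h2⟩⟩ := hx
    rfl
  · rintro ⟨⟨i, j⟩, ⟨k, l⟩⟩ hx
    simp only [Finset.mem_sigma, Nat.mem_divisorsAntidiagonal] at hx
    obtain ⟨⟨rfl, h1⟩, ⟨rfl, h2⟩⟩ := hx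
    rfl
  · rintro ⟨⟨i, j⟩, ⟨k, l⟩⟩ _
    rfl

theorem adamsSum_one {ψ : ℕ+ → R →+* R} (hψ : IsAdams ψ) {f : MvPowerSeries σ R}
    (hf : constantCoeff f = 0) : adamsSum ψ 1 f = f := by
  ext a
  by_cases ha : a = 0
  · subst ha; simp [coeff_adamsSum, hf]
  obtain ⟨d, b, rfl, hd, h⟩ := exists_primitive ha
  have hb : b ≠ 0 := by rintro rfl; simp at ha
  rw [coeff_smul_adamsSum ψ _ _ hb hd h, Finset.sum_eq_single (1, d)]
  · rw [ArithmeticFunction.one_one, one_smul]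
    exact hψ.one _
  · intro p hp hne
    rw [Nat.mem_divisorsAntidiagonal] at hp
    have : p.1 ≠ 1 := by
      intro h1
      apply hne
      ext
      · exact h1
      · rw [h1, one_mul] at hp; exact hp.1
    rw [ArithmeticFunction.one_apply_ne this, zero_smul]
  · intro h
    exact absurd (Nat.mem_divisorsAntidiagonal.mpr ⟨one_mul d, hd⟩) h

/-- The function `n ↦ 1 / n`. -/
def recip : ArithmeticFunction ℚ := ⟨fun n => (n : ℚ)⁻¹, by simp⟩

/-- The function `n ↦ μ(n) / n`. -/
def moebiusRecip : ArithmeticFunction ℚ :=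
  ⟨fun n => (ArithmeticFunction.moebius n : ℚ) / n, by simp⟩

/-- The reciprocals of the two factors multiply to the constant `1 / d`, which comes out of the
convolution and leaves `μ * ζ = 1`. -/
theorem moebiusRecip_mul_recip : moebiusRecip * recip = 1 := by
  ext d
  by_cases hd : d = 0
  · simp [hd]
  have h1 : (moebiusRecip * recip) d = (d : ℚ)⁻¹ * ((∑ p ∈ d.divisorsAntidiagonal,
      ArithmeticFunction.moebius p.1 : ℤ) : ℚ) := by
    rw [ArithmeticFunction.mul_apply, Int.cast_sum, Finset.mul_sum]
    refine Finset.sum_congr rfl fun p hp => ?_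
    rw [Nat.mem_divisorsAntidiagonal] at hp
    rw [← hp.1]
    simp only [moebiusRecip, recip, ArithmeticFunction.coe_mk]
    push_cast
    rw [mul_inv]
    ring
  have h2 : (∑ p ∈ d.divisorsAntidiagonal, ArithmeticFunction.moebius p.1 : ℤ) =
      (1 : ArithmeticFunction ℤ) d := by
    rw [← ArithmeticFunction.moebius_mul_coe_zeta, ArithmeticFunction.mul_apply]
    refine Finset.sum_congr rfl fun p hp => ?_
    rw [Nat.mem_divisorsAntidiagonal] at hp
    have : p.2 ≠ 0 := by rintro h0; rw [h0, mul_zero] at hp; omega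
    simp [this]
  rw [h1, h2]
  by_cases h : d = 1
  · subst h; simp
  · rw [ArithmeticFunction.one_apply_ne h, ArithmeticFunction.one_apply_ne h]; simp

theorem psiInv_eq (ψ : ℕ+ → R →+* R) (f : MvPowerSeries σ R) :
    psiInv ψ f = adamsSum ψ moebiusRecip f := rfl

theorem constantCoeff_Log (ψ : ℕ+ → R →+* R) (f : MvPowerSeries σ R) :
    constantCoeff (Log ψ f) = 0 :=
  constantCoeff_adamsSum ψ moebiusRecip (log f)

/-- The series `∑_n ψ_n(f) / n`. -/
def psi (ψ : ℕ+ → R →+* R) (f : MvPowerSeries σ R) : MvPowerSeries σ R := adamsSum ψ recip f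

theorem psi_psiInv {ψ : ℕ+ → R →+* R} (hψ : IsAdams ψ) {f : MvPowerSeries σ R}
    (hf : constantCoeff f = 0) : psi ψ (psiInv ψ f) = f := by
  rw [psi, psiInv_eq, adamsSum_adamsSum hψ, mul_comm, moebiusRecip_mul_recip, adamsSum_one hψ hf]

theorem psiInv_psi {ψ : ℕ+ → R →+* R} (hψ : IsAdams ψ) {f : MvPowerSeries σ R}
    (hf : constantCoeff f = 0) : psiInv ψ (psi ψ f) = f := by
  rw [psi, psiInv_eq, adamsSum_adamsSum hψ, moebiusRecip_mul_recip, adamsSum_one hψ hf]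

/-- The plethystic logarithm is characterised by its Euler derivative. -/
theorem Log_eq_iff {ψ : ℕ+ → R →+* R} (hψ : IsAdams ψ) {f g : MvPowerSeries σ R}
    (hf : constantCoeff f = 1) (hg : constantCoeff g = 0) :
    Log ψ f = g ↔ f * euler (psi ψ g) = euler f := by
  rw [← log_eq_iff hf (show constantCoeff (psi ψ g) = 0 from constantCoeff_adamsSum _ _ _), Log]
  constructor
  · rintro rfl
    rw [psi_psiInv hψ (constantCoeff_log hf)]
  · intro h
    rw [h, psiInv_psi hψ hg]

theorem eq_of_Log_eq {ψ : ℕ+ → R →+* R} (hψ : IsAdams ψ) {f f' : MvPowerSeries σ R}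
    (hf : constantCoeff f = 1) (hf' : constantCoeff f' = 1) (h : Log ψ f = Log ψ f') : f = f' := by
  have h0 : constantCoeff (Log ψ f') = 0 := constantCoeff_Log ψ f'
  exact eq_of_euler (hf.trans hf'.symm) ((Log_eq_iff hψ hf h0).mp h) ((Log_eq_iff hψ hf' h0).mp rfl)

/-- This plethystic exponential is what constructs the polynomial versions of the orbit counts. -/
theorem exists_Log_eq {ψ : ℕ+ → R →+* R} (hψ : IsAdams ψ) {g : MvPowerSeries σ R}
    (hg : constantCoeff g = 0) :
    ∃ f : MvPowerSeries σ R, constantCoeff f = 1 ∧ Log ψ f = g := by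
  obtain ⟨f, hf, h⟩ := exists_log_eq (constantCoeff_adamsSum ψ recip g)
  exact ⟨f, hf, by rw [Log, h]; exact psiInv_psi hψ hg⟩

theorem coeff_euler_psi (ψ : ℕ+ → R →+* R) (g : MvPowerSeries σ R) (a : σ →₀ ℕ) :
    coeff a (euler (psi ψ g)) = ∑ n ∈ Finset.range a.degree,
      ((a.degree : ℚ) / (n + 1 : ℕ)) • coeff a (adams ψ n.succPNat g) := by
  rw [coeff_euler, psi, coeff_adamsSum, ← Nat.cast_smul_eq_nsmul ℚ, Finset.smul_sum]
  refine Finset.sum_congr rfl fun n _ => ?_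
  rw [smul_smul]
  rfl

/-- Compatibility of the plethystic logarithm with homomorphisms of coefficients. -/
theorem Log_map {S : Type*} [CommRing S] [Algebra ℚ S] {ψ : ℕ+ → R →+* R} {ψ' : ℕ+ → S →+* S}
    (hψ : IsAdams ψ) (hψ' : IsAdams ψ') (φ : R →+* S) (h : ∀ n x, φ (ψ n x) = ψ' n (φ x))
    {f : MvPowerSeries σ R} (hf : constantCoeff f = 1) :
    Log ψ' (map φ f) = map φ (Log ψ f) := by
  have h0 : constantCoeff (Log ψ f) = 0 := constantCoeff_Log ψ f
  have hm : ∀ g : MvPowerSeries σ R, map φ (euler g) = euler (map φ g) := fun g => by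
    ext a
    rw [coeff_map, coeff_euler, coeff_euler, coeff_map, map_nsmul]
  have hp : ∀ g : MvPowerSeries σ R, map φ (psi ψ g) = psi ψ' (map φ g) := fun g => by
    ext a
    rw [coeff_map, psi, psi, coeff_adamsSum, coeff_adamsSum, map_sum]
    refine Finset.sum_congr rfl fun n _ => ?_
    rw [map_rat_smul, ← coeff_map, adams, map_expand, adams]
    congr 4
    ext b
    simp only [coeff_map, h]
  rw [Log_eq_iff hψ' (by simp [hf]) (by simp [h0]), ← hp, ← hm, ← map_mul,
    (Log_eq_iff hψ hf h0).mp rfl, hm]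

end Plethysm

end

noncomputable section

/-! ### Counting multisets fixed by a permutation -/

namespace FixedMultiset

open Finset Function

variable {I : Type*} (F : Equiv.Perm I)

/-- The multiset `{N, F N, …, F^{n-1} N}`. -/
def cyc (n : ℕ) (N : I) : Multiset I := (Multiset.range n).map fun i => (F ^ i) N

theorem cyc_add (m n : ℕ) (N : I) (h : (F ^ m) N = N) : cyc F (m + n) N = cyc F m N + cyc F n N := by
  rw [cyc, cyc, cyc, Multiset.range_add, Multiset.map_add, Multiset.map_map]
  congr 1
  refine Multiset.map_congr rfl fun i _ => ?_
  rw [Function.comp_apply, add_comm, pow_add, Equiv.Perm.mul_apply, h]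

theorem cyc_mul {r : ℕ} {N : I} (h : (F ^ r) N = N) (j : ℕ) : cyc F (j * r) N = j • cyc F r N := by
  induction j with
  | zero => simp [cyc]
  | succ j ih =>
    rw [add_mul, one_mul, add_comm, cyc_add F r _ N h, ih, succ_nsmul, add_comm]

/-- The multiset `{N, F N, …, F^n N}` is split in two ways: removing its first element leaves the
image under `F`, and removing its last one, which equals `N`, leaves the original. -/
theorem map_cyc {n : ℕ} {N : I} (h : (F ^ n) N = N) : (cyc F n N).map F = cyc F n N := by
  have h1 : cyc F (n + 1) N = N ::ₘ (cyc F n N).map F := by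
    rw [add_comm, cyc, Multiset.range_add, Multiset.map_add, Multiset.map_map, cyc, Multiset.map_map]
    simp only [Multiset.range_succ, Multiset.range_zero, Multiset.map_cons, pow_zero,
      Multiset.map_zero, Equiv.Perm.one_apply, Multiset.cons_add, zero_add]
    congr 1
    refine Multiset.map_congr rfl fun i _ => ?_
    simp [pow_add]
  have h2 : cyc F (n + 1) N = N ::ₘ cyc F n N := by
    rw [cyc, Multiset.range_succ, Multiset.map_cons, h]; rfl
  rw [h1] at h2
  exact (Multiset.cons_inj_right N).mp h2

theorem mem_cyc {n : ℕ} (hn : n ≠ 0) (N : I) : N ∈ cyc F n N :=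
  Multiset.mem_map.mpr ⟨0, Multiset.mem_range.mpr (Nat.pos_of_ne_zero hn), by simp⟩

theorem nodup_cyc (N : I) : (cyc F (minimalPeriod F N) N).Nodup := by
  refine Multiset.Nodup.map_on ?_ (Multiset.nodup_range _)
  intro i hi j hj h
  rw [Multiset.mem_range] at hi hj
  rw [← Equiv.Perm.iterate_eq_pow, ← Equiv.Perm.iterate_eq_pow] at h
  exact (iterate_eq_iterate_iff_of_lt_minimalPeriod hi hj).mp h

theorem pow_apply_eq_iff {n : ℕ} {N : I} : (F ^ n) N = N ↔ minimalPeriod F N ∣ n := by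
  rw [← Equiv.Perm.iterate_eq_pow, ← isPeriodicPt_iff_minimalPeriod_dvd]; rfl

variable {F}

theorem count_pow_apply [DecidableEq I] {s : Multiset I} (hs : s.map F = s) (N : I) (i : ℕ) :
    s.count ((F ^ i) N) = s.count N := by
  induction i with
  | zero => rfl
  | succ i ih =>
    rw [pow_succ', Equiv.Perm.mul_apply, ← ih]
    conv_lhs => rw [← hs]
    exact Multiset.count_map_eq_count' _ _ F.injective _

/-- The type `I` may be infinite, but the orbit of `N` stays in the finite support of the fixed
multiset `s`. -/
theorem minimalPeriod_pos {s : Multiset I} (hs : s.map F = s) {N : I} (hN : N ∈ s) :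
    0 < minimalPeriod F N := by
  classical
  have hmem : ∀ i, (F ^ i) N ∈ s.toFinset := fun i => by
    rw [Multiset.mem_toFinset, ← Multiset.count_pos, count_pow_apply hs]
    exact Multiset.count_pos.mpr hN
  obtain ⟨i, hi, j, hj, hne, he⟩ : ∃ i ∈ range (s.toFinset.card + 1),
      ∃ j ∈ range (s.toFinset.card + 1), i ≠ j ∧ (F ^ i) N = (F ^ j) N :=
    exists_ne_map_eq_of_card_lt_of_maps_to (by simp) fun i _ => hmem i
  wlog hij : i < j generalizing i j
  · exact this j hj i hi hne.symm he.symm (by omega)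
  have : (F ^ (j - i)) N = N := by
    apply (F ^ i).injective
    rw [← Equiv.Perm.mul_apply, ← pow_add, Nat.add_sub_cancel' hij.le, he]
  refine minimalPeriod_pos_of_mem_periodicPts ⟨j - i, by omega, ?_⟩
  rw [← Equiv.Perm.iterate_eq_pow] at this
  exact this

/-- The multiplicity is constant along orbits of a fixed multiset, so `j` copies of the orbit of `N`
fit exactly when `j` is at most the multiplicity of `N`. The middle alternative covers elements that
are not periodic, whose `minimalPeriod` is `0`. -/
theorem cyc_le_iff [DecidableEq I] {s : Multiset I} (hs : s.map F = s) (N : I) (j : ℕ) :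
    cyc F (j * minimalPeriod F N) N ≤ s ↔ j = 0 ∨ minimalPeriod F N = 0 ∨ j ≤ s.count N := by
  rw [cyc_mul F ((pow_apply_eq_iff F).mpr dvd_rfl)]
  constructor
  · intro h
    by_cases h0 : minimalPeriod F N = 0
    · exact Or.inr (Or.inl h0)
    · refine Or.inr (Or.inr ?_)
      have := Multiset.count_le_of_le N h
      rw [Multiset.count_nsmul, Multiset.count_eq_one_of_mem (nodup_cyc F N) (mem_cyc F h0 N)] at this
      omega
  · rintro (h | h | h)
    · simp [h]
    · simp [h, cyc]
    · rw [Multiset.le_iff_count]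
      intro M
      rw [Multiset.count_nsmul]
      by_cases hM : M ∈ cyc F (minimalPeriod F N) N
      · rw [Multiset.count_eq_one_of_mem (nodup_cyc F N) hM]
        obtain ⟨i, _, rfl⟩ := Multiset.mem_map.mp hM
        rw [count_pow_apply hs]
        omega
      · rw [Multiset.count_eq_zero_of_notMem hM]
        simp

variable {σ : Type*} (wt : I → σ →₀ ℕ)

/-- The weight of a multiset. -/
def weight (s : Multiset I) : σ →₀ ℕ := (s.map wt).sum

theorem weight_add (s t : Multiset I) : weight wt (s + t) = weight wt s + weight wt t := by
  simp [weight]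

variable {wt}

theorem weight_cyc (hF : ∀ N, wt (F N) = wt N) (n : ℕ) (N : I) :
    weight wt (cyc F n N) = n • wt N := by
  have : ∀ i, wt ((F ^ i) N) = wt N := fun i => by
    induction i with
    | zero => rfl
    | succ i ih => rw [pow_succ', Equiv.Perm.mul_apply, hF, ih]
  have h : (wt ∘ fun i => (F ^ i) N) = fun _ => wt N := funext this
  rw [weight, cyc, Multiset.map_map, h]
  simp

/-- The admissible lengths `n + 1` are the multiples `j r` of the period `r` with `1 ≤ j ≤ s.count
N`. The bound by the degree excludes none of them, as weights are nonzero. This turns the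
multiplicity of `N` into a number of removable cycles. -/
theorem card_cyc_le [DecidableEq I] (hF : ∀ N, wt (F N) = wt N) (hwt : ∀ N, wt N ≠ 0)
    {s : Multiset I} (hs : s.map F = s) {N : I} (hN : N ∈ s) :
    #{n ∈ range (weight wt s).degree | (F ^ (n + 1)) N = N ∧ cyc F (n + 1) N ≤ s} = s.count N := by
  have hr := minimalPeriod_pos hs hN
  set r := minimalPeriod F N
  rw [← Finset.card_range (s.count N)]
  symm
  -- The lengths are stored as `n` with length `n + 1`, hence the subtraction of `1`.
  refine Finset.card_bij (fun j _ => (j + 1) * r - 1) ?_ ?_ ?_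
  · intro j hj
    rw [mem_range] at hj
    have h1 : 0 < (j + 1) * r := by positivity
    have hle : cyc F ((j + 1) * r) N ≤ s := (cyc_le_iff hs N (j + 1)).mpr (Or.inr (Or.inr hj))
    rw [mem_filter, mem_range, Nat.sub_add_cancel h1, pow_apply_eq_iff]
    refine ⟨?_, dvd_mul_left _ _, hle⟩
    obtain ⟨t, ht⟩ := Multiset.le_iff_exists_add.mp hle
    have h2 : (weight wt s).degree = (j + 1) * r * (wt N).degree + (weight wt t).degree := by
      rw [ht, weight_add, weight_cyc hF, map_add, map_nsmul, smul_eq_mul]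
    have h3 : (wt N).degree ≠ 0 := fun h => hwt N ((Finsupp.degree_eq_zero_iff _).mp h)
    have h4 : (j + 1) * r ≤ (j + 1) * r * (wt N).degree :=
      Nat.le_mul_of_pos_right _ (Nat.pos_of_ne_zero h3)
    omega
  · intro i _ j _ h
    have h1 : 0 < (i + 1) * r := by positivity
    have h2 : 0 < (j + 1) * r := by positivity
    have h3 : (i + 1) * r = (j + 1) * r := by omega
    have := Nat.eq_of_mul_eq_mul_right hr h3
    omega
  · intro n hn
    rw [mem_filter, pow_apply_eq_iff] at hn
    obtain ⟨j, hj⟩ := hn.2.1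
    have hj0 : j ≠ 0 := by rintro rfl; simp at hj
    obtain ⟨i, rfl⟩ := Nat.exists_eq_succ_of_ne_zero hj0
    refine ⟨i, ?_, ?_⟩
    · have h1 := hn.2.2
      rw [hj, mul_comm] at h1
      rcases (cyc_le_iff hs N (i + 1)).mp h1 with h | h | h
      · omega
      · omega
      · exact mem_range.mpr h
    · rw [mul_comm]
      change r * (i + 1) - 1 = n
      change n + 1 = r * (i + 1) at hj
      omega

/-- The multisets of weight `a` fixed by `F`. -/
def fixedOfWeight (F : Equiv.Perm I) (wt : I → σ →₀ ℕ) (a : σ →₀ ℕ) : Set (Multiset I) :=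
  {s | weight wt s = a ∧ s.map F = s}

/-- The elements `N` fixed by `F ^ n` such that `n` times the weight of `N` is `c`. -/
def periodicOfWeight (F : Equiv.Perm I) (wt : I → σ →₀ ℕ) (n : ℕ) (c : σ →₀ ℕ) : Set I :=
  {N | n • wt N = c ∧ (F ^ n) N = N}

/-- Each such `N` occurs in a fixed multiset of weight `c`, namely its own cycle of length `n`. -/
theorem finite_periodicOfWeight (hF : ∀ N, wt (F N) = wt N)
    (hfin : ∀ a, (fixedOfWeight F wt a).Finite) {n : ℕ} (hn : n ≠ 0) (c : σ →₀ ℕ) :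
    (periodicOfWeight F wt n c).Finite := by
  classical
  refine ((hfin c).biUnion fun s _ => s.toFinset.finite_toSet).subset fun N hN => ?_
  rw [Set.mem_iUnion₂]
  exact ⟨cyc F n N, ⟨(weight_cyc hF n N).trans hN.1, map_cyc F hN.2⟩, by simpa using mem_cyc F hn N⟩

/-- With `f` the generating series of fixed multisets, this is the coefficient at `x ^ a` of `euler
f = f · ∑ deg(wt N) x ^ (n wt N)`, the sum being over `n ≥ 1` and `N` fixed by `F ^ n`. The degree
of the weight of `s` is the sum of `deg (wt N)` over its elements with multiplicity. By
`card_cyc_le` that multiplicity counts the cycles through `N` contained in `s`, and removing the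
cycle splits `s` into a smaller fixed multiset and the pair `(n, N)`. -/
theorem degree_mul_card [DecidableEq σ] (hF : ∀ N, wt (F N) = wt N) (hwt : ∀ N, wt N ≠ 0)
    (hfin : ∀ a, (fixedOfWeight F wt a).Finite) (a : σ →₀ ℕ) :
    a.degree * (fixedOfWeight F wt a).ncard =
      ∑ p ∈ HasAntidiagonal.antidiagonal a, (fixedOfWeight F wt p.1).ncard *
        ∑ n ∈ range p.2.degree, ∑ᶠ N ∈ periodicOfWeight F wt (n + 1) p.2, (wt N).degree := by
  classical
  let T : (σ →₀ ℕ) → Finset (Multiset I) := fun a => (hfin a).toFinset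
  let Q : ℕ → (σ →₀ ℕ) → Finset I := fun n c =>
    (finite_periodicOfWeight hF hfin (Nat.succ_ne_zero n) c).toFinset
  have hT : ∀ a s, s ∈ T a ↔ weight wt s = a ∧ s.map F = s := fun a s => by
    simp [T, fixedOfWeight]
  have hQ : ∀ n c N, N ∈ Q n c ↔ (n + 1) • wt N = c ∧ (F ^ (n + 1)) N = N := fun n c N => by
    simp [Q, periodicOfWeight]
  have hL : a.degree * (fixedOfWeight F wt a).ncard = ∑ s ∈ T a, ∑ N ∈ s.toFinset,
      ∑ n ∈ range a.degree with (F ^ (n + 1)) N = N ∧ cyc F (n + 1) N ≤ s, (wt N).degree := by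
    rw [Set.ncard_eq_toFinset_card _ (hfin a), mul_comm, ← smul_eq_mul, ← Finset.sum_const]
    refine Finset.sum_congr rfl fun s hs => ?_
    obtain ⟨rfl, h2⟩ := (hT a s).mp hs
    have h1 : ∀ N ∈ s.toFinset, (∑ n ∈ range (weight wt s).degree with
        (F ^ (n + 1)) N = N ∧ cyc F (n + 1) N ≤ s, (wt N).degree) =
        s.count N • (wt N).degree := fun N hN => by
      rw [Finset.sum_const, card_cyc_le hF hwt h2 (Multiset.mem_toFinset.mp hN)]
    rw [Finset.sum_congr rfl h1, ← Finset.sum_multiset_map_count, weight, map_multiset_sum,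
      Multiset.map_map]
    rfl
  have hR : ∀ p : (σ →₀ ℕ) × (σ →₀ ℕ), (fixedOfWeight F wt p.1).ncard *
        ∑ n ∈ range p.2.degree, ∑ᶠ N ∈ periodicOfWeight F wt (n + 1) p.2, (wt N).degree =
      ∑ s ∈ T p.1, ∑ n ∈ range p.2.degree, ∑ N ∈ Q n p.2, (wt N).degree := fun p => by
    rw [Finset.sum_const, Set.ncard_eq_toFinset_card _ (hfin _), smul_eq_mul]
    congr 1
    refine Finset.sum_congr rfl fun n _ => ?_
    exact finsum_mem_eq_finite_toFinset_sum _
      (finite_periodicOfWeight hF hfin (Nat.succ_ne_zero n) p.2)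
  rw [hL, Finset.sum_congr rfl fun p _ => hR p]
  simp only [Finset.sum_sigma']
  -- One direction removes the cycle from the multiset, the other adds it back; both summands are
  -- `deg (wt N)`.
  refine Finset.sum_nbij'
    (fun x => ⟨(weight wt (x.1 - cyc F (x.2.2 + 1) x.2.1), (x.2.2 + 1) • wt x.2.1),
      x.1 - cyc F (x.2.2 + 1) x.2.1, x.2.2, x.2.1⟩)
    (fun x => ⟨x.2.1 + cyc F (x.2.2.1 + 1) x.2.2.2, x.2.2.2, x.2.2.1⟩) ?_ ?_ ?_ ?_ ?_
  · rintro ⟨s, N, n⟩ hx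
    simp only [Finset.mem_sigma, hT, Multiset.mem_toFinset, mem_filter, mem_range] at hx
    obtain ⟨⟨h1, h2⟩, hN, hn, h3, h4⟩ := hx
    have hsc : s - cyc F (n + 1) N + cyc F (n + 1) N = s := Multiset.sub_add_cancel h4
    simp only [Finset.mem_sigma, hT, mem_range, hQ, HasAntidiagonal.mem_antidiagonal, true_and]
    refine ⟨?_, ?_, ?_, h3⟩
    · rw [← weight_cyc hF, ← weight_add, hsc, h1]
    · have h5 := h2
      rw [← hsc, Multiset.map_add, map_cyc F h3] at h5
      exact Multiset.add_left_inj.mp h5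
    · rw [map_nsmul, smul_eq_mul]
      have h3 : (wt N).degree ≠ 0 := fun h => hwt N ((Finsupp.degree_eq_zero_iff _).mp h)
      exact Nat.lt_of_succ_le (Nat.le_mul_of_pos_right _ (Nat.pos_of_ne_zero h3))
  · rintro ⟨p, s, n, N⟩ hx
    simp only [Finset.mem_sigma, hT, mem_range, hQ, HasAntidiagonal.mem_antidiagonal] at hx
    obtain ⟨h1, ⟨h2, h3⟩, hn, h4, h5⟩ := hx
    simp only [Finset.mem_sigma, hT, Multiset.mem_toFinset, mem_filter, mem_range]
    refine ⟨⟨?_, ?_⟩, ?_, ?_, h5, Multiset.le_add_left _ _⟩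
    · rw [weight_add, weight_cyc hF, h2, h4, h1]
    · rw [Multiset.map_add, h3, map_cyc F h5]
    · exact Multiset.mem_add.mpr (Or.inr (mem_cyc F n.succ_ne_zero N))
    · rw [← h1, map_add]; omega
  · rintro ⟨s, N, n⟩ hx
    simp only [Finset.mem_sigma, hT, Multiset.mem_toFinset, mem_filter, mem_range] at hx
    obtain ⟨⟨h1, h2⟩, hN, hn, h3, h4⟩ := hx
    simp [Multiset.sub_add_cancel h4]
  · rintro ⟨⟨p1, p2⟩, s, n, N⟩ hx
    simp only [Finset.mem_sigma, hT, mem_range, hQ, HasAntidiagonal.mem_antidiagonal] at hx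
    obtain ⟨h1, ⟨h2, h3⟩, hn, h4, h5⟩ := hx
    simp only [Multiset.add_sub_cancel_right, h2, h4]
  · rintro ⟨s, N, n⟩ _
    rfl

end FixedMultiset

end

noncomputable section

/-! ### Vector spaces with operators and subspaces -/

/-- A vector space with a family of operators and a family of subspaces. -/
@[ext]
structure LinSys (A J K V : Type*) [Field K] [AddCommGroup V] [Module K V] where
  op : A → V →ₗ[K] V
  sub : J → Submodule K V

namespace LinSys

variable {A J K : Type*} [Field K]
variable {V W U X Y : Type*} [AddCommGroup V] [Module K V] [AddCommGroup W] [Module K W]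
  [AddCommGroup U] [Module K U] [AddCommGroup X] [Module K X] [AddCommGroup Y] [Module K Y]

/-- The space of morphisms. -/
def hom (M : LinSys A J K V) (N : LinSys A J K W) : Submodule K (V →ₗ[K] W) where
  carrier := {f | (∀ a v, f (M.op a v) = N.op a (f v)) ∧ ∀ j, ∀ v ∈ M.sub j, f v ∈ N.sub j}
  add_mem' := fun hf hg => ⟨fun a v => by simp [hf.1, hg.1],
    fun j v hv => add_mem (hf.2 j v hv) (hg.2 j v hv)⟩
  zero_mem' := ⟨fun a v => by simp, fun j v _ => zero_mem _⟩
  smul_mem' := fun c f hf => ⟨fun a v => by simp [hf.1],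
    fun j v hv => Submodule.smul_mem _ c (hf.2 j v hv)⟩

theorem id_mem_hom (M : LinSys A J K V) : LinearMap.id ∈ hom M M :=
  ⟨fun _ _ => rfl, fun _ _ h => h⟩

theorem comp_mem_hom {M : LinSys A J K V} {N : LinSys A J K W} {P : LinSys A J K U}
    {g : W →ₗ[K] U} {f : V →ₗ[K] W} (hg : g ∈ hom N P) (hf : f ∈ hom M N) : g ∘ₗ f ∈ hom M P :=
  ⟨fun a v => by simp [hf.1, hg.1], fun j v hv => hg.2 j _ (hf.2 j v hv)⟩

/-- The endomorphism algebra. -/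
def endo (M : LinSys A J K V) : Subalgebra K (Module.End K V) where
  toSubsemiring :=
    { carrier := hom M M
      mul_mem' := fun hf hg => comp_mem_hom hf hg
      one_mem' := id_mem_hom M
      add_mem' := fun hf hg => (hom M M).add_mem hf hg
      zero_mem' := (hom M M).zero_mem }
  algebraMap_mem' := fun c => by
    have h := (hom M M).smul_mem c (id_mem_hom M)
    rwa [show algebraMap K (Module.End K V) c = c • LinearMap.id from
      Algebra.algebraMap_eq_smul_one c]

/-- Isomorphism. -/
def Iso (M : LinSys A J K V) (N : LinSys A J K W) : Prop :=
  ∃ e : V ≃ₗ[K] W, (∀ a v, e (M.op a v) = N.op a (e v)) ∧ ∀ j v, v ∈ M.sub j ↔ e v ∈ N.sub j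

theorem Iso.refl (M : LinSys A J K V) : M.Iso M := ⟨LinearEquiv.refl K V, fun _ _ => rfl, fun _ _ => Iff.rfl⟩

theorem Iso.symm {M : LinSys A J K V} {N : LinSys A J K W} (h : M.Iso N) : N.Iso M := by
  obtain ⟨e, h1, h2⟩ := h
  refine ⟨e.symm, fun a v => ?_, fun j v => ?_⟩
  · rw [LinearEquiv.symm_apply_eq, h1, LinearEquiv.apply_symm_apply]
  · rw [h2, LinearEquiv.apply_symm_apply]

theorem Iso.trans {M : LinSys A J K V} {N : LinSys A J K W} {P : LinSys A J K U} (h : M.Iso N)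
    (h' : N.Iso P) : M.Iso P := by
  obtain ⟨e, h1, h2⟩ := h
  obtain ⟨f, h3, h4⟩ := h'
  exact ⟨e.trans f, fun a v => by simp [h1, h3], fun j v => by
    rw [h2, h4, LinearEquiv.trans_apply]⟩

theorem iso_iff {M : LinSys A J K V} {N : LinSys A J K W} :
    M.Iso N ↔ ∃ f ∈ hom M N, ∃ g ∈ hom N M, g ∘ₗ f = LinearMap.id ∧ f ∘ₗ g = LinearMap.id := by
  constructor
  · rintro ⟨e, h1, h2⟩
    refine ⟨e, ⟨h1, fun j v => (h2 j v).mp⟩, e.symm, ⟨fun a v => ?_, fun j v hv => ?_⟩, ?_, ?_⟩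
    · simp [LinearEquiv.symm_apply_eq, h1]
    · rw [h2]; simpa using hv
    · ext; simp
    · ext; simp
  · rintro ⟨f, hf, g, hg, h1, h2⟩
    refine ⟨LinearEquiv.ofLinearMap f g h2 h1, hf.1, fun j v => ⟨hf.2 j v, fun h => ?_⟩⟩
    have h3 := hg.2 j _ h
    rwa [LinearEquiv.coe_ofLinearMap, ← LinearMap.comp_apply, h1] at h3

/-- The direct sum. -/
def prod (M : LinSys A J K V) (N : LinSys A J K W) : LinSys A J K (V × W) where
  op a := (M.op a).prodMap (N.op a)
  sub j := (M.sub j).prod (N.sub j)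

theorem Iso.prod {M : LinSys A J K V} {N : LinSys A J K W} {P : LinSys A J K U}
    {Q : LinSys A J K X} (h : M.Iso N) (h' : P.Iso Q) : (M.prod P).Iso (N.prod Q) := by
  obtain ⟨e, h1, h2⟩ := h
  obtain ⟨f, h3, h4⟩ := h'
  exact ⟨LinearEquiv.prodCongr e f, fun a v => by simp [LinSys.prod, h1, h3], fun j v => by
    simp [LinSys.prod, Submodule.mem_prod, h2 j, h4 j]⟩

theorem prod_comm (M : LinSys A J K V) (N : LinSys A J K W) : (M.prod N).Iso (N.prod M) :=
  ⟨LinearEquiv.prodComm K V W, fun a v => rfl, fun j v => by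
    simp [LinSys.prod, Submodule.mem_prod, and_comm]⟩

theorem prod_assoc (M : LinSys A J K V) (N : LinSys A J K W) (P : LinSys A J K U) :
    ((M.prod N).prod P).Iso (M.prod (N.prod P)) :=
  ⟨LinearEquiv.prodAssoc K V W U, fun a v => rfl, fun j v => by
    simp [LinSys.prod, Submodule.mem_prod, and_assoc]⟩

theorem prod_iso_left (M : LinSys A J K V) (N : LinSys A J K W) [Subsingleton W] :
    (M.prod N).Iso M := by
  refine iso_iff.mpr ⟨LinearMap.fst K V W, ⟨fun _ _ => rfl, fun _ _ h => h.1⟩,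
    LinearMap.inl K V W, ⟨fun a v => ?_, fun j v h => ⟨h, ?_⟩⟩, ?_, ?_⟩
  · exact Prod.ext rfl (Subsingleton.elim _ _)
  · exact zero_mem _
  · ext1 <;> ext v
    · rfl
    · exact Subsingleton.elim _ _
    · simp [Subsingleton.elim v 0]
    · exact Subsingleton.elim _ _
  · ext v; rfl

theorem fst_mem_hom (M : LinSys A J K V) (N : LinSys A J K W) :
    LinearMap.fst K V W ∈ hom (M.prod N) M := ⟨fun _ _ => rfl, fun _ _ h => h.1⟩

theorem snd_mem_hom (M : LinSys A J K V) (N : LinSys A J K W) :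
    LinearMap.snd K V W ∈ hom (M.prod N) N := ⟨fun _ _ => rfl, fun _ _ h => h.2⟩

theorem inl_mem_hom (M : LinSys A J K V) (N : LinSys A J K W) :
    LinearMap.inl K V W ∈ hom M (M.prod N) :=
  ⟨fun a v => by simp [LinSys.prod], fun _ _ h => ⟨h, zero_mem _⟩⟩

theorem inr_mem_hom (M : LinSys A J K V) (N : LinSys A J K W) :
    LinearMap.inr K V W ∈ hom N (M.prod N) :=
  ⟨fun a v => by simp [LinSys.prod], fun _ _ h => ⟨zero_mem _, h⟩⟩

/-- The restriction to a stable subspace. -/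
def restrict (M : LinSys A J K V) (p : Submodule K V) (hp : ∀ a, ∀ v ∈ p, M.op a v ∈ p) :
    LinSys A J K p where
  op a := (M.op a).restrict (hp a)
  sub j := (M.sub j).comap p.subtype

/-- The transport of structure along a linear equivalence. -/
def transport (M : LinSys A J K V) (e : V ≃ₗ[K] W) : LinSys A J K W where
  op a := e.toLinearMap ∘ₗ M.op a ∘ₗ e.symm.toLinearMap
  sub j := (M.sub j).comap e.symm.toLinearMap

theorem iso_transport (M : LinSys A J K V) (e : V ≃ₗ[K] W) : M.Iso (M.transport e) :=
  ⟨e, fun a v => by simp [transport], fun j v => by simp [transport]⟩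

theorem op_mem_ker {M : LinSys A J K V} {e : Module.End K V} (he : e ∈ endo M) (a : A) :
    ∀ v ∈ LinearMap.ker e, M.op a v ∈ LinearMap.ker e := fun v hv => by
  rw [LinearMap.mem_ker] at hv ⊢
  rw [he.1, hv, map_zero]

/-- An idempotent splits off its range. -/
theorem exists_iso_prod_of_idem {M : LinSys A J K V} {e : Module.End K V} (he : e ∈ endo M)
    (hee : e * e = e) :
    M.Iso ((M.restrict (LinearMap.ker (1 - e)) (op_mem_ker ((endo M).sub_mem (endo M).one_mem he))).prod
      (M.restrict (LinearMap.ker e) (op_mem_ker he))) := by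
  have h1 : ∀ v, e (e v) = e v := fun v => LinearMap.congr_fun hee v
  refine iso_iff.mpr ⟨(e.codRestrict _ fun v => ?_).prod ((1 - e).codRestrict _ fun v => ?_), ⟨?_, ?_⟩,
    (LinearMap.coprod (Submodule.subtype _) (Submodule.subtype _)), ⟨?_, ?_⟩, ?_, ?_⟩
  · simp [h1]
  · simp [h1]
  · intro a v
    apply Prod.ext <;> apply Subtype.ext
    · exact he.1 a v
    · exact ((endo M).sub_mem (endo M).one_mem he).1 a v
  · exact fun j v hv => ⟨he.2 j v hv, ((endo M).sub_mem (endo M).one_mem he).2 j v hv⟩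
  · rintro a ⟨v, w⟩
    simp [LinSys.prod, restrict]
  · rintro j ⟨v, w⟩ ⟨hv, hw⟩
    exact add_mem hv hw
  · ext v
    simp
  · apply LinearMap.ext
    rintro ⟨⟨v, hv⟩, ⟨w, hw⟩⟩
    have hv' : e v = v := by
      rw [LinearMap.mem_ker, LinearMap.sub_apply, sub_eq_zero] at hv
      exact hv.symm
    have hw' : e w = 0 := hw
    apply Prod.ext <;> apply Subtype.ext <;> simp [hv', hw']

/-- Indecomposability, in terms of idempotent endomorphisms. -/
def Indec (M : LinSys A J K V) : Prop :=
  Nontrivial V ∧ ∀ e ∈ endo M, e * e = e → e = 0 ∨ e = 1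

theorem Indec.of_iso {M : LinSys A J K V} {N : LinSys A J K W} (h : M.Iso N) (hM : M.Indec) :
    N.Indec := by
  obtain ⟨f, hf, g, hg, h1, h2⟩ := iso_iff.mp h
  obtain ⟨e, _⟩ := h
  refine ⟨haveI := hM.1; e.symm.toEquiv.nontrivial, fun x hx hxx => ?_⟩
  have hx' : ∀ w, x (x w) = x w := fun w => LinearMap.congr_fun hxx w
  have h1' : ∀ v, g (f v) = v := fun v => LinearMap.congr_fun h1 v
  have h2' : ∀ w, f (g w) = w := fun w => LinearMap.congr_fun h2 w
  rcases hM.2 (g ∘ₗ x ∘ₗ f) (comp_mem_hom hg (comp_mem_hom hx hf)) (by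
    ext v; simp [h2', hx']) with h3 | h3
  · left
    ext w
    have := LinearMap.congr_fun h3 (g w)
    simp only [LinearMap.comp_apply, h2', LinearMap.zero_apply] at this
    rw [← h2' (x w), this, map_zero]; rfl
  · right
    ext w
    have := LinearMap.congr_fun h3 (g w)
    simp only [LinearMap.comp_apply, h2', Module.End.one_apply] at this
    rw [← h2' (x w), this, h2']; rfl

theorem Indec.prod {M : LinSys A J K V} {N : LinSys A J K W} (h : (M.prod N).Indec) :
    Subsingleton V ∨ Subsingleton W := by
  have h1 : LinearMap.inl K V W ∘ₗ LinearMap.fst K V W ∈ endo (M.prod N) :=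
    comp_mem_hom (inl_mem_hom M N) (fst_mem_hom M N)
  rcases h.2 _ h1 (by ext v <;> simp) with h2 | h2
  · left
    refine ⟨fun v w => ?_⟩
    have hv := LinearMap.congr_fun h2 (v, 0)
    have hw := LinearMap.congr_fun h2 (w, 0)
    simp only [LinearMap.comp_apply, LinearMap.zero_apply, LinearMap.fst_apply,
      LinearMap.inl_apply] at hv hw
    exact (congrArg Prod.fst hv).trans (congrArg Prod.fst hw).symm
  · right
    refine ⟨fun v w => ?_⟩
    have hv := LinearMap.congr_fun h2 (0, v)
    have hw := LinearMap.congr_fun h2 (0, w)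
    simp only [LinearMap.comp_apply, Module.End.one_apply, LinearMap.fst_apply,
      LinearMap.inl_apply] at hv hw
    exact (congrArg Prod.snd hv).symm.trans (congrArg Prod.snd hw)

end LinSys

/-! ### Finite-dimensional algebras without idempotents -/

section FittingAlgebra

/-- Fitting's lemma. -/
theorem isNilpotent_or_isUnit_of_idem (K : Type*) {B : Type*} [Field K] [Ring B] [Algebra K B]
    [FiniteDimensional K B] (h : ∀ e : B, e * e = e → e = 0 ∨ e = 1) (x : B) :
    IsNilpotent x ∨ IsUnit x := by
  -- For large `n` the algebra is the direct sum of the kernel and the range of left multiplication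
  -- by `x ^ n`. Writing `1 = k + x ^ n z` accordingly gives the idempotent `x ^ n z`. The condition
  -- `n ≥ 1` is used only when this idempotent is `1`, to exhibit a right inverse of `x`.
  obtain ⟨n, hn0, hn⟩ := ((LinearMap.mulLeft K x).eventually_isCompl_ker_pow_range_pow.and
    (Filter.eventually_ge_atTop 1)).exists
  have hpow : ∀ y, ((LinearMap.mulLeft K x) ^ n) y = x ^ n * y := fun y => by
    rw [LinearMap.pow_mulLeft, LinearMap.mulLeft_apply]
  have h1 : (1 : B) ∈ LinearMap.ker ((LinearMap.mulLeft K x) ^ n) ⊔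
      LinearMap.range ((LinearMap.mulLeft K x) ^ n) := by
    rw [hn0.sup_eq_top]; trivial
  obtain ⟨k, hk, e, ⟨z, rfl⟩, hke⟩ := Submodule.mem_sup.mp h1
  rw [LinearMap.mem_ker, hpow] at hk
  rw [hpow] at hke
  -- As `k = 1 - x ^ n z`, the product lies in the kernel and in the range.
  have h2 : k * (x ^ n * z) = 0 := by
    have : k * (x ^ n * z) ∈ LinearMap.ker ((LinearMap.mulLeft K x) ^ n) ⊓
        LinearMap.range ((LinearMap.mulLeft K x) ^ n) := by
      refine ⟨?_, z - z * (x ^ n * z), ?_⟩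
      · rw [SetLike.mem_coe, LinearMap.mem_ker, hpow, ← mul_assoc, hk, zero_mul]
      · rw [hpow, eq_sub_of_add_eq hke]
        noncomm_ring
    rwa [hn0.inf_eq_bot, Submodule.mem_bot] at this
  rcases h (x ^ n * z) (by
    have : (k + x ^ n * z) * (x ^ n * z) = x ^ n * z := by rw [hke, one_mul]
    rwa [add_mul, h2, zero_add] at this) with h3 | h3
  · left
    refine ⟨n, ?_⟩
    rw [h3, add_zero] at hke
    rwa [hke, mul_one] at hk
  · right
    obtain ⟨m, rfl⟩ : ∃ m, n = m + 1 := ⟨n - 1, by omega⟩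
    rw [pow_succ', mul_assoc] at h3
    have : IsArtinianRing B := IsArtinianRing.of_finite K B
    exact IsUnit.of_mul_eq_one _ h3

/-- In a finite-dimensional algebra without idempotents the nilpotent elements are closed under
addition. -/
theorem isNilpotent_add_of_idem (K : Type*) {B : Type*} [Field K] [Ring B] [Algebra K B]
    [FiniteDimensional K B] [Nontrivial B] (h : ∀ e : B, e * e = e → e = 0 ∨ e = 1) {x y : B} (hx : IsNilpotent x) (hy : IsNilpotent y) : IsNilpotent (x + y) := by
  rcases isNilpotent_or_isUnit_of_idem K h (x + y) with h1 | ⟨u, hu⟩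
  · exact h1
  exfalso
  -- If the sum were a unit `u`, then `u⁻¹ x` and `u⁻¹ y` would add up to `1`, and one of them would
  -- be a unit, making `x` or `y` both a unit and nilpotent.
  have h2 : ↑u⁻¹ * x + ↑u⁻¹ * y = (1 : B) := by rw [← mul_add, ← hu, Units.inv_mul]
  rcases isNilpotent_or_isUnit_of_idem K h (↑u⁻¹ * x) with h3 | h3
  · have h4 : IsUnit (↑u⁻¹ * y) := by
      rw [← sub_eq_of_eq_add' h2.symm]
      exact h3.isUnit_one_sub
    rw [Units.isUnit_units_mul] at h4
    exact hy.not_isUnit h4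
  · rw [Units.isUnit_units_mul] at h3
    exact hx.not_isUnit h3

end FittingAlgebra

end

noncomputable section

/-! ### Multiplicities of indecomposable summands -/

theorem Submodule.finrank_prod_eq {K V W : Type*} [Field K] [AddCommGroup V] [Module K V]
    [AddCommGroup W] [Module K W] [FiniteDimensional K V] [FiniteDimensional K W]
    (p : Submodule K V) (q : Submodule K W) :
    Module.finrank K (p.prod q) = Module.finrank K p + Module.finrank K q := by
  have h : p.prod q = LinearMap.range (p.subtype.prodMap q.subtype) := by
    rw [LinearMap.range_prodMap, Submodule.range_subtype, Submodule.range_subtype]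
  rw [h, LinearMap.finrank_range_of_inj, Module.finrank_prod]
  exact Function.Injective.prodMap p.injective_subtype q.injective_subtype

namespace LinSys

variable {A J K : Type*} [Field K]
variable {V W U X Y : Type*} [AddCommGroup V] [Module K V] [AddCommGroup W] [Module K W]
  [AddCommGroup U] [Module K U] [AddCommGroup X] [Module K X] [AddCommGroup Y] [Module K Y]

theorem Indec.idem {M : LinSys A J K V} (hM : M.Indec) (e : endo M) (he : e * e = e) :
    e = 0 ∨ e = 1 := by
  rcases hM.2 e e.2 (congrArg Subtype.val he) with h | h
  · exact Or.inl (Subtype.ext h)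
  · exact Or.inr (Subtype.ext h)

theorem isNilpotent_endo {M : LinSys A J K V} {e : endo M} :
    IsNilpotent e ↔ IsNilpotent (e : Module.End K V) := by
  constructor <;> rintro ⟨n, hn⟩
  · exact ⟨n, by simpa using congrArg Subtype.val hn⟩
  · exact ⟨n, Subtype.ext (by simpa using hn)⟩

/-- A split injection from a nonzero object to an indecomposable one is an isomorphism. -/
theorem iso_of_split {I : LinSys A J K V} {M : LinSys A J K W}
    (hI : Nontrivial V) (hM : M.Indec) {f : V →ₗ[K] W} (hf : f ∈ hom I M) {g : W →ₗ[K] V}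
    (hg : g ∈ hom M I) (h : g ∘ₗ f = LinearMap.id) : I.Iso M := by
  have h' : ∀ v, g (f v) = v := fun v => LinearMap.congr_fun h v
  refine iso_iff.mpr ⟨f, hf, g, hg, h, ?_⟩
  rcases hM.2 (f ∘ₗ g) (comp_mem_hom hf hg) (by ext v; simp [h']) with h1 | h1
  · exfalso
    obtain ⟨v, hv⟩ := exists_ne (0 : V)
    apply hv
    have := LinearMap.congr_fun h1 (f v)
    rw [LinearMap.comp_apply, h', LinearMap.zero_apply] at this
    rw [← h' v, this, map_zero]
  · exact h1

variable [FiniteDimensional K V]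

theorem Indec.nilpotent_or_inverse {M : LinSys A J K V} (hM : M.Indec) {f : Module.End K V}
    (hf : f ∈ endo M) : IsNilpotent f ∨ ∃ g ∈ endo M, g * f = 1 ∧ f * g = 1 := by
  rcases isNilpotent_or_isUnit_of_idem K hM.idem (⟨f, hf⟩ : endo M) with h | ⟨u, hu⟩
  · exact Or.inl (isNilpotent_endo.mp h)
  · right
    have hu' : (u : endo M).1 = f := congrArg Subtype.val hu
    refine ⟨(u⁻¹ : (endo M)ˣ).1.1, (u⁻¹ : (endo M)ˣ).1.2, ?_, ?_⟩
    · rw [← hu']; exact congrArg Subtype.val u.inv_mul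
    · rw [← hu']; exact congrArg Subtype.val u.mul_inv

theorem Indec.nilpotent_add {M : LinSys A J K V} (hM : M.Indec) {f g : Module.End K V}
    (hf : f ∈ endo M) (hg : g ∈ endo M) (hf' : IsNilpotent f) (hg' : IsNilpotent g) :
    IsNilpotent (f + g) := by
  have := hM.1
  exact isNilpotent_endo.mp (isNilpotent_add_of_idem K hM.idem (x := (⟨f, hf⟩ : endo M))
    (y := ⟨g, hg⟩) (isNilpotent_endo.mpr hf') (isNilpotent_endo.mpr hg'))

/-- The morphisms from `I` to `M` that are not split injections. -/
def rad {I : LinSys A J K V} (hI : I.Indec) (M : LinSys A J K W) : Submodule K (V →ₗ[K] W) where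
  carrier := {f | f ∈ hom I M ∧ ∀ g ∈ hom M I, IsNilpotent (g ∘ₗ f : Module.End K V)}
  add_mem' := fun {f f'} hf hf' => ⟨add_mem hf.1 hf'.1, fun g hg => by
    rw [LinearMap.comp_add]
    exact hI.nilpotent_add (comp_mem_hom hg hf.1) (comp_mem_hom hg hf'.1) (hf.2 g hg) (hf'.2 g hg)⟩
  zero_mem' := ⟨zero_mem _, fun g _ => by rw [LinearMap.comp_zero]; exact IsNilpotent.zero⟩
  smul_mem' := fun c f hf => ⟨Submodule.smul_mem _ c hf.1, fun g hg => by
    rw [LinearMap.comp_smul]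
    exact (hf.2 g hg).smul c⟩

/-- The dimension of the space of morphisms from `I` to `M` modulo those that are not split
injections, a multiple of the multiplicity of `I` in `M`. -/
def mult {I : LinSys A J K V} (hI : I.Indec) (M : LinSys A J K W) : ℤ :=
  Module.finrank K (hom I M) - Module.finrank K (rad hI M)

/-- Both spaces of morphisms decompose along the product. For `rad` the point is that a composite `I
→ M × N → I` is a sum of two nilpotent endomorphisms of the indecomposable `I`, hence nilpotent. -/
theorem mult_prod [FiniteDimensional K W] [FiniteDimensional K U] {I : LinSys A J K V}
    (hI : I.Indec) (M : LinSys A J K W) (N : LinSys A J K U) :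
    mult hI (M.prod N) = mult hI M + mult hI N := by
  have h1 : hom I (M.prod N) = ((hom I M).prod (hom I N)).map
      (LinearMap.prodEquiv K : ((V →ₗ[K] W) × (V →ₗ[K] U)) ≃ₗ[K] V →ₗ[K] W × U).toLinearMap := by
    ext f
    rw [Submodule.mem_map]
    constructor
    · intro hf
      exact ⟨(LinearMap.fst K W U ∘ₗ f, LinearMap.snd K W U ∘ₗ f),
        ⟨comp_mem_hom (fst_mem_hom M N) hf, comp_mem_hom (snd_mem_hom M N) hf⟩, rfl⟩
    · rintro ⟨⟨f1, f2⟩, ⟨hf1, hf2⟩, rfl⟩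
      exact ⟨fun a v => Prod.ext (hf1.1 a v) (hf2.1 a v), fun j v hv => ⟨hf1.2 j v hv, hf2.2 j v hv⟩⟩
  have h2 : rad hI (M.prod N) = ((rad hI M).prod (rad hI N)).map
      (LinearMap.prodEquiv K : ((V →ₗ[K] W) × (V →ₗ[K] U)) ≃ₗ[K] V →ₗ[K] W × U).toLinearMap := by
    ext f
    rw [Submodule.mem_map]
    constructor
    · intro hf
      refine ⟨(LinearMap.fst K W U ∘ₗ f, LinearMap.snd K W U ∘ₗ f),
        ⟨⟨comp_mem_hom (fst_mem_hom M N) hf.1, fun g hg => ?_⟩,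
          ⟨comp_mem_hom (snd_mem_hom M N) hf.1, fun g hg => ?_⟩⟩, rfl⟩
      · exact hf.2 _ (comp_mem_hom hg (fst_mem_hom M N))
      · exact hf.2 _ (comp_mem_hom hg (snd_mem_hom M N))
    · rintro ⟨⟨f1, f2⟩, ⟨hf1, hf2⟩, rfl⟩
      refine ⟨⟨fun a v => Prod.ext (hf1.1.1 a v) (hf2.1.1 a v),
        fun j v hv => ⟨hf1.1.2 j v hv, hf2.1.2 j v hv⟩⟩, fun g hg => ?_⟩
      have h3 := comp_mem_hom hg (inl_mem_hom M N)
      have h4 := comp_mem_hom hg (inr_mem_hom M N)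
      have h5 := hI.nilpotent_add (comp_mem_hom h3 hf1.1) (comp_mem_hom h4 hf2.1)
        (hf1.2 _ h3) (hf2.2 _ h4)
      convert h5 using 1
      ext v
      simp [← map_add]
  rw [mult, mult, mult, h1, h2, LinearEquiv.finrank_map_eq, LinearEquiv.finrank_map_eq,
    Submodule.finrank_prod_eq, Submodule.finrank_prod_eq]
  push_cast
  ring

theorem mult_iso {I : LinSys A J K V} (hI : I.Indec) {M : LinSys A J K W} {N : LinSys A J K U}
    (h : M.Iso N) : mult hI M = mult hI N := by
  obtain ⟨f, hf, g, hg, h1, h2⟩ := iso_iff.mp h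
  have h1' : ∀ v, g (f v) = v := fun v => LinearMap.congr_fun h1 v
  have h2' : ∀ v, f (g v) = v := fun v => LinearMap.congr_fun h2 v
  let e : (V →ₗ[K] W) ≃ₗ[K] (V →ₗ[K] U) := LinearEquiv.congrRight (LinearEquiv.ofLinearMap f g h2 h1)
  have he : ∀ x, e x = f ∘ₗ x := fun x => rfl
  have e1 : hom I N = (hom I M).map e.toLinearMap := by
    ext x
    rw [Submodule.mem_map]
    constructor
    · intro hx
      exact ⟨g ∘ₗ x, comp_mem_hom hg hx, by ext v; simp [he, h2']⟩
    · rintro ⟨y, hy, rfl⟩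
      change f ∘ₗ y ∈ hom I N
      exact comp_mem_hom hf hy
  have e2 : rad hI N = (rad hI M).map e.toLinearMap := by
    ext x
    rw [Submodule.mem_map]
    constructor
    · intro hx
      exact ⟨g ∘ₗ x, ⟨comp_mem_hom hg hx.1, fun y hy => hx.2 _ (comp_mem_hom hy hg)⟩,
        by ext v; simp [he, h2']⟩
    · rintro ⟨y, hy, rfl⟩
      change f ∘ₗ y ∈ rad hI N
      exact ⟨comp_mem_hom hf hy.1, fun z hz => hy.2 _ (comp_mem_hom hz hf)⟩
  rw [mult, mult, e1, e2, LinearEquiv.finrank_map_eq, LinearEquiv.finrank_map_eq]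

theorem mult_self_pos {I : LinSys A J K V} (hI : I.Indec) : 0 < mult hI I := by
  have h : rad hI I < hom I I := by
    refine lt_of_le_of_ne (fun f hf => hf.1) fun h => ?_
    have h1 : LinearMap.id ∈ rad hI I := by rw [h]; exact id_mem_hom I
    have := hI.1
    have h2 : IsNilpotent (1 : Module.End K V) := h1.2 _ (id_mem_hom I)
    exact not_isNilpotent_one h2
  have := Submodule.finrank_lt_finrank_of_lt h
  rw [mult]
  omega

/-- A composite `I → M → I` that is not nilpotent is invertible, so `I` would split off the
indecomposable `M`. -/
theorem mult_eq_zero {I : LinSys A J K V} (hI : I.Indec)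
    {M : LinSys A J K W} (hM : M.Indec) (h : ¬ I.Iso M) : mult hI M = 0 := by
  have h1 : rad hI M = hom I M := by
    refine le_antisymm (fun f hf => hf.1) fun f hf => ⟨hf, fun g hg => ?_⟩
    rcases hI.nilpotent_or_inverse (comp_mem_hom hg hf) with h2 | ⟨x, hx, h2, -⟩
    · exact h2
    · exact absurd (iso_of_split hI.1 hM hf (comp_mem_hom hx hg) h2) h
  rw [mult, h1, sub_self]

theorem mult_of_subsingleton [Subsingleton W] {I : LinSys A J K V} (hI : I.Indec)
    (M : LinSys A J K W) : mult hI M = 0 := by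
  have h : rad hI M = hom I M := by
    refine le_antisymm (fun f hf => hf.1) fun f hf => ?_
    rw [Subsingleton.elim f 0]
    exact zero_mem _
  rw [mult, h, sub_self]

end LinSys

/-! ### Isomorphism classes -/

/-- Isomorphism as an equivalence relation. -/
instance LinSys.setoid (A J K : Type*) [Field K] : Setoid (Σ n : ℕ, LinSys A J K (Fin n → K)) where
  r M N := M.2.Iso N.2
  iseqv := ⟨fun M => LinSys.Iso.refl M.2, LinSys.Iso.symm, LinSys.Iso.trans⟩

/-- The isomorphism classes of finite-dimensional vector spaces with operators and subspaces. -/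
def IsoClass (A J K : Type*) [Field K] : Type _ := Quotient (LinSys.setoid A J K)

namespace IsoClass

variable {A J K : Type*} [Field K]
variable {V W U : Type*} [AddCommGroup V] [Module K V] [AddCommGroup W] [Module K W]
  [AddCommGroup U] [Module K U] [FiniteDimensional K V] [FiniteDimensional K W]
  [FiniteDimensional K U]

/-- The isomorphism class of a system. -/
def mk (M : LinSys A J K V) : IsoClass A J K :=
  Quotient.mk _ ⟨Module.finrank K V, M.transport (Module.finBasis K V).equivFun⟩

theorem mk_eq_mk {M : LinSys A J K V} {N : LinSys A J K W} : mk M = mk N ↔ M.Iso N := by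
  have h1 := M.iso_transport (Module.finBasis K V).equivFun
  have h2 := N.iso_transport (Module.finBasis K W).equivFun
  exact Quotient.eq.trans ⟨fun h => (h1.trans h).trans h2.symm, fun h => (h1.symm.trans h).trans h2⟩

theorem quotient_mk (M : Σ n : ℕ, LinSys A J K (Fin n → K)) : Quotient.mk _ M = mk M.2 :=
  Quotient.sound (LinSys.iso_transport M.2 _)

theorem exists_rep (s : IsoClass A J K) : ∃ (n : ℕ) (M : LinSys A J K (Fin n → K)), s = mk M := by
  obtain ⟨M, rfl⟩ := Quotient.exists_rep s
  exact ⟨M.1, M.2, quotient_mk M⟩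

instance : Add (IsoClass A J K) :=
  ⟨Quotient.lift₂ (fun M N => mk (M.2.prod N.2)) fun _ _ _ _ h h' => mk_eq_mk.mpr (h.prod h')⟩

theorem mk_prod (M : LinSys A J K V) (N : LinSys A J K W) : mk (M.prod N) = mk M + mk N :=
  mk_eq_mk.mpr ((M.iso_transport _).prod (N.iso_transport _))

instance : Zero (IsoClass A J K) := ⟨mk (⟨fun _ => 0, fun _ => ⊤⟩ : LinSys A J K (Fin 0 → K))⟩

theorem mk_eq_zero {M : LinSys A J K V} : mk M = 0 ↔ Subsingleton V := by
  refine mk_eq_mk.trans ⟨fun ⟨e, _⟩ => e.toEquiv.subsingleton, fun h => ?_⟩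
  refine ⟨⟨0, 0, fun v => Subsingleton.elim _ _, fun v => Subsingleton.elim _ _⟩,
    fun a v => Subsingleton.elim _ _, fun j v => ?_⟩
  rw [Subsingleton.elim v 0, map_zero]
  exact iff_of_true (zero_mem _) (zero_mem _)

instance : AddCommMonoid (IsoClass A J K) where
  add_assoc s t u := by
    obtain ⟨_, M, rfl⟩ := exists_rep s
    obtain ⟨_, N, rfl⟩ := exists_rep t
    obtain ⟨_, P, rfl⟩ := exists_rep u
    rw [← mk_prod, ← mk_prod, ← mk_prod, ← mk_prod]
    exact mk_eq_mk.mpr (M.prod_assoc N P)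
  add_comm s t := by
    obtain ⟨_, M, rfl⟩ := exists_rep s
    obtain ⟨_, N, rfl⟩ := exists_rep t
    rw [← mk_prod, ← mk_prod]
    exact mk_eq_mk.mpr (M.prod_comm N)
  zero_add s := by
    obtain ⟨_, M, rfl⟩ := exists_rep s
    exact (mk_prod _ _).symm.trans (mk_eq_mk.mpr ((LinSys.prod_comm _ _).trans (M.prod_iso_left _)))
  add_zero s := by
    obtain ⟨_, M, rfl⟩ := exists_rep s
    exact (mk_prod _ _).symm.trans (mk_eq_mk.mpr (M.prod_iso_left _))
  nsmul := nsmulRec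

/-- The dimension. -/
def dim : IsoClass A J K →+ ℕ where
  toFun := Quotient.lift (fun M => M.1) fun M N ⟨e, _⟩ => by simpa using e.finrank_eq
  map_zero' := Module.finrank_fin_fun K
  map_add' s t := by
    obtain ⟨M, rfl⟩ := Quotient.exists_rep s
    obtain ⟨N, rfl⟩ := Quotient.exists_rep t
    change Module.finrank K ((Fin M.1 → K) × (Fin N.1 → K)) = M.1 + N.1
    simp

theorem dim_mk (M : LinSys A J K V) : dim (mk M) = Module.finrank K V := rfl

theorem dim_eq_zero {s : IsoClass A J K} : dim s = 0 ↔ s = 0 := by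
  obtain ⟨_, M, rfl⟩ := exists_rep s
  rw [dim_mk, mk_eq_zero, Module.finrank_zero_iff]

/-- Indecomposable classes. -/
def IsIndec (s : IsoClass A J K) : Prop := s ≠ 0 ∧ ∀ t u, s = t + u → t = 0 ∨ u = 0

/-- An idempotent endomorphism splits the object into two kernels, and a decomposition gives the
idempotent that projects to one factor. -/
theorem isIndec_mk {M : LinSys A J K V} : IsIndec (mk M) ↔ M.Indec := by
  rw [IsIndec, LinSys.Indec, ne_eq, mk_eq_zero, not_subsingleton_iff_nontrivial]
  refine and_congr_right fun hV => ⟨fun h e he hee => ?_, fun h t u htu => ?_⟩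
  · have h1 := LinSys.exists_iso_prod_of_idem he hee
    rw [← mk_eq_mk, mk_prod] at h1
    rcases h _ _ h1 with h2 | h2 <;> rw [mk_eq_zero] at h2
    · left
      have : ∀ v, e v ∈ LinearMap.ker (1 - e) := fun v => by
        have : e (e v) = e v := LinearMap.congr_fun hee v
        simp [this]
      ext v
      exact congrArg Subtype.val (Subsingleton.elim (⟨e v, this v⟩ : LinearMap.ker (1 - e)) 0)
    · right
      have : ∀ v, (1 - e) v ∈ LinearMap.ker e := fun v => by
        have : e (e v) = e v := LinearMap.congr_fun hee v
        simp [this]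
      ext v
      have h3 : (1 - e) v = 0 :=
        congrArg Subtype.val (Subsingleton.elim (⟨(1 - e) v, this v⟩ : LinearMap.ker e) 0)
      rw [LinearMap.sub_apply, sub_eq_zero] at h3
      exact h3.symm
  · obtain ⟨_, N, rfl⟩ := exists_rep t
    obtain ⟨_, P, rfl⟩ := exists_rep u
    rw [← mk_prod, mk_eq_mk] at htu
    rw [mk_eq_zero, mk_eq_zero]
    exact LinSys.Indec.prod (LinSys.Indec.of_iso htu ⟨hV, h⟩)

/-- The multiplicity of an indecomposable object. -/
def mult {I : LinSys A J K V} (hI : I.Indec) : IsoClass A J K →+ ℤ where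
  toFun := Quotient.lift (fun M => LinSys.mult hI M.2) fun _ _ h => LinSys.mult_iso hI h
  map_zero' := (LinSys.mult_iso hI (LinSys.iso_transport
    (⟨fun _ => 0, fun _ => ⊤⟩ : LinSys A J K (Fin 0 → K)) _)).symm.trans
      (LinSys.mult_of_subsingleton hI _)
  map_add' s t := by
    obtain ⟨M, rfl⟩ := Quotient.exists_rep s
    obtain ⟨N, rfl⟩ := Quotient.exists_rep t
    exact (LinSys.mult_iso hI (LinSys.iso_transport (M.2.prod N.2) _)).symm.trans
      (LinSys.mult_prod hI M.2 N.2)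

theorem mult_mk {I : LinSys A J K V} (hI : I.Indec) (M : LinSys A J K W) :
    mult hI (mk M) = LinSys.mult hI M := (LinSys.mult_iso hI (LinSys.iso_transport M _)).symm

/-- Every class is a sum of indecomposable ones. -/
theorem exists_multiset (s : IsoClass A J K) :
    ∃ m : Multiset (IsoClass A J K), (∀ t ∈ m, IsIndec t) ∧ m.sum = s := by
  induction hn : dim s using Nat.strong_induction_on generalizing s with
  | _ n ih =>
    by_cases h0 : s = 0
    · exact ⟨0, by simp, by simp [h0]⟩
    by_cases hs : IsIndec s
    · exact ⟨{s}, by simpa using hs, by simp⟩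
    simp only [IsIndec, not_and, not_forall, not_or] at hs
    obtain ⟨t, u, rfl, ht, hu⟩ := hs h0
    rw [← dim_eq_zero] at ht hu
    rw [map_add] at hn
    obtain ⟨m, hm, rfl⟩ := ih (dim t) (by omega) t rfl
    obtain ⟨m', hm', rfl⟩ := ih (dim u) (by omega) u rfl
    exact ⟨m + m', fun t ht => (Multiset.mem_add.mp ht).elim (hm t) (hm' t), by simp⟩

/-- The Krull–Schmidt theorem. -/
theorem multiset_eq_of_sum_eq {m m' : Multiset (IsoClass A J K)} (hm : ∀ t ∈ m, IsIndec t)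
    (hm' : ∀ t ∈ m', IsIndec t) (h : m.sum = m'.sum) : m = m' := by
  classical
  -- For every indecomposable class there is an additive function on all classes that returns a
  -- fixed nonzero multiple of its number of occurrences. The sum therefore determines every
  -- multiplicity.
  have key : ∀ (s : IsoClass A J K), IsIndec s → ∃ (c : ℤ) (φ : IsoClass A J K →+ ℤ), c ≠ 0 ∧
      ∀ m : Multiset (IsoClass A J K), (∀ t ∈ m, IsIndec t) → φ m.sum = c * m.count s := by
    intro s hs
    obtain ⟨_, I, rfl⟩ := exists_rep s
    have hI := isIndec_mk.mp hs
    refine ⟨LinSys.mult hI I, mult hI, (LinSys.mult_self_pos hI).ne', fun m => ?_⟩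
    induction m using Multiset.induction_on with
    | empty => simp
    | cons t m ih =>
      intro hm
      rw [Multiset.sum_cons, map_add, ih fun u hu => hm u (Multiset.mem_cons_of_mem hu),
        Multiset.count_cons]
      split_ifs with h
      · rw [← h, mult_mk]; push_cast; ring
      · have ht := hm t (Multiset.mem_cons_self t m)
        obtain ⟨_, M, rfl⟩ := exists_rep t
        rw [mult_mk, LinSys.mult_eq_zero hI (isIndec_mk.mp ht) fun h' => h (mk_eq_mk.mpr h')]
        simp
  ext s
  by_cases hs : IsIndec s
  · obtain ⟨c, φ, hc, hφ⟩ := key s hs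
    have := (hφ m hm).symm.trans ((congrArg φ h).trans (hφ m' hm'))
    exact_mod_cast mul_left_cancel₀ hc this
  · rw [Multiset.count_eq_zero_of_notMem fun h' => hs (hm s h'),
      Multiset.count_eq_zero_of_notMem fun h' => hs (hm' s h')]

/-- Cancellation holds for multisets, hence for classes by the Krull–Schmidt theorem. -/
theorem add_left_cancel' {s t u : IsoClass A J K} (h : s + t = s + u) : t = u := by
  obtain ⟨m, hm, rfl⟩ := exists_multiset s
  obtain ⟨n, hn, rfl⟩ := exists_multiset t
  obtain ⟨p, hp, rfl⟩ := exists_multiset u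
  rw [← Multiset.sum_add, ← Multiset.sum_add] at h
  have := multiset_eq_of_sum_eq
    (fun x hx => (Multiset.mem_add.mp hx).elim (hm x) (hn x))
    (fun x hx => (Multiset.mem_add.mp hx).elim (hm x) (hp x)) h
  rw [add_right_inj] at this
  rw [this]

end IsoClass

end

noncomputable section

/-! ### Extension of scalars -/

open TensorProduct

theorem Submodule.finrank_baseChange_eq {K L V : Type*} [Field K] [Field L] [Algebra K L]
    [AddCommGroup V] [Module K V] (p : Submodule K V) :
    Module.finrank L (p.baseChange L) = Module.finrank K p := by
  rw [Submodule.baseChange, LinearMap.finrank_range_of_inj, Module.finrank_baseChange]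
  exact Module.Flat.lTensor_preserves_injective_linearMap _ p.injective_subtype

theorem TensorProduct.linearMap_ext_one {K L V W : Type*} [Field K] [Field L] [Algebra K L]
    [AddCommGroup V] [Module K V] [AddCommGroup W] [Module L W] {f g : L ⊗[K] V →ₗ[L] W}
    (h : ∀ v : V, f (1 ⊗ₜ v) = g (1 ⊗ₜ v)) : f = g := by
  ext x
  induction x using TensorProduct.induction_on with
  | zero => simp
  | tmul l v =>
    have : l ⊗ₜ[K] v = l • ((1 : L) ⊗ₜ[K] v) := by rw [smul_tmul', smul_eq_mul, mul_one]
    rw [this, map_smul, map_smul, h]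
  | add x y hx hy => rw [map_add, map_add, hx, hy]

/-- The map `L ⊗ V → V` induced by a linear form on `L`. -/
def TensorProduct.slice {K L : Type*} (V : Type*) [Field K] [Field L] [Algebra K L]
    [AddCommGroup V] [Module K V] (φ : L →ₗ[K] K) : L ⊗[K] V →ₗ[K] V :=
  (TensorProduct.lid K V).toLinearMap ∘ₗ φ.rTensor V

theorem TensorProduct.slice_tmul {K L V : Type*} [Field K] [Field L] [Algebra K L]
    [AddCommGroup V] [Module K V] (φ : L →ₗ[K] K) (l : L) (v : V) :
    slice V φ (l ⊗ₜ v) = φ l • v := by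
  simp [slice]

/-- The basis of `L` may be infinite. Allowing every larger finite set makes it possible to use one
set for several vectors at once. -/
theorem TensorProduct.exists_expand {K L V B : Type*} [Field K] [Field L] [Algebra K L]
    [AddCommGroup V] [Module K V] (β : Module.Basis B K L) (x : L ⊗[K] V) :
    ∃ T : Finset B, ∀ T', T ⊆ T' → x = ∑ b ∈ T', β b ⊗ₜ slice V (β.coord b) x := by
  classical
  induction x using TensorProduct.induction_on with
  | zero => exact ⟨∅, fun T' _ => by simp⟩
  | tmul l v =>
    refine ⟨(β.repr l).support, fun T' hT => ?_⟩
    have h1 : ∀ b, β b ⊗ₜ[K] slice V (β.coord b) (l ⊗ₜ v) = (β.repr l b • β b) ⊗ₜ v := fun b => by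
      rw [slice_tmul, TensorProduct.tmul_smul, ← TensorProduct.smul_tmul']; rfl
    rw [Finset.sum_congr rfl fun b _ => h1 b, ← TensorProduct.sum_tmul,
      ← Finset.sum_subset hT fun b _ hb => by rw [Finsupp.notMem_support_iff.mp hb, zero_smul]]
    congr 1
    exact (β.linearCombination_repr l).symm
  | add x y hx hy =>
    obtain ⟨T, hT⟩ := hx
    obtain ⟨S, hS⟩ := hy
    refine ⟨T ∪ S, fun T' h => ?_⟩
    conv_lhs => rw [hT T' (Finset.union_subset_left h), hS T' (Finset.union_subset_right h)]
    rw [← Finset.sum_add_distrib]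
    exact Finset.sum_congr rfl fun b _ => by rw [map_add, tmul_add]

namespace LinSys

variable {A J K : Type*} [Field K]
variable {V W U X Y : Type*} [AddCommGroup V] [Module K V] [AddCommGroup W] [Module K W]
  [AddCommGroup U] [Module K U] [AddCommGroup X] [Module K X] [AddCommGroup Y] [Module K Y]
variable (L : Type*) [Field L] [Algebra K L]

/-- Extension of scalars. -/
def baseChange (M : LinSys A J K V) : LinSys A J L (L ⊗[K] V) where
  op a := (M.op a).baseChange L
  sub j := (M.sub j).baseChange L

theorem baseChange_mem_hom {M : LinSys A J K V} {N : LinSys A J K W} {f : V →ₗ[K] W}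
    (hf : f ∈ hom M N) : f.baseChange L ∈ hom (M.baseChange L) (N.baseChange L) := by
  refine ⟨fun a => LinearMap.congr_fun (?_ : f.baseChange L ∘ₗ (M.baseChange L).op a =
    (N.baseChange L).op a ∘ₗ f.baseChange L), fun j => ?_⟩
  · refine TensorProduct.linearMap_ext_one fun v => ?_
    simp [baseChange, hf.1]
  · change (M.sub j).baseChange L ≤ ((N.sub j).baseChange L).comap (f.baseChange L)
    rw [Submodule.baseChange_eq_span, Submodule.span_le]
    rintro _ ⟨v, hv, rfl⟩
    simp only [TensorProduct.mk_apply, Submodule.comap_coe, Set.mem_preimage,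
      LinearMap.baseChange_tmul]
    exact Submodule.tmul_mem_baseChange_of_mem _ (hf.2 j v hv)

theorem Iso.baseChange {M : LinSys A J K V} {N : LinSys A J K W} (h : M.Iso N) :
    (M.baseChange L).Iso (N.baseChange L) := by
  obtain ⟨f, hf, g, hg, h1, h2⟩ := iso_iff.mp h
  refine iso_iff.mpr ⟨_, baseChange_mem_hom L hf, _, baseChange_mem_hom L hg, ?_, ?_⟩
  · rw [← LinearMap.baseChange_comp, h1, LinearMap.baseChange_id]
  · rw [← LinearMap.baseChange_comp, h2, LinearMap.baseChange_id]

theorem prod_mem_hom {M : LinSys A J K V} {N : LinSys A J K W} {P : LinSys A J K U}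
    {f : V →ₗ[K] W} {g : V →ₗ[K] U} (hf : f ∈ hom M N) (hg : g ∈ hom M P) :
    f.prod g ∈ hom M (N.prod P) :=
  ⟨fun a v => Prod.ext (hf.1 a v) (hg.1 a v), fun j v hv => ⟨hf.2 j v hv, hg.2 j v hv⟩⟩

theorem coprod_mem_hom {M : LinSys A J K V} {N : LinSys A J K W} {P : LinSys A J K U}
    {f : V →ₗ[K] U} {g : W →ₗ[K] U} (hf : f ∈ hom M P) (hg : g ∈ hom N P) :
    f.coprod g ∈ hom (M.prod N) P :=
  ⟨fun a v => by simp [LinSys.prod, hf.1, hg.1], fun j v hv =>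
    add_mem (hf.2 j _ hv.1) (hg.2 j _ hv.2)⟩

theorem baseChange_prod (M : LinSys A J K V) (N : LinSys A J K W) :
    ((M.prod N).baseChange L).Iso ((M.baseChange L).prod (N.baseChange L)) := by
  refine iso_iff.mpr ⟨_, prod_mem_hom (baseChange_mem_hom L (fst_mem_hom M N))
    (baseChange_mem_hom L (snd_mem_hom M N)), _,
    coprod_mem_hom (baseChange_mem_hom L (inl_mem_hom M N))
    (baseChange_mem_hom L (inr_mem_hom M N)), ?_, ?_⟩
  · refine TensorProduct.linearMap_ext_one fun v => ?_
    simp [← tmul_add]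
  · apply LinearMap.prod_ext <;> refine TensorProduct.linearMap_ext_one fun v => ?_ <;> simp

theorem slice_op {M : LinSys A J K V} (φ : L →ₗ[K] K) (a : A) (x : L ⊗[K] V) :
    slice V φ ((M.baseChange L).op a x) = M.op a (slice V φ x) := by
  induction x using TensorProduct.induction_on with
  | zero => simp
  | tmul l v => simp [baseChange, slice_tmul]
  | add x y hx hy => simp [hx, hy]

theorem slice_mem {p : Submodule K V} (φ : L →ₗ[K] K) {x : L ⊗[K] V} (hx : x ∈ p.baseChange L) :
    slice V φ x ∈ p := by
  obtain ⟨y, rfl⟩ := hx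
  induction y using TensorProduct.induction_on with
  | zero => simp
  | tmul l v => simpa [slice_tmul] using Submodule.smul_mem _ _ v.2
  | add x y hx hy => rw [map_add, map_add]; exact add_mem hx hy

theorem slice_mem_hom {M : LinSys A J K V} {N : LinSys A J K W} {e : L ⊗[K] V →ₗ[L] L ⊗[K] W}
    (he : e ∈ hom (M.baseChange L) (N.baseChange L)) (φ : L →ₗ[K] K) :
    slice W φ ∘ₗ e.restrictScalars K ∘ₗ TensorProduct.mk K L V 1 ∈ hom M N := by
  refine ⟨fun a v => ?_, fun j v hv => ?_⟩
  · have h1 : (1 : L) ⊗ₜ[K] M.op a v = (M.baseChange L).op a (1 ⊗ₜ v) := rfl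
    simp only [LinearMap.comp_apply, LinearMap.coe_restrictScalars, TensorProduct.mk_apply]
    rw [h1, he.1, slice_op]
  · exact slice_mem L φ (he.2 j _ (Submodule.tmul_mem_baseChange_of_mem _ hv))

/-- Morphisms over `L` are `L`-combinations of morphisms over `K`: the coordinates of `e` with
respect to a basis of `L` over `K` are morphisms by `slice_mem_hom`, and finitely many suffice
because `V` is finite-dimensional. No finiteness of `L` over `K` is needed. -/
theorem exists_expand_hom [FiniteDimensional K V] {M : LinSys A J K V} {N : LinSys A J K W}
    {e : L ⊗[K] V →ₗ[L] L ⊗[K] W} (he : e ∈ hom (M.baseChange L) (N.baseChange L)) :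
    ∃ (T : Finset L) (f : L → V →ₗ[K] W), (∀ l, f l ∈ hom M N) ∧
      e = ∑ l ∈ T, l • (f l).baseChange L := by
  classical
  let β := Module.Basis.ofVectorSpace K L
  let b := Module.finBasis K V
  choose T hT using fun i => TensorProduct.exists_expand β (e (1 ⊗ₜ b i))
  let f : Module.Basis.ofVectorSpaceIndex K L → V →ₗ[K] W := fun l =>
    slice W (β.coord l) ∘ₗ e.restrictScalars K ∘ₗ TensorProduct.mk K L V 1
  have hf : ∀ l, f l ∈ hom M N := fun l => slice_mem_hom L he _
  have hinj : Function.Injective β := β.injective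
  -- The coordinates are indexed by elements of `L` itself, so that the statement mentions no basis;
  -- outside the basis the value `0` is used.
  refine ⟨(Finset.univ.biUnion T).image β, fun l => if h : ∃ i, β i = l then f h.choose else 0,
    fun l => ?_, ?_⟩
  · dsimp only
    split_ifs
    · exact hf _
    · exact zero_mem _
  · have h1 : ∀ i, (if h : ∃ i', β i' = β i then f h.choose else 0) = f i := fun i => by
      have h : ∃ i', β i' = β i := ⟨i, rfl⟩
      rw [dif_pos h, hinj h.choose_spec]
    rw [Finset.sum_image fun x _ y _ h => hinj h]
    simp only [h1]
    refine TensorProduct.linearMap_ext_one fun v => ?_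
    have h2 : e.restrictScalars K ∘ₗ TensorProduct.mk K L V 1 =
        (∑ i ∈ Finset.univ.biUnion T, β i • (f i).baseChange L).restrictScalars K ∘ₗ
          TensorProduct.mk K L V 1 := by
      refine b.ext fun i => ?_
      simp only [LinearMap.comp_apply, TensorProduct.mk_apply, LinearMap.coe_restrictScalars]
      rw [hT i _ (Finset.subset_biUnion_of_mem T (Finset.mem_univ i)), LinearMap.sum_apply]
      refine Finset.sum_congr rfl fun j _ => ?_
      rw [LinearMap.smul_apply, LinearMap.baseChange_tmul, smul_tmul', smul_eq_mul, mul_one]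
      rfl
    exact LinearMap.congr_fun h2 v

/-- If `I` is an indecomposable summand of `M` and `M`, `N` become isomorphic after an extension of
scalars, then `I` is a summand of `N`. -/
theorem exists_split_of_baseChange_iso [FiniteDimensional K V] [FiniteDimensional K W]
    [FiniteDimensional K U] {I : LinSys A J K V} (hI : I.Indec)
    {M : LinSys A J K W} {N : LinSys A J K U} (h : (M.baseChange L).Iso (N.baseChange L))
    {i : V →ₗ[K] W} (hi : i ∈ hom I M) {p : W →ₗ[K] V} (hp : p ∈ hom M I)
    (hpi : p ∘ₗ i = LinearMap.id) :
    ∃ i' ∈ hom I N, ∃ p' ∈ hom N I, p' ∘ₗ i' = LinearMap.id := by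
  by_contra hcon
  obtain ⟨e, he, e', he', hee, -⟩ := iso_iff.mp h
  -- If such a composite were not in the radical, then `f ∘ₗ i` would be a split injection of `I`
  -- into `N`.
  have key : ∀ f ∈ hom M N, ∀ f' ∈ hom N M, p ∘ₗ f' ∘ₗ f ∘ₗ i ∈ rad hI I := by
    intro f hf f' hf'
    have h1 : p ∘ₗ f' ∘ₗ f ∘ₗ i ∈ endo I :=
      comp_mem_hom hp (comp_mem_hom hf' (comp_mem_hom hf hi))
    refine ⟨h1, fun g hg => ?_⟩
    rcases hI.nilpotent_or_inverse (f := g ∘ₗ p ∘ₗ f' ∘ₗ f ∘ₗ i) (comp_mem_hom hg h1) with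
      h2 | ⟨x, hx, h2, -⟩
    · exact h2
    · exact absurd ⟨f ∘ₗ i, comp_mem_hom hf hi, x ∘ₗ g ∘ₗ p ∘ₗ f',
        comp_mem_hom hx (comp_mem_hom hg (comp_mem_hom hp hf')), h2⟩ hcon
  obtain ⟨T, f, hf, rfl⟩ := exists_expand_hom L he
  obtain ⟨T', f', hf', rfl⟩ := exists_expand_hom L he'
  obtain ⟨φ, hφ⟩ := LinearMap.exists_leftInverse_of_injective (Algebra.linearMap K L)
    (LinearMap.ker_eq_bot.mpr (algebraMap K L).injective)
  have hφ1 : φ 1 = 1 := by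
    have := LinearMap.congr_fun hφ 1
    simpa using this
  -- A `K`-linear retraction `φ` of `L` onto `K`, applied to `e' ∘ e = 1` expanded over `K`, writes
  -- the identity of `I` as a `K`-combination of composites from `key`. As `rad` is a subspace, the
  -- identity would be in it, which is absurd.
  have h3 : ∑ l' ∈ T', ∑ l ∈ T, φ (l' * l) • (p ∘ₗ f' l' ∘ₗ f l ∘ₗ i) = LinearMap.id := by
    ext v
    have h4 := LinearMap.congr_fun hee (1 ⊗ₜ i v)
    rw [LinearMap.id_apply] at h4
    have h5 := congrArg (fun x => p (slice W φ x)) h4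
    simp only [LinearMap.comp_apply, LinearMap.sum_apply, LinearMap.smul_apply, map_sum,
      LinearMap.baseChange_tmul, map_smul, smul_tmul', smul_eq_mul, mul_one, slice_tmul, hφ1,
      one_smul] at h5
    simp only [LinearMap.sum_apply, LinearMap.smul_apply, LinearMap.comp_apply]
    rw [Finset.sum_comm]
    have h6 : p (i v) = v := LinearMap.congr_fun hpi v
    rw [h6] at h5
    rw [LinearMap.id_apply]
    conv_rhs => rw [← h5]
  have h7 : LinearMap.id ∈ rad hI I := by
    rw [← h3]
    exact Submodule.sum_mem _ fun l' _ => Submodule.sum_mem _ fun l _ =>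
      Submodule.smul_mem _ _ (key _ (hf l) _ (hf' l'))
  have := hI.1
  have h8 : IsNilpotent (1 : Module.End K V) := h7.2 _ (id_mem_hom I)
  exact not_isNilpotent_one h8

/-- A split injection yields a direct sum decomposition. -/
theorem exists_iso_prod_of_split {I : LinSys A J K V} {N : LinSys A J K W}
    {i : V →ₗ[K] W} (hi : i ∈ hom I N) {p : W →ₗ[K] V} (hp : p ∈ hom N I)
    (h : p ∘ₗ i = LinearMap.id) :
    ∃ (q : Submodule K W) (N' : LinSys A J K q), N.Iso (I.prod N') := by
  have h' : ∀ v, p (i v) = v := fun v => LinearMap.congr_fun h v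
  have he : i ∘ₗ p ∈ endo N := comp_mem_hom hi hp
  have h1 := exists_iso_prod_of_idem he (by ext v; simp [h'])
  refine ⟨_, _, h1.trans (Iso.prod (iso_iff.mpr ?_) (Iso.refl _))⟩
  have hm : ∀ v, i v ∈ LinearMap.ker (1 - i ∘ₗ p : Module.End K W) := fun v => by simp [h']
  refine ⟨p ∘ₗ Submodule.subtype _, ⟨fun a v => ?_, fun j v hv => ?_⟩, i.codRestrict _ hm,
    ⟨fun a v => ?_, fun j v hv => ?_⟩, ?_, ?_⟩
  · simp [restrict, hp.1]
  · exact hp.2 j _ hv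
  · exact Subtype.ext (hi.1 a v)
  · exact hi.2 j v hv
  · ext ⟨v, hv⟩
    rw [LinearMap.mem_ker, LinearMap.sub_apply, sub_eq_zero] at hv
    exact hv.symm
  · ext v
    simp [h']

end LinSys

namespace IsoClass

variable {A J K : Type*} [Field K]
variable {V W U : Type*} [AddCommGroup V] [Module K V] [AddCommGroup W] [Module K W]
  [AddCommGroup U] [Module K U] [FiniteDimensional K V] [FiniteDimensional K W]
  [FiniteDimensional K U]
variable (L : Type*) [Field L] [Algebra K L]

/-- Extension of scalars. -/
def baseChange : IsoClass A J K →+ IsoClass A J L where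
  toFun := Quotient.lift (fun M => mk (M.2.baseChange L)) fun _ _ h =>
    mk_eq_mk.mpr (LinSys.Iso.baseChange L h)
  map_zero' := by
    refine mk_eq_zero.mpr ?_
    rw [← Module.finrank_zero_iff (R := L), Module.finrank_baseChange]
    exact (Module.finrank_fin_fun K).trans (Module.finrank_fin_fun K)
  map_add' s t := by
    obtain ⟨M, rfl⟩ := Quotient.exists_rep s
    obtain ⟨N, rfl⟩ := Quotient.exists_rep t
    exact (mk_eq_mk.mpr (((LinSys.iso_transport (M.2.prod N.2) _).baseChange L).symm.trans
      (LinSys.baseChange_prod L M.2 N.2))).trans (mk_prod _ _)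

theorem baseChange_mk (M : LinSys A J K V) : baseChange L (mk M) = mk (M.baseChange L) :=
  mk_eq_mk.mpr ((M.iso_transport _).baseChange L).symm

/-- The Noether–Deuring theorem. -/
theorem baseChange_injective : Function.Injective (baseChange (A := A) (J := J) (K := K) L) := by
  intro s t h
  induction hn : dim s using Nat.strong_induction_on generalizing s t with
  | _ n ih =>
    have hd : ∀ s : IsoClass A J K, dim (baseChange L s) = dim s := fun s => by
      obtain ⟨_, M, rfl⟩ := exists_rep s
      rw [baseChange_mk, dim_mk, dim_mk, Module.finrank_baseChange]
    by_cases h0 : s = 0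
    · subst h0
      rw [eq_comm, ← dim_eq_zero, ← hd, ← h, map_zero, map_zero]
    obtain ⟨m, hm, rfl⟩ := exists_multiset s
    -- An indecomposable summand of `s` is also a summand of `t`. After cancelling it over `L`, the
    -- induction applies to the remaining parts, of smaller dimension.
    obtain ⟨x, hx⟩ : ∃ x, x ∈ m := by
      refine Multiset.exists_mem_of_ne_zero fun h1 => h0 ?_
      rw [h1, Multiset.sum_zero]
    obtain ⟨m, rfl⟩ := Multiset.exists_cons_of_mem hx
    have hx' := hm x hx
    rw [Multiset.sum_cons] at *
    generalize m.sum = s' at *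
    obtain ⟨_, I, rfl⟩ := exists_rep x
    obtain ⟨_, M', rfl⟩ := exists_rep s'
    obtain ⟨_, N, rfl⟩ := exists_rep t
    have hI := isIndec_mk.mp hx'
    have h1 := h
    rw [← mk_prod, baseChange_mk, baseChange_mk, mk_eq_mk] at h1
    obtain ⟨i, hi, p, hp, hpi⟩ := LinSys.exists_split_of_baseChange_iso L hI h1
      (LinSys.inl_mem_hom I M') (LinSys.fst_mem_hom I M') (by ext; simp)
    obtain ⟨q, N', hN⟩ := LinSys.exists_iso_prod_of_split hi hp hpi
    rw [← mk_eq_mk, mk_prod] at hN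
    rw [hN, map_add, map_add] at h
    rw [hN, ih (dim (mk M')) ?_ (add_left_cancel' h) rfl]
    rw [← hn, map_add]
    have : dim (mk I) ≠ 0 := fun h => hx'.1 (dim_eq_zero.mp h)
    omega

end IsoClass

end

noncomputable section

/-! ### Frobenius-semilinear maps -/

section Lang

open Polynomial

variable {K Ω : Type*} [Field K] [Finite K] [Field Ω] [Algebra K Ω]

/-- The polynomial `X ^ q - X` has at most `q` roots, and the elements of `K` already provide that
many. -/
theorem exists_algebraMap_eq_of_pow_card {x : Ω} (hx : x ^ Nat.card K = x) :
    ∃ y : K, algebraMap K Ω y = x := by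
  classical
  have := Fintype.ofFinite K
  rw [Nat.card_eq_fintype_card] at hx
  by_contra h
  push Not at h
  have hQ : 1 < Fintype.card K := Fintype.one_lt_card
  have h1 : (X ^ Fintype.card K - X : Polynomial Ω) = 0 := by
    refine eq_zero_of_natDegree_lt_card_of_eval_eq_zero' _
      (insert x (Finset.univ.image (algebraMap K Ω))) (fun i hi => ?_) ?_
    · rw [eval_sub, eval_pow, eval_X, sub_eq_zero]
      rcases Finset.mem_insert.mp hi with rfl | hi
      · exact hx
      · obtain ⟨y, -, rfl⟩ := Finset.mem_image.mp hi
        rw [← map_pow, FiniteField.pow_card]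
    · rw [FiniteField.X_pow_card_sub_X_natDegree_eq Ω hQ, Finset.card_insert_of_notMem,
        Finset.card_image_of_injective _ (algebraMap K Ω).injective, Finset.card_univ]
      · omega
      · intro hx'
        obtain ⟨y, -, hy⟩ := Finset.mem_image.mp hx'
        exact h y hy
  exact FiniteField.X_pow_card_sub_X_ne_zero Ω hQ h1

theorem algebraMap_pow_card (y : K) : algebraMap K Ω y ^ Nat.card K = algebraMap K Ω y := by
  have := Fintype.ofFinite K
  rw [Nat.card_eq_fintype_card, ← map_pow, FiniteField.pow_card]

/-- The polynomial `X ^ (q ^ m) - X` is separable and splits. The number of its roots exceeds the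
degree of the additive polynomial that occurs in `span_fixed_eq_top`. -/
theorem exists_finset_pow_card [IsAlgClosed Ω] {m : ℕ} (hm : m ≠ 0) :
    ∃ s : Finset Ω, s.card = Nat.card K ^ m ∧ ∀ x ∈ s, x ^ Nat.card K ^ m = x := by
  classical
  have := Fintype.ofFinite K
  have hQ : 1 < Nat.card K := Finite.one_lt_card
  let p := ringChar Ω
  have hp : p ∣ Nat.card K ^ m := by
    rw [← CharP.cast_eq_zero_iff Ω p, Nat.cast_pow]
    have h1 : (Nat.card K : Ω) = 0 := by
      rw [← map_natCast (algebraMap K Ω), Nat.card_eq_fintype_card, FiniteField.cast_card_eq_zero,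
        map_zero]
    rw [h1, zero_pow hm]
  have hs := galois_poly_separable (K := Ω) p _ hp
  refine ⟨(X ^ Nat.card K ^ m - X : Polynomial Ω).roots.toFinset, ?_, fun x hx => ?_⟩
  · rw [Multiset.toFinset_card_of_nodup (nodup_roots hs), ← (IsAlgClosed.splits _).natDegree_eq_card_roots,
      FiniteField.X_pow_card_pow_sub_X_natDegree_eq Ω hm hQ]
  · rw [Multiset.mem_toFinset, mem_roots', IsRoot.def, eval_sub, eval_pow, eval_X, sub_eq_zero] at hx
    exact hx.2

variable {V : Type*} [AddCommGroup V] [Module Ω V] [FiniteDimensional Ω V]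

/-- The matrix of `θ` and the coordinates of `v` generate a finite extension `L` of `K`. The vectors
with coordinates in `L` form a finite set stable under the injective map `θ`, and all points of such
a set are periodic. -/
theorem mem_periodicPts_of_semilinear [Algebra.IsAlgebraic K Ω] {θ : V →+ V}
    (hinj : Function.Injective θ) (hθ : ∀ (c : Ω) v, θ (c • v) = c ^ Nat.card K • θ v) (v : V) :
    v ∈ Function.periodicPts θ := by
  classical
  let b := Module.finBasis Ω V
  let S : Set Ω := Set.range (fun x : Fin (Module.finrank Ω V) × Fin (Module.finrank Ω V) =>
    b.repr (θ (b x.1)) x.2) ∪ Set.range fun i => b.repr v i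
  have hS : Finite S := (Set.finite_range _).union (Set.finite_range _)
  let L := IntermediateField.adjoin K S
  have hL : FiniteDimensional K L :=
    IntermediateField.finiteDimensional_adjoin fun x _ => (Algebra.IsAlgebraic.isAlgebraic x).isIntegral
  have hLf : Finite L := Module.finite_of_finite K
  let T : Set V := {w | ∀ i, b.repr w i ∈ L}
  have hTf : Finite T := by
    refine Finite.of_injective (fun (w : T) i => (⟨b.repr w.1 i, w.2 i⟩ : L)) fun w w' h => ?_
    refine Subtype.ext (b.repr.injective (Finsupp.ext fun i => ?_))
    exact congrArg Subtype.val (congrFun h i)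
  have hT : ∀ w ∈ T, θ w ∈ T := by
    intro w hw i
    have h1 : θ w = ∑ j, b.repr w j ^ Nat.card K • θ (b j) := by
      conv_lhs => rw [← b.sum_repr w, map_sum]
      exact Finset.sum_congr rfl fun j _ => hθ _ _
    rw [h1, map_sum, Finsupp.finsetSum_apply]
    refine sum_mem fun j _ => ?_
    rw [map_smul, Finsupp.smul_apply, smul_eq_mul]
    exact mul_mem (pow_mem (hw j) _)
      (IntermediateField.subset_adjoin K S (Or.inl ⟨(j, i), rfl⟩))
  have hv : v ∈ T := fun i => IntermediateField.subset_adjoin K S (Or.inr ⟨i, rfl⟩)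
  let θ' : T → T := fun w => ⟨θ w.1, hT w.1 w.2⟩
  have hθ' : Function.Injective θ' := fun w w' h => Subtype.ext (hinj (congrArg Subtype.val h))
  obtain ⟨n, hn, h⟩ := hθ'.mem_periodicPts ⟨v, hv⟩
  refine ⟨n, hn, ?_⟩
  have h1 : ∀ n (w : T), ((θ'^[n] w : T) : V) = θ^[n] w := fun n => by
    induction n with
    | zero => exact fun w => rfl
    | succ n ih => exact fun w => by rw [Function.iterate_succ_apply, ih, Function.iterate_succ_apply]
  exact (h1 n ⟨v, hv⟩).symm.trans (congrArg Subtype.val h)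

/-- The fixed vectors of an injective Frobenius-semilinear map span the space. -/
theorem span_fixed_eq_top [Algebra.IsAlgebraic K Ω] [IsAlgClosed Ω] {θ : V →+ V}
    (hinj : Function.Injective θ) (hθ : ∀ (c : Ω) v, θ (c • v) = c ^ Nat.card K • θ v) :
    Submodule.span Ω {v | θ v = v} = ⊤ := by
  classical
  have hQ : 1 < Nat.card K := Finite.one_lt_card
  by_contra hne
  obtain ⟨f, hf0, hf⟩ := Submodule.exists_le_ker_of_lt_top _ (lt_top_iff_ne_top.mpr hne)
  refine hf0 (LinearMap.ext fun v => ?_)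
  obtain ⟨m, hm, hmv⟩ := mem_periodicPts_of_semilinear hinj hθ v
  -- Let `f` vanish on all fixed vectors and let `v` have period `m`. If `c ^ (q ^ m) = c`, then `∑
  -- c ^ (q ^ i) • θ^i v` is fixed by `θ`, so `P` vanishes at `q ^ m` points. Its degree is at most
  -- `q ^ (m - 1)`, so it is zero.
  let P : Polynomial Ω := ∑ i ∈ Finset.range m, C (f (θ^[i] v)) * X ^ Nat.card K ^ i
  have hP : P = 0 := by
    obtain ⟨s, hs, hs'⟩ := exists_finset_pow_card (K := K) (Ω := Ω) hm.ne'
    refine eq_zero_of_natDegree_lt_card_of_eval_eq_zero' _ s (fun c hc => ?_) ?_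
    · have hfix : θ (∑ i ∈ Finset.range m, c ^ Nat.card K ^ i • θ^[i] v) =
          ∑ i ∈ Finset.range m, c ^ Nat.card K ^ i • θ^[i] v := by
        have h1 : ∀ i, θ (c ^ Nat.card K ^ i • θ^[i] v) =
            c ^ Nat.card K ^ (i + 1) • θ^[i + 1] v := fun i => by
          rw [hθ, ← pow_mul, ← pow_succ, Function.iterate_succ_apply']
        rw [map_sum, Finset.sum_congr rfl fun i _ => h1 i]
        have h2 := Finset.sum_range_succ' (fun i => c ^ Nat.card K ^ i • θ^[i] v) m
        rw [Finset.sum_range_succ, pow_zero, pow_one, hs' c hc, hmv.eq] at h2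
        exact (add_right_cancel h2).symm
      have h3 := hf (Submodule.subset_span hfix)
      rw [LinearMap.mem_ker, map_sum] at h3
      rw [eval_finsetSum, ← h3]
      refine Finset.sum_congr rfl fun i _ => ?_
      rw [eval_mul, eval_C, eval_pow, eval_X, map_smul, smul_eq_mul, mul_comm]
    · rw [hs]
      refine lt_of_le_of_lt (natDegree_sum_le_of_forall_le _ (n := Nat.card K ^ (m - 1)) _
        fun i hi => ?_) (Nat.pow_lt_pow_right hQ (by omega))
      rw [Finset.mem_range] at hi
      exact (natDegree_C_mul_X_pow_le _ _).trans (Nat.pow_le_pow_right (by omega) (by omega))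
  -- Only `i = 0` contributes to the coefficient of `X`, and that coefficient is `f v`.
  have hcoeff := congrArg (fun p => coeff p 1) hP
  simp only [P, finsetSum_coeff, coeff_C_mul_X_pow, coeff_zero] at hcoeff
  rw [Finset.sum_eq_single 0] at hcoeff
  · simpa using hcoeff
  · intro i _ hi
    rw [if_neg]
    exact fun h => absurd h (Nat.one_lt_pow hi hQ).ne
  · intro h
    exact absurd (Finset.mem_range.mpr hm) h

end Lang

/-! ### Twisting by field automorphisms -/

namespace LinSys

variable {A J K : Type*} [Field K]
variable {V W U X : Type*} [AddCommGroup V] [Module K V] [AddCommGroup W] [Module K W]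
  [AddCommGroup U] [Module K U] [AddCommGroup X] [Module K X]

/-- The existence of a `σ`-semilinear isomorphism. -/
def IsoOver (σ : RingAut K) (M : LinSys A J K V) (N : LinSys A J K W) : Prop :=
  ∃ θ : V ≃+ W, (∀ (c : K) v, θ (c • v) = σ c • θ v) ∧ (∀ a v, θ (M.op a v) = N.op a (θ v)) ∧
    ∀ j v, v ∈ M.sub j ↔ θ v ∈ N.sub j

theorem isoOver_one {M : LinSys A J K V} {N : LinSys A J K W} : IsoOver 1 M N ↔ M.Iso N :=
  ⟨fun ⟨θ, h0, h1, h2⟩ => ⟨{ θ with map_smul' := h0 }, h1, h2⟩,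
    fun ⟨e, h1, h2⟩ => ⟨e.toAddEquiv, e.map_smul, h1, h2⟩⟩

theorem IsoOver.trans {σ τ : RingAut K} {M : LinSys A J K V} {N : LinSys A J K W}
    {P : LinSys A J K U} (h : IsoOver σ M N) (h' : IsoOver τ N P) : IsoOver (τ * σ) M P := by
  obtain ⟨θ, h0, h1, h2⟩ := h
  obtain ⟨η, h3, h4, h5⟩ := h'
  exact ⟨θ.trans η, fun c v => by simp [h0, h3], fun a v => by simp [h1, h4], fun j v => by
    rw [h2, h5]; rfl⟩

theorem IsoOver.symm {σ : RingAut K} {M : LinSys A J K V} {N : LinSys A J K W}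
    (h : IsoOver σ M N) : IsoOver σ⁻¹ N M := by
  obtain ⟨θ, h0, h1, h2⟩ := h
  refine ⟨θ.symm, fun c v => ?_, fun a v => ?_, fun j v => ?_⟩
  · rw [AddEquiv.symm_apply_eq, h0, AddEquiv.apply_symm_apply]
    exact congrArg (· • v) (σ.apply_symm_apply c).symm
  · rw [AddEquiv.symm_apply_eq, h1, AddEquiv.apply_symm_apply]
  · rw [h2, AddEquiv.apply_symm_apply]

theorem IsoOver.prod {σ : RingAut K} {M : LinSys A J K V} {N : LinSys A J K W}
    {P : LinSys A J K U} {Q : LinSys A J K X} (h : IsoOver σ M N) (h' : IsoOver σ P Q) :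
    IsoOver σ (M.prod P) (N.prod Q) := by
  obtain ⟨θ, h0, h1, h2⟩ := h
  obtain ⟨η, h3, h4, h5⟩ := h'
  exact ⟨AddEquiv.prodCongr θ η, fun c v => Prod.ext (h0 c v.1) (h3 c v.2),
    fun a v => Prod.ext (h1 a v.1) (h4 a v.2), fun j v => and_congr (h2 j v.1) (h5 j v.2)⟩

/-- The twist by a field automorphism. -/
def twist (σ : RingAut K) {n : ℕ} (M : LinSys A J K (Fin n → K)) : LinSys A J K (Fin n → K) where
  op a :=
    { toFun := fun v i => σ (M.op a (fun j => σ.symm (v j)) i)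
      map_add' := fun v w => by
        ext i
        have : (fun j => σ.symm ((v + w) j)) = (fun j => σ.symm (v j)) + fun j => σ.symm (w j) := by
          ext j; simp
        rw [this, map_add]
        simp
      map_smul' := fun c v => by
        ext i
        have : (fun j => σ.symm ((c • v) j)) = σ.symm c • fun j => σ.symm (v j) := by
          ext j; simp
        rw [this, map_smul]
        simp }
  sub j :=
    { carrier := {v | (fun j => σ.symm (v j)) ∈ M.sub j}
      add_mem' := fun {v w} hv hw => by
        have : (fun j => σ.symm ((v + w) j)) = (fun j => σ.symm (v j)) + fun j => σ.symm (w j) := by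
          ext j; simp
        rw [Set.mem_ofPred_eq, this]
        exact add_mem hv hw
      zero_mem' := by
        have : (fun j => σ.symm ((0 : Fin n → K) j)) = 0 := by ext j; simp
        rw [Set.mem_ofPred_eq, this]
        exact zero_mem _
      smul_mem' := fun c v hv => by
        have : (fun j => σ.symm ((c • v) j)) = σ.symm c • fun j => σ.symm (v j) := by
          ext j; simp
        rw [Set.mem_ofPred_eq, this]
        exact Submodule.smul_mem _ _ hv }

theorem isoOver_twist (σ : RingAut K) {n : ℕ} (M : LinSys A J K (Fin n → K)) :
    IsoOver σ M (M.twist σ) := by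
  refine ⟨AddEquiv.piCongrRight fun _ => σ.toAddEquiv, fun c v => ?_, fun a v => ?_, fun j v => ?_⟩
  · ext i; simp
  · ext i; simp [twist]
  · simp [twist]

end LinSys

namespace IsoClass

variable {A J K : Type*} [Field K]
variable {V W U : Type*} [AddCommGroup V] [Module K V] [AddCommGroup W] [Module K W]
  [AddCommGroup U] [Module K U] [FiniteDimensional K V] [FiniteDimensional K W]
  [FiniteDimensional K U]

instance : SMul (RingAut K) (IsoClass A J K) :=
  ⟨fun σ => Quotient.lift (fun M => mk (M.2.twist σ)) fun M N h => mk_eq_mk.mpr (by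
    rw [← LinSys.isoOver_one]
    have h1 := (M.2.isoOver_twist σ).symm.trans
      ((LinSys.isoOver_one.mpr h).trans (N.2.isoOver_twist σ))
    simpa using h1)⟩

theorem smul_mk_eq_iff {σ : RingAut K} {M : LinSys A J K V} {N : LinSys A J K W} :
    σ • mk M = mk N ↔ LinSys.IsoOver σ M N := by
  have h1 := LinSys.isoOver_one.mpr (M.iso_transport (Module.finBasis K V).equivFun)
  have h2 := LinSys.isoOver_twist σ (M.transport (Module.finBasis K V).equivFun)
  have h3 := h1.trans h2
  refine Iff.trans mk_eq_mk ⟨fun h => ?_, fun h => ?_⟩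
  · simpa using h3.trans (LinSys.isoOver_one.mpr h)
  · rw [← LinSys.isoOver_one]
    simpa using h3.symm.trans h

theorem exists_isoOver (σ : RingAut K) (M : LinSys A J K V) :
    ∃ (n : ℕ) (N : LinSys A J K (Fin n → K)), LinSys.IsoOver σ M N ∧ σ • mk M = mk N := by
  obtain ⟨n, N, hN⟩ := exists_rep (σ • mk M)
  exact ⟨n, N, smul_mk_eq_iff.mp hN, hN⟩

instance : DistribMulAction (RingAut K) (IsoClass A J K) where
  one_smul s := by
    obtain ⟨_, M, rfl⟩ := exists_rep s
    exact smul_mk_eq_iff.mpr (LinSys.isoOver_one.mpr (LinSys.Iso.refl M))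
  mul_smul σ τ s := by
    obtain ⟨_, M, rfl⟩ := exists_rep s
    obtain ⟨_, N, hN, hN'⟩ := exists_isoOver τ M
    obtain ⟨_, P, hP, hP'⟩ := exists_isoOver σ N
    rw [hN', hP', smul_mk_eq_iff]
    exact hN.trans hP
  smul_zero σ := by
    obtain ⟨_, N, ⟨θ, -⟩, hN'⟩ := exists_isoOver σ (⟨fun _ => 0, fun _ => ⊤⟩ : LinSys A J K (Fin 0 → K))
    refine hN'.trans (mk_eq_zero.mpr ?_)
    exact θ.symm.toEquiv.subsingleton
  smul_add σ s t := by
    obtain ⟨_, M, rfl⟩ := exists_rep s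
    obtain ⟨_, M', rfl⟩ := exists_rep t
    obtain ⟨_, N, hN, hN'⟩ := exists_isoOver σ M
    obtain ⟨_, P, hP, hP'⟩ := exists_isoOver σ M'
    rw [hN', hP', ← mk_prod, ← mk_prod, smul_mk_eq_iff]
    exact hN.prod hP

theorem IsIndec.smul {s : IsoClass A J K} (hs : IsIndec s) (σ : RingAut K) : IsIndec (σ • s) := by
  refine ⟨fun h => hs.1 ((smul_eq_zero_iff_eq σ).mp h), fun t u h => ?_⟩
  have h1 : s = σ⁻¹ • t + σ⁻¹ • u := by rw [← smul_add, ← h, inv_smul_smul]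
  simpa [smul_eq_zero_iff_eq] using hs.2 _ _ h1

end IsoClass

end

noncomputable section

open TensorProduct

/-! ### Descent along a finite field -/

namespace LinSys

variable {A J K Ω : Type*} [Field K] [Field Ω] [Algebra K Ω]

/-- An automorphism of the field extension acts semilinearly on an extension of scalars. -/
theorem isoOver_baseChange {V : Type*} [AddCommGroup V] [Module K V] (M : LinSys A J K V)
    (τ : Ω ≃ₐ[K] Ω) : IsoOver (τ : RingAut Ω) (M.baseChange Ω) (M.baseChange Ω) := by
  let θ : (Ω ≃ₐ[K] Ω) → (Ω ⊗[K] V ≃ₗ[K] Ω ⊗[K] V) := fun τ =>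
    TensorProduct.congr τ.toLinearEquiv (LinearEquiv.refl K V)
  have hθ : ∀ (τ : Ω ≃ₐ[K] Ω) l v, θ τ (l ⊗ₜ v) = τ l ⊗ₜ v := fun τ l v => rfl
  have hsub : ∀ (τ : Ω ≃ₐ[K] Ω) j v, v ∈ (M.baseChange Ω).sub j → θ τ v ∈ (M.baseChange Ω).sub j := by
    rintro τ j _ ⟨x, rfl⟩
    induction x using TensorProduct.induction_on with
    | zero => simp
    | tmul l v => exact Submodule.tmul_mem_baseChange_of_mem (τ l) v.2
    | add x y hx hy => rw [map_add, map_add]; exact add_mem hx hy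
  have hsymm : ∀ v, θ τ.symm (θ τ v) = v := fun v => by
    induction v using TensorProduct.induction_on with
    | zero => simp
    | tmul l v => simp [hθ]
    | add x y hx hy => rw [map_add, map_add, hx, hy]
  refine ⟨(θ τ).toAddEquiv, fun c v => ?_, fun a v => ?_, fun j v => ⟨hsub τ j v, fun h => ?_⟩⟩
  · change θ τ (c • v) = τ c • θ τ v
    induction v using TensorProduct.induction_on with
    | zero => simp
    | tmul l v => rw [smul_tmul', hθ, hθ, smul_tmul', smul_eq_mul, map_mul, smul_eq_mul]
    | add x y hx hy => rw [smul_add, map_add, hx, hy, map_add, smul_add]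
  · change θ τ ((M.baseChange Ω).op a v) = (M.baseChange Ω).op a (θ τ v)
    induction v using TensorProduct.induction_on with
    | zero => simp
    | tmul l v => simp [hθ, baseChange]
    | add x y hx hy => simp [hx, hy]
  · have h1 := hsub τ.symm j _ h
    exact hsymm v ▸ h1

variable [Finite K] [Algebra.IsAlgebraic K Ω] [IsAlgClosed Ω]
variable {V : Type*} [AddCommGroup V] [Module Ω V] [FiniteDimensional Ω V]

/-- A system over an algebraic closure with a Frobenius-semilinear automorphism is defined over the
finite field. -/
theorem exists_iso_baseChange {σ : RingAut Ω} (hσ : ∀ x, σ x = x ^ Nat.card K)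
    {M : LinSys A J Ω V} (h : IsoOver σ M M) :
    ∃ (n : ℕ) (N : LinSys A J K (Fin n → K)), (N.baseChange Ω).Iso M := by
  classical
  obtain ⟨θ, h0, h1, h2⟩ := h
  have h0' : ∀ (c : Ω) v, θ (c • v) = c ^ Nat.card K • θ v := fun c v => by rw [h0, hσ]
  have hspan := span_fixed_eq_top (K := K) (θ := θ.toAddMonoidHom) θ.injective h0'
  -- The fixed vectors span, so they contain a basis; its `K`-span will be the `K`-form of `V`.
  let b' := Module.Basis.ofSpan hspan.ge
  have hb' : ∀ i, θ (b' i) = b' i := fun i => Module.Basis.ofSpan_subset hspan.ge ⟨i, rfl⟩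
  let n := Module.finrank Ω V
  let b : Module.Basis (Fin n) Ω V := b'.reindex (b'.indexEquiv (Module.finBasis Ω V))
  have hb : ∀ i, θ (b i) = b i := fun i => by rw [Module.Basis.reindex_apply]; exact hb' _
  let m : Module K V := Module.compHom V (algebraMap K Ω)
  have hst : IsScalarTower K Ω V := ⟨fun c l v => by
    rw [Algebra.smul_def, mul_smul]; rfl⟩
  let f : (Fin n → K) →ₗ[K] V := Fintype.linearCombination K b
  have hf : ∀ x, f x = ∑ i, x i • b i := fun x => Fintype.linearCombination_apply K b x
  have hθK : ∀ (c : K) v, θ (c • v) = c • θ v := fun c v => by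
    rw [← algebraMap_smul Ω c v, h0', algebraMap_pow_card, algebraMap_smul]
  have hfix : ∀ x, θ (f x) = f x := fun x => by
    rw [hf, map_sum]
    exact Finset.sum_congr rfl fun i _ => by rw [hθK, hb]
  -- The coordinates of a fixed vector in a fixed basis satisfy `x ^ q = x`, so they lie in `K`.
  -- Hence the `K`-span of the basis consists of all fixed vectors, and it is stable under every
  -- operator that commutes with `θ`.
  have hrange : ∀ v, θ v = v → ∃ x, f x = v := fun v hv => by
    have h3 : ∀ i, b.repr v i ^ Nat.card K = b.repr v i := fun i => by
      have h4 : θ v = ∑ j, b.repr v j ^ Nat.card K • b j := by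
        conv_lhs => rw [← b.sum_repr v, map_sum]
        exact Finset.sum_congr rfl fun j _ => by rw [h0', hb]
      rw [hv] at h4
      have h5 := congrArg (fun w => b.repr w i) h4
      simp only [b.repr_sum_self] at h5
      exact h5.symm
    choose x hx using fun i => exists_algebraMap_eq_of_pow_card (h3 i)
    refine ⟨x, ?_⟩
    rw [hf]
    conv_rhs => rw [← b.sum_repr v]
    exact Finset.sum_congr rfl fun i _ => by rw [← hx, algebraMap_smul]
  let e : Ω ⊗[K] (Fin n → K) ≃ₗ[Ω] V :=
    (Module.Basis.baseChange Ω (Pi.basisFun K (Fin n))).equiv b (Equiv.refl _)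
  have he : ∀ x, e (1 ⊗ₜ x) = f x := by
    have h3 : e.toLinearMap.restrictScalars K ∘ₗ TensorProduct.mk K Ω (Fin n → K) 1 = f := by
      refine (Pi.basisFun K (Fin n)).ext fun i => ?_
      have h4 : e (1 ⊗ₜ Pi.basisFun K (Fin n) i) = b i := by
        rw [← Module.Basis.baseChange_apply, Module.Basis.equiv_apply]; rfl
      refine h4.trans ?_
      rw [Pi.basisFun_apply, hf]
      simp [Pi.single_apply]
    exact fun x => LinearMap.congr_fun h3 x
  have hinj : Function.Injective f := fun x y hxy => by
    rw [← he, ← he] at hxy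
    have := e.injective hxy
    exact Module.FaithfullyFlat.tensorProduct_mk_injective (A := K) (B := Ω) (Fin n → K) this
  let g : (Fin n → K) ≃ₗ[K] LinearMap.range f := LinearEquiv.ofInjective f hinj
  have hop : ∀ a, ∀ v ∈ LinearMap.range f, (M.op a).restrictScalars K v ∈ LinearMap.range f := by
    rintro a _ ⟨x, rfl⟩
    refine hrange _ ?_
    rw [LinearMap.coe_restrictScalars, h1, hfix]
  let N : LinSys A J K (Fin n → K) :=
    { op := fun a => g.symm.toLinearMap ∘ₗ ((M.op a).restrictScalars K).restrict (hop a) ∘ₗ g.toLinearMap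
      sub := fun j => ((M.sub j).restrictScalars K).comap f }
  have hN : ∀ a x, f (N.op a x) = M.op a (f x) := fun a x => by
    have h3 : g (N.op a x) = ⟨M.op a (f x), hop a _ ⟨x, rfl⟩⟩ := g.apply_symm_apply _
    exact congrArg Subtype.val h3
  refine ⟨n, N, e, fun a => LinearMap.congr_fun (?_ : e.toLinearMap ∘ₗ (N.baseChange Ω).op a =
    M.op a ∘ₗ e.toLinearMap), fun j v => ?_⟩
  · refine TensorProduct.linearMap_ext_one fun x => ?_
    simp only [LinearMap.comp_apply, LinearEquiv.coe_coe, baseChange, LinearMap.baseChange_tmul]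
    rw [he, he, hN]
  · have h3 : ((N.sub j).baseChange Ω).map e.toLinearMap = M.sub j := by
      apply le_antisymm
      · rw [Submodule.map_le_iff_le_comap, Submodule.baseChange_eq_span, Submodule.span_le]
        rintro _ ⟨x, hx, rfl⟩
        change e (1 ⊗ₜ x) ∈ M.sub j
        rw [he]
        exact hx
      -- The spanning theorem is applied a second time, to the restriction of `θ` to the subspace,
      -- which shows that the subspace is spanned by its own fixed vectors.
      · let θ' : M.sub j →+ M.sub j :=
          { toFun := fun v => ⟨θ v, (h2 j v).mp v.2⟩
            map_zero' := Subtype.ext (map_zero θ)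
            map_add' := fun v w => Subtype.ext (map_add θ _ _) }
        have h4 := span_fixed_eq_top (K := K) (θ := θ')
          (fun v w hvw => Subtype.ext (θ.injective (congrArg Subtype.val hvw)))
          (fun c v => Subtype.ext (h0' c v))
        intro v hv
        have h5 : (⟨v, hv⟩ : M.sub j) ∈ Submodule.span Ω {v | θ' v = v} := by rw [h4]; trivial
        have h6 : (M.sub j).subtype ⟨v, hv⟩ ∈
            (Submodule.span Ω {v | θ' v = v}).map (M.sub j).subtype := ⟨_, h5, rfl⟩
        rw [Submodule.map_span] at h6
        refine (Submodule.span_le.mpr ?_) h6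
        rintro _ ⟨w, hw, rfl⟩
        obtain ⟨x, hx⟩ := hrange w.1 (congrArg Subtype.val hw)
        refine ⟨1 ⊗ₜ x, Submodule.tmul_mem_baseChange_of_mem _ ?_, (he x).trans hx⟩
        change f x ∈ M.sub j
        rw [hx]
        exact w.2
    rw [← h3]
    constructor
    · exact fun hv => ⟨v, hv, rfl⟩
    · rintro ⟨w, hw, hwv⟩
      exact e.injective hwv ▸ hw

end LinSys

namespace IsoClass

variable {A J K Ω : Type*} [Field K] [Field Ω] [Algebra K Ω] [Finite K] [Algebra.IsAlgebraic K Ω]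
  [IsAlgClosed Ω]

/-- The classes defined over a finite field are those fixed by the Frobenius automorphism. -/
theorem exists_baseChange_eq_iff {σ : RingAut Ω} (hσ : ∀ x, σ x = x ^ Nat.card K)
    (s : IsoClass A J Ω) : (∃ t : IsoClass A J K, baseChange Ω t = s) ↔ σ • s = s := by
  constructor
  · rintro ⟨t, rfl⟩
    obtain ⟨_, M, rfl⟩ := exists_rep t
    rw [baseChange_mk, smul_mk_eq_iff]
    let τ : Ω ≃ₐ[K] Ω := AlgEquiv.ofRingEquiv (f := σ) fun x => by
      rw [hσ, algebraMap_pow_card]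
    exact M.isoOver_baseChange τ
  · obtain ⟨_, M, rfl⟩ := exists_rep s
    rw [smul_mk_eq_iff]
    intro h
    obtain ⟨n, N, hN⟩ := LinSys.exists_iso_baseChange hσ h
    exact ⟨mk N, by rw [baseChange_mk, mk_eq_mk]; exact hN⟩

end IsoClass

/-! ### Indecomposability and extension of scalars -/

namespace LinSys

variable {A J K : Type*} [Field K] {V : Type*} [AddCommGroup V] [Module K V]

/-- The semilinear map between two extensions of scalars. -/
def changeScalars (V : Type*) [AddCommGroup V] [Module K V] {L L' : Type*} [Field L] [Field L']
    [Algebra K L] [Algebra K L'] (ι : L →ₐ[K] L') : L ⊗[K] V →ₗ[K] L' ⊗[K] V :=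
  ι.toLinearMap.rTensor V

theorem sum_baseChange_mem_endo {S L' : Type*} [Field L'] [Algebra K L'] {M : LinSys A J K V}
    (T : Finset S) (c : S → L') {f : S → V →ₗ[K] V} (hf : ∀ l, f l ∈ hom M M) :
    ∑ l ∈ T, c l • (f l).baseChange L' ∈ endo (M.baseChange L') :=
  sum_mem fun l _ => Subalgebra.smul_mem _ (baseChange_mem_hom L' (hf l)) _

section

variable {L L' : Type*} [Field L] [Field L'] [Algebra K L] [Algebra K L'] (ι : L →ₐ[K] L')

theorem changeScalars_tmul (l : L) (v : V) : changeScalars V ι (l ⊗ₜ v) = ι l ⊗ₜ v := rfl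

theorem changeScalars_smul (l : L) (x : L ⊗[K] V) :
    changeScalars V ι (l • x) = ι l • changeScalars V ι x := by
  induction x using TensorProduct.induction_on with
  | zero => simp
  | tmul l v => rw [smul_tmul', changeScalars_tmul, changeScalars_tmul, smul_tmul', smul_eq_mul,
      map_mul, smul_eq_mul]
  | add x y hx hy => rw [smul_add, map_add, hx, hy, map_add, smul_add]

theorem changeScalars_injective : Function.Injective (changeScalars V ι) :=
  Module.Flat.rTensor_preserves_injective_linearMap _ ι.toRingHom.injective

/-- Equality descends since the change of scalars is injective, and ascends since the vectors `1 ⊗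
v` generate. It transfers idempotency and triviality of an endomorphism between `L` and `L'`. -/
theorem eq_iff_of_changeScalars {e f : Module.End L (L ⊗[K] V)} {e' f' : Module.End L' (L' ⊗[K] V)}
    (he : ∀ x, e' (changeScalars V ι x) = changeScalars V ι (e x))
    (hf : ∀ x, f' (changeScalars V ι x) = changeScalars V ι (f x)) : e' = f' ↔ e = f := by
  constructor
  · rintro rfl
    refine LinearMap.ext fun x => ?_
    exact changeScalars_injective ι ((he x).symm.trans (hf x))
  · rintro rfl
    refine TensorProduct.linearMap_ext_one fun v => ?_
    have h1 : (1 : L') ⊗ₜ[K] v = changeScalars V ι (1 ⊗ₜ v) := by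
      rw [changeScalars_tmul, map_one]
    rw [h1, he, hf]

theorem sum_baseChange_changeScalars (T : Finset L) (f : L → V →ₗ[K] V) (x : L ⊗[K] V) :
    (∑ l ∈ T, ι l • (f l).baseChange L') (changeScalars V ι x) =
      changeScalars V ι ((∑ l ∈ T, l • (f l).baseChange L) x) := by
  rw [LinearMap.sum_apply, LinearMap.sum_apply, map_sum]
  refine Finset.sum_congr rfl fun l _ => ?_
  rw [LinearMap.smul_apply, LinearMap.smul_apply, changeScalars_smul]
  congr 1
  induction x using TensorProduct.induction_on with
  | zero => simp
  | tmul l v => simp [changeScalars_tmul]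
  | add x y hx hy => simp [hx, hy]

/-- Indecomposability descends along extensions of scalars. -/
theorem Indec.of_baseChange [FiniteDimensional K V] {M : LinSys A J K V}
    (h : (M.baseChange L').Indec) (ι : L →ₐ[K] L') : (M.baseChange L).Indec := by
  constructor
  · have := h.1
    refine Module.nontrivial_of_finrank_pos (R := L) ?_
    rw [Module.finrank_baseChange, ← Module.finrank_baseChange (R := L')]
    exact Module.finrank_pos
  · intro e he hee
    obtain ⟨T, f, hf, rfl⟩ := exists_expand_hom L he
    -- Moving the coefficients of the expansion along `ι` extends the endomorphism to `L'`.
    have h1 := sum_baseChange_changeScalars ι T f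
    set e := ∑ l ∈ T, l • (f l).baseChange L
    set e' := ∑ l ∈ T, ι l • (f l).baseChange L'
    have h2 : e' * e' = e' := (eq_iff_of_changeScalars ι (e := e * e)
      (fun x => by rw [Module.End.mul_apply, h1, h1]; rfl) h1).mpr hee
    rcases h.2 e' (sum_baseChange_mem_endo T ι hf) h2 with h3 | h3
    · exact Or.inl ((eq_iff_of_changeScalars ι (f := 0) h1 fun x => by simp).mp h3)
    · exact Or.inr ((eq_iff_of_changeScalars ι (f := 1) h1 fun x => rfl).mp h3)

end

/-- Idempotents over an algebraic extension are defined over a finite one. -/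
theorem exists_finite_not_indec {Ω : Type*} [Field Ω] [Algebra K Ω] [Algebra.IsAlgebraic K Ω]
    [FiniteDimensional K V] {M : LinSys A J K V} (h : ¬ (M.baseChange Ω).Indec) :
    ∃ L : IntermediateField K Ω, FiniteDimensional K L ∧ ¬ (M.baseChange L).Indec := by
  classical
  by_cases hV : Nontrivial (Ω ⊗[K] V)
  swap
  · refine ⟨⊥, inferInstance, fun h1 => hV ?_⟩
    have := h1.1
    refine Module.nontrivial_of_finrank_pos (R := Ω) ?_
    rw [Module.finrank_baseChange, ← Module.finrank_baseChange (R := (⊥ : IntermediateField K Ω))]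
    exact Module.finrank_pos
  simp only [Indec, not_and, not_forall, not_or] at h
  obtain ⟨e, he, hee, he0, he1⟩ := h hV
  obtain ⟨T, f, hf, rfl⟩ := exists_expand_hom Ω he
  -- The idempotent involves only the finitely many coefficients in `T`; they generate a finite
  -- extension over which it already exists.
  let L := IntermediateField.adjoin K (T : Set Ω)
  have hL : FiniteDimensional K L :=
    IntermediateField.finiteDimensional_adjoin fun x _ => (Algebra.IsAlgebraic.isAlgebraic x).isIntegral
  refine ⟨L, hL, fun hind => ?_⟩
  let incl : {x // x ∈ T} ↪ L := ⟨fun l => ⟨l.1, IntermediateField.subset_adjoin K _ l.2⟩,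
    fun x y h => Subtype.ext (congrArg (fun l : L => (l : Ω)) h)⟩
  let T' : Finset L := T.attach.map incl
  have h0 : ∑ l ∈ T, l • (f l).baseChange Ω = ∑ l ∈ T', L.val l • (f (l : Ω)).baseChange Ω := by
    rw [Finset.sum_map]
    exact (Finset.sum_attach T fun l => l • (f l).baseChange Ω).symm
  have h1 := sum_baseChange_changeScalars L.val T' fun l => f (l : Ω)
  rw [h0] at hee he0 he1
  set e := ∑ l ∈ T', l • (f (l : Ω)).baseChange L
  set e' := ∑ l ∈ T', L.val l • (f (l : Ω)).baseChange Ω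
  have h2 : e * e = e := (eq_iff_of_changeScalars L.val (e' := e' * e')
      (fun x => by rw [Module.End.mul_apply, h1, h1]; rfl) h1).mp hee
  rcases hind.2 e (sum_baseChange_mem_endo T' (fun l => l) fun l => hf (l : Ω)) h2 with h3 | h3
  · exact he0 ((eq_iff_of_changeScalars L.val (f' := 0) h1 fun x => by simp).mpr h3)
  · exact he1 ((eq_iff_of_changeScalars L.val (f' := 1) h1 fun x => rfl).mpr h3)

end LinSys

end

noncomputable section

open TensorProduct

/-! ### Flags and their types -/

namespace LinSys

variable {A ι K : Type*} [Field K]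
variable {V W : Type*} [AddCommGroup V] [Module K V] [AddCommGroup W] [Module K W]

theorem ext' {J : Type*} {M N : LinSys A J K V} (h : M.op = N.op) (h' : M.sub = N.sub) : M = N := by
  cases M; cases N; simp_all

/-- The subspaces form flags of type `a`. -/
structure HasType (M : LinSys A (ι × ℕ) K V) (a : ι × ℕ →₀ ℕ) : Prop where
  anti : ∀ i, Antitone fun j => M.sub (i, j)
  finrank_add : ∀ i j, Module.finrank K (M.sub (i, j)) + ∑ l ∈ Finset.range j, a (i, l) =
    Module.finrank K V
  exists_eq_bot : ∀ i, ∃ n, M.sub (i, n) = ⊥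

theorem HasType.unique {M : LinSys A (ι × ℕ) K V} {a b : ι × ℕ →₀ ℕ} (h : M.HasType a)
    (h' : M.HasType b) : a = b := by
  ext ⟨i, j⟩
  have h1 := h.finrank_add i j
  have h2 := h'.finrank_add i j
  have h3 := h.finrank_add i (j + 1)
  have h4 := h'.finrank_add i (j + 1)
  rw [Finset.sum_range_succ] at h3 h4
  omega

theorem finrank_eq_of_semilinear (σ : RingAut K) (θ : V ≃+ W)
    (h0 : ∀ (c : K) v, θ (c • v) = σ c • θ v) : Module.finrank K V = Module.finrank K W := by
  have h := congrArg Cardinal.toNat (lift_rank_eq_of_equiv_equiv σ θ σ.bijective h0)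
  simp only [Cardinal.toNat_lift] at h
  exact h

theorem HasType.of_isoOver {σ : RingAut K} {M : LinSys A (ι × ℕ) K V} {N : LinSys A (ι × ℕ) K W}
    {a : ι × ℕ →₀ ℕ} (h : IsoOver σ M N) (hM : M.HasType a) : N.HasType a := by
  obtain ⟨θ, h0, -, h2⟩ := h
  have hV : Module.finrank K V = Module.finrank K W :=
    finrank_eq_of_semilinear σ θ h0
  have hs : ∀ j, Module.finrank K (M.sub j) = Module.finrank K (N.sub j) := fun j => by
    let η : M.sub j ≃+ N.sub j :=
      { toFun := fun v => ⟨θ v, (h2 j v).mp v.2⟩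
        invFun := fun w => ⟨θ.symm w, (h2 j _).mpr (by rw [AddEquiv.apply_symm_apply]; exact w.2)⟩
        left_inv := fun v => by simp
        right_inv := fun v => by simp
        map_add' := fun v w => Subtype.ext (map_add θ _ _) }
    exact finrank_eq_of_semilinear σ η fun c v => Subtype.ext (h0 c v)
  refine ⟨fun i j j' hj w hw => ?_, fun i j => by rw [← hs, ← hV]; exact hM.finrank_add i j,
    fun i => ?_⟩
  · obtain ⟨v, rfl⟩ := θ.surjective w
    exact (h2 _ v).mp (hM.anti i hj ((h2 _ v).mpr hw))
  · obtain ⟨n, hn⟩ := hM.exists_eq_bot i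
    refine ⟨n, (Submodule.eq_bot_iff _).mpr fun w hw => ?_⟩
    obtain ⟨v, rfl⟩ := θ.surjective w
    have h3 := (h2 _ v).mpr hw
    rw [hn, Submodule.mem_bot] at h3
    rw [h3, map_zero]

theorem HasType.of_iso {M : LinSys A (ι × ℕ) K V} {N : LinSys A (ι × ℕ) K W}
    {a : ι × ℕ →₀ ℕ} (h : M.Iso N) (hM : M.HasType a) : N.HasType a :=
  hM.of_isoOver (isoOver_one.mpr h)

theorem HasType.prod [FiniteDimensional K V] [FiniteDimensional K W] {M : LinSys A (ι × ℕ) K V}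
    {N : LinSys A (ι × ℕ) K W} {a b : ι × ℕ →₀ ℕ} (hM : M.HasType a) (hN : N.HasType b) :
    (M.prod N).HasType (a + b) := by
  refine ⟨fun i j j' hj => Submodule.prod_mono (hM.anti i hj) (hN.anti i hj), fun i j => ?_,
    fun i => ?_⟩
  · have h1 := hM.finrank_add i j
    have h2 := hN.finrank_add i j
    change Module.finrank K ((M.sub (i, j)).prod (N.sub (i, j))) + _ = _
    rw [Submodule.finrank_prod_eq, Module.finrank_prod, ← h1, ← h2]
    simp only [Finsupp.add_apply, Finset.sum_add_distrib]
    ring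
  · obtain ⟨m, hm⟩ := hM.exists_eq_bot i
    obtain ⟨n, hn⟩ := hN.exists_eq_bot i
    refine ⟨max m n, ?_⟩
    have h1 : M.sub (i, max m n) = ⊥ := le_bot_iff.mp (hm ▸ hM.anti i (le_max_left m n))
    have h2 : N.sub (i, max m n) = ⊥ := le_bot_iff.mp (hn ▸ hN.anti i (le_max_right m n))
    change (M.sub (i, max m n)).prod (N.sub (i, max m n)) = ⊥
    rw [h1, h2, Submodule.prod_bot]

/-- The type consists of the successive dimension drops. The truncated subtraction is exact because
the flags decrease, and the support is finite because each of the finitely many flags reaches zero.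
-/
theorem exists_hasType [Finite ι] [FiniteDimensional K V] {M : LinSys A (ι × ℕ) K V}
    (h1 : ∀ i, Antitone fun j => M.sub (i, j)) (h2 : ∀ i, M.sub (i, 0) = ⊤)
    (h3 : ∀ i, ∃ n, M.sub (i, n) = ⊥) : ∃ a, M.HasType a := by
  classical
  have := Fintype.ofFinite ι
  let d : ι × ℕ → ℕ := fun x => Module.finrank K (M.sub x)
  have hd : ∀ i j, d (i, j + 1) ≤ d (i, j) := fun i j =>
    Submodule.finrank_mono (h1 i (Nat.le_succ j))
  choose n hn using h3
  let f : ι × ℕ → ℕ := fun x => d x - d (x.1, x.2 + 1)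
  have hf : (Function.support f).Finite := by
    refine ((Finset.univ ×ˢ Finset.range (Finset.univ.sup n)).finite_toSet).subset ?_
    rintro ⟨i, j⟩ hij
    simp only [Finset.coe_product, Finset.coe_univ, Finset.coe_range, Set.mem_prod, Set.mem_univ,
      Set.mem_Iio, true_and]
    by_contra hj
    have h4 : n i ≤ j := (Finset.le_sup (Finset.mem_univ i)).trans (not_lt.mp hj)
    have h5 : M.sub (i, j) = ⊥ := le_bot_iff.mp (hn i ▸ h1 i h4)
    have h6 : d (i, j) = 0 := by
      simp only [d]
      rw [h5]
      exact finrank_bot K V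
    exact hij (by simp only [f, h6, zero_tsub])
  refine ⟨Finsupp.ofSupportFinite f hf, h1, fun i j => ?_, fun i => ⟨n i, hn i⟩⟩
  change d (i, j) + ∑ l ∈ Finset.range j, f (i, l) = _
  induction j with
  | zero =>
    rw [Finset.sum_range_zero, add_zero]
    simp only [d]
    rw [h2]
    exact finrank_top K V
  | succ j ih =>
    rw [Finset.sum_range_succ]
    have := hd i j
    simp only [f] at ih ⊢
    omega

/-- A summand inherits flags by intersection, and types are additive and unique. This is what gives
the indecomposable summands of a flagged object types of their own. -/
theorem HasType.of_prod [Finite ι] [FiniteDimensional K V] [FiniteDimensional K W]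
    {M : LinSys A (ι × ℕ) K V} {N : LinSys A (ι × ℕ) K W} {c : ι × ℕ →₀ ℕ}
    (h : (M.prod N).HasType c) : ∃ a b, M.HasType a ∧ N.HasType b ∧ a + b = c := by
  have h0 : ∀ i, (M.prod N).sub (i, 0) = ⊤ := fun i => by
    apply Submodule.eq_top_of_finrank_eq
    simpa using h.finrank_add i 0
  obtain ⟨a, ha⟩ : ∃ a, M.HasType a := by
    refine exists_hasType (fun i j j' hj v hv => ?_) (fun i => ?_) fun i => ?_
    · exact (h.anti i hj (show ((v, 0) : V × W) ∈ (M.prod N).sub (i, j') from ⟨hv, zero_mem _⟩)).1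
    · refine Submodule.eq_top_iff'.mpr fun v => ?_
      exact (show ((v, 0) : V × W) ∈ (M.prod N).sub (i, 0) by rw [h0]; trivial).1
    · obtain ⟨n, hn⟩ := h.exists_eq_bot i
      refine ⟨n, (Submodule.eq_bot_iff _).mpr fun v hv => ?_⟩
      have h1 : ((v, 0) : V × W) ∈ (M.prod N).sub (i, n) := ⟨hv, zero_mem _⟩
      rw [hn, Submodule.mem_bot] at h1
      exact congrArg Prod.fst h1
  obtain ⟨b, hb⟩ : ∃ b, N.HasType b := by
    refine exists_hasType (fun i j j' hj v hv => ?_) (fun i => ?_) fun i => ?_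
    · exact (h.anti i hj (show ((0, v) : V × W) ∈ (M.prod N).sub (i, j') from ⟨zero_mem _, hv⟩)).2
    · refine Submodule.eq_top_iff'.mpr fun v => ?_
      exact (show ((0, v) : V × W) ∈ (M.prod N).sub (i, 0) by rw [h0]; trivial).2
    · obtain ⟨n, hn⟩ := h.exists_eq_bot i
      refine ⟨n, (Submodule.eq_bot_iff _).mpr fun v hv => ?_⟩
      have h1 : ((0, v) : V × W) ∈ (M.prod N).sub (i, n) := ⟨zero_mem _, hv⟩
      rw [hn, Submodule.mem_bot] at h1
      exact congrArg Prod.snd h1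
  exact ⟨a, b, ha, hb, (ha.prod hb).unique h⟩

/-- Extension of scalars preserves dimensions. Inclusions descend by slicing with a linear form on
`L` that takes the value `1` at `1`. -/
theorem hasType_baseChange_iff (L : Type*) [Field L] [Algebra K L] [FiniteDimensional K V]
    {M : LinSys A (ι × ℕ) K V} {a : ι × ℕ →₀ ℕ} : (M.baseChange L).HasType a ↔ M.HasType a := by
  have hs : ∀ j, Module.finrank L ((M.baseChange L).sub j) = Module.finrank K (M.sub j) := fun j =>
    Submodule.finrank_baseChange_eq _
  have hV : Module.finrank L (L ⊗[K] V) = Module.finrank K V := Module.finrank_baseChange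
  have hle : ∀ j j', M.sub j ≤ M.sub j' ↔ (M.baseChange L).sub j ≤ (M.baseChange L).sub j' :=
    fun j j' => by
      refine ⟨fun h => Submodule.baseChange_mono L h, fun h v hv => ?_⟩
      obtain ⟨φ, hφ⟩ := LinearMap.exists_leftInverse_of_injective (Algebra.linearMap K L)
        (LinearMap.ker_eq_bot.mpr (algebraMap K L).injective)
      have hφ1 : φ 1 = 1 := by simpa using LinearMap.congr_fun hφ 1
      have h1 := slice_mem L φ (h (Submodule.tmul_mem_baseChange_of_mem (1 : L) hv))
      rwa [slice_tmul, hφ1, one_smul] at h1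
  have hbot : ∀ j, M.sub j = ⊥ ↔ (M.baseChange L).sub j = ⊥ := fun j => by
    rw [← Submodule.finrank_eq_zero, ← Submodule.finrank_eq_zero, hs]
  constructor
  · intro h
    exact ⟨fun i j j' hj => (hle _ _).mpr (h.anti i hj), fun i j => by
      rw [← hs, ← hV]; exact h.finrank_add i j, fun i => by
      simp only [hbot]; exact h.exists_eq_bot i⟩
  · intro h
    exact ⟨fun i j j' hj => (hle _ _).mp (h.anti i hj), fun i j => by
      rw [hs, hV]; exact h.finrank_add i j, fun i => by
      simp only [← hbot]; exact h.exists_eq_bot i⟩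

theorem HasType.finrank_eq {M : LinSys A (ι × ℕ) K V} {a : ι × ℕ →₀ ℕ} (h : M.HasType a) (i : ι) :
    Module.finrank K V = (a.curry i).degree := by
  obtain ⟨n, hn⟩ := h.exists_eq_bot i
  have h1 := h.finrank_add i n
  rw [hn, finrank_bot, zero_add] at h1
  rw [← h1, Finsupp.degree_apply]
  refine (Finset.sum_subset (fun j hj => ?_) fun j _ hj => by
    simpa using hj).symm
  rw [Finset.mem_range]
  by_contra hj'
  have h2 := h.finrank_add i (j + 1)
  rw [← h1, Finset.sum_range_succ, ← Finset.sum_range_add_sum_Ico _ (not_lt.mp hj')] at h2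
  rw [Finsupp.mem_support_iff, Finsupp.curry_apply] at hj
  omega

/-- The flags are infinite sequences, but past the support of `a` every term is zero, so finitely
many subspaces determine the system. -/
theorem finite_hasType [Finite K] [Finite A] [Finite ι] [FiniteDimensional K V] (a : ι × ℕ →₀ ℕ) :
    Finite {M : LinSys A (ι × ℕ) K V // M.HasType a} := by
  classical
  have := Module.finite_of_finite K (M := V)
  have : Finite (Module.End K V) := DFunLike.finite _
  have : Finite (Submodule K V) := Finite.of_injective _ SetLike.coe_injective
  let N := a.support.sup (fun x => x.2 + 1)
  have hN : ∀ i j, N ≤ j → a (i, j) = 0 := fun i j hj => by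
    by_contra h
    have : j + 1 ≤ N :=
      Finset.le_sup (f := fun x : ι × ℕ => x.2 + 1) (Finsupp.mem_support_iff.mpr h)
    omega
  have hsub : ∀ M : {M : LinSys A (ι × ℕ) K V // M.HasType a}, ∀ i j, N ≤ j →
      M.1.sub (i, j) = ⊥ := fun ⟨M, hM⟩ i j hj => by
    change M.sub (i, j) = ⊥
    obtain ⟨m, hm⟩ := hM.exists_eq_bot i
    have h1 : M.sub (i, max j m) = ⊥ := le_bot_iff.mp (hm ▸ hM.anti i (le_max_right j m))
    have h2 := hM.finrank_add i j
    have h3 := hM.finrank_add i (max j m)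
    rw [h1, finrank_bot, ← Finset.sum_range_add_sum_Ico _ (le_max_left j m),
      Finset.sum_eq_zero (s := Finset.Ico _ _)
        (fun l hl => hN i l (hj.trans (Finset.mem_Ico.mp hl).1))] at h3
    rw [← Submodule.finrank_eq_zero]
    omega
  refine Finite.of_injective (fun M : {M : LinSys A (ι × ℕ) K V // M.HasType a} =>
    (M.1.op, fun y : ι × Fin N => M.1.sub (y.1, y.2))) fun M M' h => ?_
  refine Subtype.ext (ext' (Prod.mk.inj h).1 (funext fun ⟨i, j⟩ => ?_))
  by_cases hj : j < N
  · exact congrFun (Prod.mk.inj h).2 (i, ⟨j, hj⟩)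
  · rw [hsub M i j (not_lt.mp hj), hsub M' i j (not_lt.mp hj)]

end LinSys

namespace IsoClass

variable {A ι K : Type*} [Field K]
variable {V : Type*} [AddCommGroup V] [Module K V] [FiniteDimensional K V]

/-- The type of the flags of an isomorphism class. -/
def HasType (s : IsoClass A (ι × ℕ) K) (a : ι × ℕ →₀ ℕ) : Prop :=
  ∃ (n : ℕ) (M : LinSys A (ι × ℕ) K (Fin n → K)), s = mk M ∧ M.HasType a

theorem hasType_mk {M : LinSys A (ι × ℕ) K V} {a : ι × ℕ →₀ ℕ} :
    (mk M).HasType a ↔ M.HasType a := by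
  constructor
  · rintro ⟨n, N, h, hN⟩
    exact hN.of_iso (mk_eq_mk.mp h).symm
  · intro h
    exact ⟨_, _, mk_eq_mk.mpr (M.iso_transport (Module.finBasis K V).equivFun),
      h.of_iso (M.iso_transport _)⟩

theorem HasType.unique {s : IsoClass A (ι × ℕ) K} {a b : ι × ℕ →₀ ℕ} (h : s.HasType a)
    (h' : s.HasType b) : a = b := by
  obtain ⟨n, M, rfl, hM⟩ := h
  exact hM.unique (hasType_mk.mp h')

theorem HasType.smul {s : IsoClass A (ι × ℕ) K} {a : ι × ℕ →₀ ℕ} (h : s.HasType a)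
    (σ : RingAut K) : (σ • s).HasType a := by
  obtain ⟨n, M, rfl, hM⟩ := h
  obtain ⟨m, N, h1, h2⟩ := exists_isoOver σ M
  rw [h2, hasType_mk]
  exact hM.of_isoOver h1

theorem HasType.add {s t : IsoClass A (ι × ℕ) K} {a b : ι × ℕ →₀ ℕ} (h : s.HasType a)
    (h' : t.HasType b) : (s + t).HasType (a + b) := by
  obtain ⟨n, M, rfl, hM⟩ := h
  obtain ⟨m, N, rfl, hN⟩ := h'
  rw [← mk_prod, hasType_mk]
  exact hM.prod hN

theorem HasType.of_add [Finite ι] {s t : IsoClass A (ι × ℕ) K} {c : ι × ℕ →₀ ℕ}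
    (h : (s + t).HasType c) : ∃ a b, s.HasType a ∧ t.HasType b ∧ a + b = c := by
  obtain ⟨n, M, rfl⟩ := exists_rep s
  obtain ⟨m, N, rfl⟩ := exists_rep t
  rw [← mk_prod, hasType_mk] at h
  obtain ⟨a, b, ha, hb, hab⟩ := h.of_prod
  exact ⟨a, b, hasType_mk.mpr ha, hasType_mk.mpr hb, hab⟩

theorem hasType_zero : (0 : IsoClass A (ι × ℕ) K).HasType 0 := by
  have h : (mk (⟨fun _ => 0, fun _ => ⊤⟩ : LinSys A (ι × ℕ) K (Fin 0 → K))) = 0 :=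
    mk_eq_zero.mpr inferInstance
  rw [← h, hasType_mk]
  exact ⟨fun i j j' _ => le_rfl, fun i j => by simp, fun i => ⟨0, Subsingleton.elim _ _⟩⟩

theorem HasType.eq_zero [Nonempty ι] {s : IsoClass A (ι × ℕ) K} (h : s.HasType 0) : s = 0 := by
  obtain ⟨n, M, rfl, hM⟩ := h
  obtain ⟨i⟩ := ‹Nonempty ι›
  obtain ⟨j, hj⟩ := hM.exists_eq_bot i
  have h1 := hM.finrank_add i j
  rw [hj, finrank_bot] at h1
  rw [mk_eq_zero, ← Module.finrank_zero_iff (R := K), ← h1]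
  simp

theorem hasType_baseChange_iff (L : Type*) [Field L] [Algebra K L] {s : IsoClass A (ι × ℕ) K}
    {a : ι × ℕ →₀ ℕ} : (baseChange L s).HasType a ↔ s.HasType a := by
  obtain ⟨n, M, rfl⟩ := exists_rep s
  rw [baseChange_mk, hasType_mk, hasType_mk, LinSys.hasType_baseChange_iff]

theorem finite_hasType [Finite K] [Finite A] [Finite ι] [Nonempty ι] (a : ι × ℕ →₀ ℕ) :
    {s : IsoClass A (ι × ℕ) K | s.HasType a}.Finite := by
  obtain ⟨i⟩ := ‹Nonempty ι›
  have := LinSys.finite_hasType (A := A) (V := Fin (a.curry i).degree → K) (K := K) a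
  refine (Set.finite_range fun M : {M : LinSys A (ι × ℕ) K (Fin (a.curry i).degree → K) //
    M.HasType a} => mk M.1).subset ?_
  rintro _ ⟨n, M, rfl, hM⟩
  have hn : n = (a.curry i).degree := by
    rw [← hM.finrank_eq i, Module.finrank_fin_fun]
  subst hn
  exact ⟨⟨M, hM⟩, rfl⟩

/-! ### Counting fixed classes -/

/-- The indecomposable classes that have a type. -/
abbrev Flagged (A ι K : Type*) [Field K] : Type _ :=
  {s : IsoClass A (ι × ℕ) K // s.IsIndec ∧ ∃ a, s.HasType a}

namespace Flagged

/-- The type of the flags. -/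
def wt (N : Flagged A ι K) : ι × ℕ →₀ ℕ := N.2.2.choose

theorem hasType_wt (N : Flagged A ι K) : N.1.HasType N.wt := N.2.2.choose_spec

/-- The action of an automorphism of the field. -/
def perm (σ : RingAut K) : Equiv.Perm (Flagged A ι K) where
  toFun N := ⟨σ • N.1, N.2.1.smul σ, N.wt, N.hasType_wt.smul σ⟩
  invFun N := ⟨σ⁻¹ • N.1, N.2.1.smul σ⁻¹, N.wt, N.hasType_wt.smul σ⁻¹⟩
  left_inv N := Subtype.ext (inv_smul_smul σ N.1)
  right_inv N := Subtype.ext (smul_inv_smul σ N.1)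

theorem perm_pow_apply (σ : RingAut K) (n : ℕ) (N : Flagged A ι K) :
    ((perm σ ^ n) N).1 = σ ^ n • N.1 := by
  induction n with
  | zero => simp
  | succ n ih =>
    rw [pow_succ', Equiv.Perm.mul_apply, pow_succ', mul_smul, ← ih]
    rfl

theorem wt_perm (σ : RingAut K) (N : Flagged A ι K) : (perm σ N).wt = N.wt :=
  (perm σ N).hasType_wt.unique (N.hasType_wt.smul σ)

theorem wt_ne_zero [Nonempty ι] (N : Flagged A ι K) : N.wt ≠ 0 := fun h =>
  N.2.1.1 (HasType.eq_zero (h ▸ N.hasType_wt))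

/-- The sum of a multiset of classes. -/
def sum (m : Multiset (Flagged A ι K)) : IsoClass A (ι × ℕ) K := (m.map Subtype.val).sum

theorem hasType_sum (m : Multiset (Flagged A ι K)) : (sum m).HasType (FixedMultiset.weight wt m) := by
  induction m using Multiset.induction with
  | empty => exact hasType_zero
  | cons N m ih =>
    have h := N.hasType_wt.add ih
    rwa [sum, FixedMultiset.weight, Multiset.map_cons, Multiset.sum_cons, Multiset.map_cons,
      Multiset.sum_cons]

theorem sum_map_perm (σ : RingAut K) (m : Multiset (Flagged A ι K)) :
    sum (m.map (perm σ)) = σ • sum m := by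
  rw [sum, sum, Multiset.smul_sum, Multiset.map_map, Multiset.map_map]
  rfl

theorem sum_injective : Function.Injective (sum : Multiset (Flagged A ι K) → _) := fun m m' h => by
  have h' : ∀ m : Multiset (Flagged A ι K), ∀ t ∈ m.map Subtype.val, t.IsIndec := fun m t ht => by
    obtain ⟨N, -, rfl⟩ := Multiset.mem_map.mp ht
    exact N.2.1
  exact Multiset.map_injective Subtype.val_injective (multiset_eq_of_sum_eq (h' m) (h' m') h)

theorem exists_sum_eq [Finite ι] {s : IsoClass A (ι × ℕ) K} {a : ι × ℕ →₀ ℕ} (h : s.HasType a) :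
    ∃ m : Multiset (Flagged A ι K), sum m = s := by
  obtain ⟨m, hm, rfl⟩ := exists_multiset s
  have h1 : ∀ t ∈ m, t.IsIndec ∧ ∃ b, t.HasType b := fun t ht => by
    obtain ⟨m', rfl⟩ := Multiset.exists_cons_of_mem ht
    rw [Multiset.sum_cons] at h
    obtain ⟨b, _, hb, -⟩ := h.of_add
    exact ⟨hm t ht, b, hb⟩
  refine ⟨m.pmap (fun t ht => ⟨t, ht⟩) h1, ?_⟩
  rw [sum, Multiset.map_pmap, Multiset.pmap_eq_map, Multiset.map_id']

/-- The Krull–Schmidt theorem gives injectivity and existence, and the sum commutes with `σ`; fixed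
classes thus correspond to fixed multisets, not only to multisets of fixed classes. -/
theorem bijOn_sum [Finite ι] (σ : RingAut K) (a : ι × ℕ →₀ ℕ) :
    Set.BijOn (sum : Multiset (Flagged A ι K) → _) (FixedMultiset.fixedOfWeight (perm σ) wt a)
      {s | s.HasType a ∧ σ • s = s} := by
  refine ⟨fun m hm => ⟨hm.1 ▸ hasType_sum m, ?_⟩, sum_injective.injOn, fun s hs => ?_⟩
  · rw [← sum_map_perm, hm.2]
  · obtain ⟨m, rfl⟩ := exists_sum_eq hs.1
    refine ⟨m, ⟨(hasType_sum m).unique hs.1, sum_injective ?_⟩, rfl⟩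
    rw [sum_map_perm, hs.2]

end Flagged

/-- The number of classes of type `a` fixed by `σ`. -/
def fixCount (A : Type*) (σ : RingAut K) (a : ι × ℕ →₀ ℕ) : ℕ :=
  {s : IsoClass A (ι × ℕ) K | s.HasType a ∧ σ • s = s}.ncard

/-- The number of indecomposable classes of type `a` fixed by `σ`. -/
def indecCount (A : Type*) (σ : RingAut K) (a : ι × ℕ →₀ ℕ) : ℕ :=
  {s : IsoClass A (ι × ℕ) K | s.IsIndec ∧ s.HasType a ∧ σ • s = s}.ncard

/-- As `n ≠ 0`, the condition `n • wt N = n • b` means that `N` has type `b`, and being fixed by the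
`n`-th power of the permutation means being fixed by `σ ^ n`. -/
theorem finsum_degree_periodicOfWeight (σ : RingAut K) (n : ℕ) (hn : n ≠ 0) (b : ι × ℕ →₀ ℕ) :
    ∑ᶠ N ∈ FixedMultiset.periodicOfWeight (Flagged.perm σ : Equiv.Perm (Flagged A ι K))
      Flagged.wt n (n • b), N.wt.degree = b.degree * indecCount A (σ ^ n) b := by
  have hwt : ∀ N ∈ FixedMultiset.periodicOfWeight (Flagged.perm σ : Equiv.Perm (Flagged A ι K))
      Flagged.wt n (n • b), N.wt = b := fun N hN => nsmul_right_injective hn hN.1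
  have h1 : ∑ᶠ N ∈ FixedMultiset.periodicOfWeight (Flagged.perm σ : Equiv.Perm (Flagged A ι K))
      Flagged.wt n (n • b), N.wt.degree = ∑ᶠ N ∈ FixedMultiset.periodicOfWeight
        (Flagged.perm σ : Equiv.Perm (Flagged A ι K)) Flagged.wt n (n • b), b.degree * 1 :=
    finsum_mem_congr rfl fun N hN => by rw [hwt N hN, mul_one]
  rw [h1, ← mul_finsum_mem, finsum_one, indecCount]
  congr 1
  refine Set.ncard_congr (fun N _ => N.1) (fun N hN => ⟨N.2.1, hwt N hN ▸ N.hasType_wt, ?_⟩)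
    (fun _ _ _ _ h => Subtype.ext h) fun s hs => ⟨⟨s, hs.1, b, hs.2.1⟩, ⟨?_, ?_⟩, rfl⟩
  · rw [← Flagged.perm_pow_apply, hN.2]
  · rw [HasType.unique (Flagged.hasType_wt ⟨s, hs.1, b, hs.2.1⟩) hs.2.1]
  · exact Subtype.ext ((Flagged.perm_pow_apply σ n _).trans hs.2.2)

/-- This is `degree_mul_card` for the indecomposable classes. The function `T` replaces the inner
sum: it is prescribed on multiples of `n + 1` and vanishes elsewhere, which is the shape of a
coefficient of `ψ_{n+1}`. -/
theorem degree_mul_fixCount [DecidableEq ι] [Finite ι] [Nonempty ι] {σ : RingAut K}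
    (hfin : ∀ a, {s : IsoClass A (ι × ℕ) K | s.HasType a ∧ σ • s = s}.Finite)
    (T : ℕ → (ι × ℕ →₀ ℕ) → ℕ)
    (hT : ∀ n b, T n ((n + 1) • b) = b.degree * indecCount A (σ ^ (n + 1)) b)
    (hT0 : ∀ n c, (¬∃ b, c = (n + 1) • b) → T n c = 0) (a : ι × ℕ →₀ ℕ) :
    a.degree * fixCount A σ a = ∑ p ∈ Finset.HasAntidiagonal.antidiagonal a,
      fixCount A σ p.1 * ∑ n ∈ Finset.range p.2.degree, T n p.2 := by
  have h1 : ∀ a, (FixedMultiset.fixedOfWeight (Flagged.perm σ : Equiv.Perm (Flagged A ι K))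
      Flagged.wt a).ncard = fixCount A σ a := fun a => by
    rw [fixCount, ← (Flagged.bijOn_sum σ a).image_eq, Set.ncard_image_of_injective _
      Flagged.sum_injective]
  have h2 := FixedMultiset.degree_mul_card (F := (Flagged.perm σ : Equiv.Perm (Flagged A ι K)))
    (Flagged.wt_perm σ) Flagged.wt_ne_zero (fun a => (Flagged.bijOn_sum σ a).finite_iff_finite.mpr
      (hfin a)) a
  simp only [h1] at h2
  rw [h2]
  refine Finset.sum_congr rfl fun p _ => congrArg _ (Finset.sum_congr rfl fun n _ => ?_)
  by_cases h : ∃ b, p.2 = (n + 1) • b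
  · obtain ⟨b, hb⟩ := h
    rw [hb, hT, finsum_degree_periodicOfWeight σ _ n.succ_ne_zero]
  · rw [hT0 n _ h]
    have : FixedMultiset.periodicOfWeight (Flagged.perm σ : Equiv.Perm (Flagged A ι K))
        Flagged.wt (n + 1) p.2 = ∅ := Set.eq_empty_of_forall_notMem fun N hN => h ⟨_, hN.1.symm⟩
    rw [this, finsum_mem_empty]

end IsoClass

end

/-! ### Classes over finite fields as fixed points of Frobenius, and the identity for their series.
-/

noncomputable section

namespace IsoClass

variable {A ι : Type*}

/-- The number of classes of type `a` over `K`. -/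
def classCount (A K : Type*) [Field K] (a : ι × ℕ →₀ ℕ) : ℕ :=
  {s : IsoClass A (ι × ℕ) K | s.HasType a}.ncard

/-- The number of absolutely indecomposable classes of type `a` over `K`. -/
def absCount (A K : Type*) [Field K] (a : ι × ℕ →₀ ℕ) : ℕ :=
  {s : IsoClass A (ι × ℕ) K | (baseChange (AlgebraicClosure K) s).IsIndec ∧ s.HasType a}.ncard

/-- Used to compare two algebraic closures of `K`, which embed in one another. -/
theorem isIndec_baseChange_iff {J K L L' : Type*} [Field K] [Field L] [Field L'] [Algebra K L]
    [Algebra K L'] (f : L →ₐ[K] L') (f' : L' →ₐ[K] L) (s : IsoClass A J K) :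
    (baseChange L s).IsIndec ↔ (baseChange L' s).IsIndec := by
  obtain ⟨n, M, rfl⟩ := exists_rep s
  rw [baseChange_mk, baseChange_mk, isIndec_mk, isIndec_mk]
  exact ⟨fun h => h.of_baseChange f', fun h => h.of_baseChange f⟩

section

variable {K Ω : Type*} [Field K] [Finite K] [Field Ω] [Algebra K Ω] [Algebra.IsAlgebraic K Ω]
  [IsAlgClosed Ω] {σ : RingAut Ω}

/-- Extension of scalars from `K` is injective on classes by the Noether–Deuring theorem, and its
image consists of the classes fixed by the Frobenius of `K`. -/
theorem fixCount_eq_classCount (hσ : ∀ x, σ x = x ^ Nat.card K) (a : ι × ℕ →₀ ℕ) :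
    fixCount A σ a = classCount A K a := by
  rw [fixCount, classCount, ← Set.ncard_image_of_injective _ (baseChange_injective (K := K) Ω)]
  congr 1
  ext s
  constructor
  · rintro ⟨h1, h2⟩
    obtain ⟨t, rfl⟩ := (exists_baseChange_eq_iff hσ s).mpr h2
    exact ⟨t, (hasType_baseChange_iff Ω).mp h1, rfl⟩
  · rintro ⟨t, ht, rfl⟩
    exact ⟨(hasType_baseChange_iff Ω).mpr ht, (exists_baseChange_eq_iff hσ _).mp ⟨t, rfl⟩⟩

theorem indecCount_eq_absCount (hσ : ∀ x, σ x = x ^ Nat.card K) (a : ι × ℕ →₀ ℕ) :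
    indecCount A σ a = absCount A K a := by
  have hcl : IsAlgClosure K Ω := ⟨inferInstance, inferInstance⟩
  have h0 : ∀ s : IsoClass A (ι × ℕ) K, (baseChange (AlgebraicClosure K) s).IsIndec ↔
      (baseChange Ω s).IsIndec := fun s =>
    isIndec_baseChange_iff (IsAlgClosed.lift : AlgebraicClosure K →ₐ[K] Ω) IsAlgClosed.lift s
  rw [indecCount, absCount, ← Set.ncard_image_of_injective _ (baseChange_injective (K := K) Ω)]
  congr 1
  ext s
  constructor
  · rintro ⟨h1, h2, h3⟩
    obtain ⟨t, rfl⟩ := (exists_baseChange_eq_iff hσ s).mpr h3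
    exact ⟨t, ⟨(h0 t).mpr h1, (hasType_baseChange_iff Ω).mp h2⟩, rfl⟩
  · rintro ⟨t, ht, rfl⟩
    exact ⟨(h0 t).mp ht.1, (hasType_baseChange_iff Ω).mpr ht.2,
      (exists_baseChange_eq_iff hσ _).mp ⟨t, rfl⟩⟩

theorem finite_fixed [Finite A] [Finite ι] [Nonempty ι] (hσ : ∀ x, σ x = x ^ Nat.card K)
    (a : ι × ℕ →₀ ℕ) : {s : IsoClass A (ι × ℕ) Ω | s.HasType a ∧ σ • s = s}.Finite := by
  refine ((finite_hasType (K := K) a).image (baseChange Ω)).subset fun s hs => ?_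
  obtain ⟨t, rfl⟩ := (exists_baseChange_eq_iff hσ s).mpr hs.2
  exact ⟨t, (hasType_baseChange_iff Ω).mp hs.1, rfl⟩

end

section

variable (p : ℕ) [Fact p.Prime]

/-- The Frobenius automorphism. -/
def frob : RingAut (AlgebraicClosure (ZMod p)) := frobeniusEquiv _ p

theorem frob_pow_apply (m : ℕ) (x : AlgebraicClosure (ZMod p)) : (frob p ^ m) x = x ^ p ^ m := by
  induction m generalizing x with
  | zero => simp
  | succ m ih =>
    rw [pow_succ, RingAut.mul_apply, ih, pow_succ', pow_mul]
    rfl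

/-- An embedding in the algebraic closure of the prime field. -/
theorem exists_algebra (K : Type*) [Field K] [Finite K] [CharP K p] :
    ∃ _ : Algebra K (AlgebraicClosure (ZMod p)),
      Algebra.IsAlgebraic K (AlgebraicClosure (ZMod p)) := by
  let _ := ZMod.algebra K p
  let f : K →ₐ[ZMod p] AlgebraicClosure (ZMod p) := IsAlgClosed.lift
  let _ := f.toRingHom.toAlgebra
  have : IsScalarTower (ZMod p) K (AlgebraicClosure (ZMod p)) :=
    IsScalarTower.of_algebraMap_eq fun x => (f.commutes x).symm
  exact ⟨inferInstance, Algebra.IsAlgebraic.tower_top (K := ZMod p) K⟩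

variable {K : Type*} [Field K] [Finite K] [CharP K p] {m : ℕ}

/-- All finite fields of characteristic `p` are compared inside one closure of the prime field,
where the field with `p ^ m` elements corresponds to the `m`-th power of a single automorphism. -/
theorem fixCount_frob_pow (h : Nat.card K = p ^ m) (a : ι × ℕ →₀ ℕ) :
    fixCount A (frob p ^ m) a = classCount A K a := by
  obtain ⟨_, _⟩ := exists_algebra p K
  exact fixCount_eq_classCount (fun x => by rw [frob_pow_apply, h]) a

theorem indecCount_frob_pow (h : Nat.card K = p ^ m) (a : ι × ℕ →₀ ℕ) :
    indecCount A (frob p ^ m) a = absCount A K a := by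
  obtain ⟨_, _⟩ := exists_algebra p K
  exact indecCount_eq_absCount (fun x => by rw [frob_pow_apply, h]) a

end

/-- Both numbers count the fixed points of the same power of the same Frobenius. -/
theorem classCount_congr {K K' : Type*} [Field K] [Finite K] [Field K'] [Finite K']
    (h : Nat.card K = Nat.card K') (a : ι × ℕ →₀ ℕ) : classCount A K a = classCount A K' a := by
  obtain ⟨p, hp⟩ := CharP.exists K
  have : Fact p.Prime := ⟨CharP.char_is_prime K p⟩
  have := Fintype.ofFinite K
  have := Fintype.ofFinite K'
  obtain ⟨n, -, hn⟩ := FiniteField.card K p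
  obtain ⟨p', hp'⟩ := CharP.exists K'
  obtain ⟨n', hn1, hn'⟩ := FiniteField.card K' p'
  rw [← Nat.card_eq_fintype_card] at hn hn'
  have hpp : p' = p := by
    rw [hn, hn'] at h
    exact ((Nat.prime_dvd_prime_iff_eq hn1 Fact.out).mp (hn1.dvd_of_dvd_pow
      (h ▸ dvd_pow_self p' n'.ne_zero)))
  subst hpp
  rw [← fixCount_frob_pow p' hn, ← fixCount_frob_pow p' (h ▸ hn)]

/-! ### The generating series -/

open MvPowerSeries Plethysm

theorem isAdams_adams : IsAdams PrimePower.adams :=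
  ⟨fun x => funext fun q => congrArg x (Subtype.ext (pow_one q.1)),
    fun m n x => funext fun q => congrArg x (Subtype.ext (pow_mul q.1 m n).symm)⟩

/-- The generating series of the numbers of classes. -/
def classSeries (A ι : Type*) : MvPowerSeries (ι × ℕ) (PrimePower → ℚ) :=
  fun a q => classCount A q.Fq a

/-- The generating series of the numbers of absolutely indecomposable classes. -/
def absSeries (A ι : Type*) : MvPowerSeries (ι × ℕ) (PrimePower → ℚ) :=
  fun a q => absCount A q.Fq a

/-- The operation `ψ_n` on functions of `q` corresponds to passing to the `n`-th power of the
Frobenius of `𝔽_q`. -/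
theorem absCount_pow (q : PrimePower) (n : ℕ+) (a : ι × ℕ →₀ ℕ) :
    absCount A (q.pow n).Fq a =
      indecCount A ((frob q.char ^ q.1.factorization q.char) ^ (n : ℕ)) a := by
  have h1 : (q.pow n).char = q.char := Nat.pow_minFac n.ne_zero
  have : CharP (q.pow n).Fq q.char := CharP.congr _ h1
  have h2 : q.char ^ q.1.factorization q.char = q.1 := q.2.minFac_pow_factorization_eq
  rw [← pow_mul, indecCount_frob_pow q.char (K := (q.pow n).Fq)]
  rw [PrimePower.card_Fq, pow_mul, h2]
  rfl

theorem classCount_zero [Nonempty ι] (K : Type*) [Field K] : classCount A K (0 : ι × ℕ →₀ ℕ) = 1 := by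
  rw [classCount, Set.ncard_eq_one]
  refine ⟨0, Set.eq_singleton_iff_unique_mem.mpr ⟨hasType_zero, fun s hs => hs.eq_zero⟩⟩

theorem absCount_zero [Nonempty ι] (K : Type*) [Field K] : absCount A K (0 : ι × ℕ →₀ ℕ) = 0 := by
  rw [absCount]
  have : {s : IsoClass A (ι × ℕ) K | (baseChange (AlgebraicClosure K) s).IsIndec ∧ s.HasType 0} = ∅ := by
    refine Set.eq_empty_of_forall_notMem fun s hs => hs.1.1 ?_
    rw [hs.2.eq_zero, map_zero]
  rw [this, Set.ncard_empty]

/-- By `Log_eq_iff` the claim is an equation of Euler derivatives, and at each exponent and each `q`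
it is `degree_mul_fixCount` for the Frobenius of `𝔽_q`. -/
theorem Log_classSeries [Finite A] [Finite ι] [Nonempty ι] [DecidableEq ι] :
    Log PrimePower.adams (classSeries A ι) = absSeries A ι := by
  classical
  refine (Log_eq_iff isAdams_adams ?_ ?_).mpr ?_
  · ext q
    change ((classCount A q.Fq 0 : ℕ) : ℚ) = 1
    rw [classCount_zero, Nat.cast_one]
  · ext q
    change ((absCount A q.Fq 0 : ℕ) : ℚ) = 0
    rw [absCount_zero, Nat.cast_zero]
  ext a q
  set m := q.1.factorization q.char
  have hq : Nat.card q.Fq = q.char ^ m :=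
    (PrimePower.card_Fq q).trans q.2.minFac_pow_factorization_eq.symm
  obtain ⟨_, _⟩ := exists_algebra q.char q.Fq
  -- At `c = (n + 1) • b` the value depends on `b` alone, which is unique.
  let T : ℕ → (ι × ℕ →₀ ℕ) → ℕ := fun n c => if h : ∃ b, c = (n + 1) • b then
    h.choose.degree * indecCount A ((frob q.char ^ m) ^ (n + 1)) h.choose else 0
  have hT : ∀ n b, T n ((n + 1) • b) =
      b.degree * indecCount A ((frob q.char ^ m) ^ (n + 1)) b := fun n b => by
    have h : ∃ b', (n + 1) • b = (n + 1) • b' := ⟨b, rfl⟩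
    have h1 : h.choose = b := (nsmul_right_injective n.succ_ne_zero h.choose_spec).symm
    simp only [T]
    rw [dif_pos h, h1]
  have hT0 : ∀ n c, (¬∃ b, c = (n + 1) • b) → T n c = 0 := fun n c h => dif_neg h
  have key := degree_mul_fixCount (A := A) (σ := frob q.char ^ m)
    (finite_fixed (K := q.Fq) fun x => by rw [frob_pow_apply, hq]) T hT hT0 a
  simp only [fixCount_frob_pow q.char hq] at key
  -- At `c = (n + 1) • b` the factor `deg c / (n + 1)` is `deg b`, and the coefficient of `ψ_{n+1}`
  -- at `c` is the count for `b` over the extension of degree `n + 1`. At other exponents both sides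
  -- vanish.
  have hTq : ∀ n c, (T n c : ℚ) = ((c.degree : ℚ) / (n + 1 : ℕ)) *
      coeff c (adams PrimePower.adams n.succPNat (absSeries A ι)) q := fun n c => by
    by_cases h : ∃ b, c = (n + 1) • b
    · obtain ⟨b, rfl⟩ := h
      have h1 := coeff_smul_adams PrimePower.adams n.succPNat (absSeries A ι) b
      have h2 : coeff ((n + 1) • b) (adams PrimePower.adams n.succPNat (absSeries A ι)) q =
        (absCount A (q.pow n.succPNat).Fq b : ℚ) := congrFun h1 q
      rw [hT, h2, absCount_pow, map_nsmul]
      push_cast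
      have : ((n : ℚ) + 1) ≠ 0 := by positivity
      simp only [nsmul_eq_mul, Nat.succPNat_coe, Nat.succ_eq_add_one]
      push_cast
      field_simp
      rfl
    · obtain ⟨x, hx⟩ : ∃ x, ¬(n.succPNat : ℕ) ∣ c x := by
        by_contra! h1
        refine h ⟨c.mapRange (fun i => i / (n + 1)) (Nat.zero_div _), Finsupp.ext fun x => ?_⟩
        simpa using (Nat.mul_div_cancel' (h1 x)).symm
      rw [hT0 n c h, adams, coeff_expand_of_not_dvd _ _ _ hx]
      simp
  rw [coeff_mul, coeff_euler]
  have h3 : (∑ p ∈ Finset.HasAntidiagonal.antidiagonal a, coeff p.1 (classSeries A ι) *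
      coeff p.2 (euler (psi PrimePower.adams (absSeries A ι)))) q =
      ∑ p ∈ Finset.HasAntidiagonal.antidiagonal a, (classCount A q.Fq p.1 : ℚ) *
        ∑ n ∈ Finset.range p.2.degree, (T n p.2 : ℚ) := by
    rw [Finset.sum_apply]
    refine Finset.sum_congr rfl fun p _ => ?_
    rw [Pi.mul_apply, coeff_euler_psi, Finset.sum_apply]
    simp only [hTq]
    rfl
  rw [h3]
  have h4 := congrArg (Nat.cast : ℕ → ℚ) key
  push_cast at h4
  rw [← h4, Pi.smul_apply, nsmul_eq_mul]
  rfl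

end IsoClass

end

noncomputable section

/-! ### Chains of prescribed ranks -/

section Chains

open Classical Finset

variable {L : Type*} [PartialOrder L] [Fintype L] (d : L → ℕ)

/-- The number of chains that start at `W`, with the given differences of ranks, and end in
rank `0`. -/
def chainCount : List ℕ → L → ℕ
  | [], W => if d W = 0 then 1 else 0
  | a :: l, W => ∑ W' with W' ≤ W ∧ d W' + a = d W, chainCount l W'

variable {d}

/-- Summing over the third term of the chain first leaves the number of possible second terms
between `W₂` and `W` as the only factor that depends on the order of `a` and `b`. -/
theorem chainCount_cons_cons (a b : ℕ) (l : List ℕ) (W : L) :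
    chainCount d (a :: b :: l) W = ∑ W₂ with W₂ ≤ W ∧ d W₂ + a + b = d W,
      #{W₁ | W₂ ≤ W₁ ∧ W₁ ≤ W ∧ d W₁ + a = d W} * chainCount d l W₂ := by
  simp only [chainCount]
  rw [sum_comm' (s' := fun W₂ => {W₁ | W₂ ≤ W₁ ∧ W₁ ≤ W ∧ d W₁ + a = d W})
    (t' := {W₂ | W₂ ≤ W ∧ d W₂ + a + b = d W})]
  · exact sum_congr rfl fun W₂ _ => by rw [sum_const, smul_eq_mul]
  · intro W₁ W₂
    simp only [mem_filter, mem_univ, true_and]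
    constructor
    · rintro ⟨⟨h1, h2⟩, h3, h4⟩
      exact ⟨⟨h3, h1, h2⟩, h3.trans h1, by omega⟩
    · rintro ⟨⟨h1, h2, h3⟩, h4, h5⟩
      exact ⟨⟨h2, h3⟩, h1, by omega⟩

/-- Adjacent transpositions generate all permutations, and `h` says that exchanging two adjacent
steps does not change the number of intermediate elements. -/
theorem chainCount_perm (h : ∀ W₂ W a b, W₂ ≤ W → d W₂ + a + b = d W →
    #{W₁ | W₂ ≤ W₁ ∧ W₁ ≤ W ∧ d W₁ + a = d W} = #{W₁ | W₂ ≤ W₁ ∧ W₁ ≤ W ∧ d W₁ + b = d W})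
    {l l' : List ℕ} (hl : l.Perm l') (W : L) : chainCount d l W = chainCount d l' W := by
  induction hl generalizing W with
  | nil => rfl
  | cons a _ ih => exact sum_congr rfl fun W' _ => ih W'
  | trans _ _ ih ih' => exact (ih W).trans (ih' W)
  | swap a b l =>
    rw [chainCount_cons_cons, chainCount_cons_cons]
    refine sum_congr ?_ fun W₂ hW₂ => ?_
    · ext W₂
      simp only [mem_filter, mem_univ, true_and, add_right_comm]
    · simp only [mem_filter, mem_univ, true_and] at hW₂
      rw [h W₂ W b a hW₂.1 (by omega)]

/-- A step of size zero repeats the same element. -/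
theorem chainCount_filter (hd : ∀ W' W, W' ≤ W → d W' = d W → W' = W) (l : List ℕ) (W : L) :
    chainCount d (l.filter (· ≠ 0)) W = chainCount d l W := by
  induction l generalizing W with
  | nil => rfl
  | cons a l ih =>
    by_cases ha : a = 0
    · subst ha
      have h : ({W' | W' ≤ W ∧ d W' + 0 = d W} : Finset L) = {W} := by
        ext W'
        simp only [mem_filter, mem_univ, true_and, mem_singleton, add_zero]
        exact ⟨fun h => hd _ _ h.1 h.2, fun h => h ▸ ⟨le_rfl, rfl⟩⟩
      rw [List.filter_cons_of_neg (by simp), ih, chainCount, h, sum_singleton]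
    · rw [List.filter_cons_of_pos (by simpa using ha)]
      exact sum_congr rfl fun W' _ => ih W'

variable (d)

/-- The infinite flags that start at `W`, with the given differences of ranks, and end in
rank `0`. -/
def rankFlags (c : ℕ → ℕ) (W : L) : Set (ℕ → L) :=
  {E | Antitone E ∧ (∀ j, d (E j) + ∑ l ∈ range j, c l = d W) ∧ E 0 = W ∧ ∃ n, d (E n) = 0}

variable {d}

/-- A flag is its second term and the flag that starts there. -/
def rankFlagsEquiv (c : ℕ → ℕ) (W : L) : rankFlags d c W ≃
    Σ W' : {W' // W' ∈ ({W' | W' ≤ W ∧ d W' + c 0 = d W} : Finset L)},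
      rankFlags d (fun j => c (j + 1)) W'.1 where
  toFun E := ⟨⟨E.1 1, by
      have h := E.2.2.1 1
      rw [sum_range_one] at h
      simp only [mem_filter, mem_univ, true_and]
      exact ⟨(E.2.1 zero_le_one).trans_eq E.2.2.2.1, h⟩⟩, fun j => E.1 (j + 1),
    fun i j hij => E.2.1 (Nat.succ_le_succ hij), fun j => by
      have h1 := E.2.2.1 1
      have h2 := E.2.2.1 (j + 1)
      rw [sum_range_one] at h1
      rw [sum_range_succ'] at h2
      simp only
      omega, rfl, by
      obtain ⟨n, hn⟩ := E.2.2.2.2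
      -- The same `n` serves for the shifted flag, since the rank cannot grow from `E n` to `E (n +
      -- 1)`.
      refine ⟨n, ?_⟩
      have h1 := E.2.2.1 n
      have h2 := E.2.2.1 (n + 1)
      rw [sum_range_succ] at h2
      simp only
      omega⟩
  invFun E := ⟨fun j => Nat.casesOn j W E.2.1, by
      have hW := (mem_filter.mp E.1.2).2
      refine antitone_nat_of_succ_le fun j => ?_
      cases j with
      | zero => exact (E.2.2.2.2.1).trans_le hW.1
      | succ j => exact E.2.2.1 (Nat.le_succ j), fun j => by
      have hW := (mem_filter.mp E.1.2).2
      cases j with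
      | zero => simp
      | succ j =>
        rw [sum_range_succ']
        exact (add_assoc _ _ _).symm.trans ((congrArg (· + c 0) (E.2.2.2.1 j)).trans hW.2), rfl, by
      obtain ⟨n, hn⟩ := E.2.2.2.2.2
      exact ⟨n + 1, hn⟩⟩
  left_inv E := by
    refine Subtype.ext (funext fun j => ?_)
    cases j with
    | zero => exact E.2.2.2.1.symm
    | succ j => rfl
  right_inv E := by
    obtain ⟨⟨W', hW'⟩, E, h1, h2, h3, h4⟩ := E
    have h5 : E 0 = W' := h3
    subst h5
    rfl

/-- The first `N` steps determine the flag, as it is constant afterwards. -/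
theorem card_rankFlags (hd : ∀ W' W, W' ≤ W → d W' = d W → W' = W) {N : ℕ} {c : ℕ → ℕ}
    (hc : ∀ j, N ≤ j → c j = 0) (W : L) : Finite (rankFlags d c W) ∧
      Nat.card (rankFlags d c W) = chainCount d ((List.range N).map c) W := by
  induction N generalizing c W with
  | zero =>
    have h0 : c = fun _ => 0 := funext fun j => hc j (Nat.zero_le j)
    subst h0
    have h1 : rankFlags d (fun _ => 0) W = if d W = 0 then {fun _ => W} else ∅ := by
      ext E
      constructor
      · rintro ⟨h1, h2, h3, n, h4⟩
        have h5 := h2 n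
        rw [h4, sum_const_zero] at h5
        rw [if_pos (by omega)]
        refine funext fun j => hd _ _ (h3 ▸ h1 (Nat.zero_le j)) ?_
        have h6 := h2 j
        rwa [sum_const_zero] at h6
      · intro h
        split_ifs at h with h1
        · rw [Set.mem_singleton_iff.mp h]
          exact ⟨antitone_const, fun j => by simp, rfl, 0, h1⟩
        · exact absurd h (Set.notMem_empty _)
    rw [h1]
    simp only [List.range_zero, List.map_nil, chainCount]
    split_ifs with h
    · exact ⟨Set.finite_singleton _, by simp⟩
    · exact ⟨Set.finite_empty, by simp⟩
  | succ N ih =>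
    have hc' : ∀ j, N ≤ j → c (j + 1) = 0 := fun j hj => hc _ (Nat.succ_le_succ hj)
    have : ∀ W' : L, Finite (rankFlags d (fun j => c (j + 1)) W') := fun W' => (ih hc' W').1
    refine ⟨Finite.of_equiv _ (rankFlagsEquiv c W).symm, ?_⟩
    rw [Nat.card_congr (rankFlagsEquiv c W), Nat.card_sigma, List.range_succ_eq_map, List.map_cons,
      chainCount, List.map_map]
    rw [← Finset.sum_coe_sort ({W' | W' ≤ W ∧ d W' + c 0 = d W} : Finset L)]
    exact sum_congr rfl fun W' _ => (ih hc' W'.1).2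

/-- Truncating to lists and deleting the zeros turns equal multisets of nonzero values into lists
that are permutations of each other, so `chainCount_perm` applies. -/
theorem card_rankFlags_congr (hd : ∀ W' W, W' ≤ W → d W' = d W → W' = W)
    (h : ∀ W₂ W a b, W₂ ≤ W → d W₂ + a + b = d W →
    #{W₁ | W₂ ≤ W₁ ∧ W₁ ≤ W ∧ d W₁ + a = d W} = #{W₁ | W₂ ≤ W₁ ∧ W₁ ≤ W ∧ d W₁ + b = d W})
    {c c' : ℕ →₀ ℕ} (hc : c.support.val.map c = c'.support.val.map c') (W : L) :
    Nat.card (rankFlags d c W) = Nat.card (rankFlags d c' W) := by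
  have key : ∀ c : ℕ →₀ ℕ, ∃ N, (∀ j, N ≤ j → c j = 0) ∧
      ((((List.range N).map c).filter (· ≠ 0) : List ℕ) : Multiset ℕ) = c.support.val.map c := by
    intro c
    refine ⟨c.support.sup (· + 1), fun j hj => by_contra fun h => ?_, ?_⟩
    · have : j + 1 ≤ c.support.sup (· + 1) :=
        Finset.le_sup (f := (· + 1)) (Finsupp.mem_support_iff.mpr h)
      omega
    · have h1 : c.support = (range (c.support.sup (· + 1))).filter (fun j => c j ≠ 0) := by
        ext j
        simp only [Finsupp.mem_support_iff, mem_filter, mem_range]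
        refine ⟨fun h => ⟨?_, h⟩, fun h => h.2⟩
        exact Finset.le_sup (f := (· + 1)) (Finsupp.mem_support_iff.mpr h)
      conv_rhs => rw [h1]
      rw [filter_val, range_val, Multiset.range, Multiset.filter_coe, Multiset.map_coe,
        List.filter_map]
      rfl
  obtain ⟨N, hN, h1⟩ := key c
  obtain ⟨N', hN', h1'⟩ := key c'
  rw [(card_rankFlags hd hN W).2, (card_rankFlags hd hN' W).2, ← chainCount_filter hd,
    ← chainCount_filter hd ((List.range N').map c')]
  refine chainCount_perm h (Multiset.coe_eq_coe.mp ?_) W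
  rw [h1, h1', hc]

end Chains

end

noncomputable section

open Polynomial

/-! ### Torsion modules over `K[X]` are self-dual -/

section SelfDual

variable {K : Type*} [Field K]

/-- A nondegenerate symmetric bilinear form for which the polynomials are self-adjoint. -/
structure SelfDualForm (K : Type*) [Field K] (N : Type*) [AddCommGroup N] [Module K[X] N] where
  form : N → N → K
  add_left : ∀ x y z, form (x + y) z = form x z + form y z
  symm : ∀ x y, form x y = form y x
  smul_left : ∀ (p : K[X]) x y, form (p • x) y = form x (p • y)
  C_smul_left : ∀ (c : K) x y, form (C c • x) y = c * form x y
  nondegenerate : ∀ x, (∀ y, form x y = 0) → x = 0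

namespace SelfDualForm

variable {N N' : Type*} [AddCommGroup N] [Module K[X] N] [AddCommGroup N'] [Module K[X] N']

/-- Transport along an isomorphism. -/
def congr (B : SelfDualForm K N') (e : N ≃ₗ[K[X]] N') : SelfDualForm K N where
  form x y := B.form (e x) (e y)
  add_left x y z := by rw [map_add, B.add_left]
  symm x y := B.symm _ _
  smul_left p x y := by rw [map_smul, map_smul, B.smul_left]
  C_smul_left c x y := by rw [map_smul, B.C_smul_left]
  nondegenerate x h := by
    rw [← e.map_eq_zero_iff]
    exact B.nondegenerate _ fun y => by simpa using h (e.symm y)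

theorem zero_left (B : SelfDualForm K N) (y : N) : B.form 0 y = 0 := by
  simpa using B.add_left 0 0 y

/-- The orthogonal direct sum. -/
def directSum {ι : Type*} [Fintype ι] {N : ι → Type*} [∀ i, AddCommGroup (N i)]
    [∀ i, Module K[X] (N i)] (B : ∀ i, SelfDualForm K (N i)) :
    SelfDualForm K (DirectSum ι N) where
  form x y := ∑ i, (B i).form (x i) (y i)
  add_left x y z := by
    rw [← Finset.sum_add_distrib]
    exact Finset.sum_congr rfl fun i _ => (B i).add_left _ _ _
  symm x y := Finset.sum_congr rfl fun i _ => (B i).symm _ _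
  smul_left p x y := Finset.sum_congr rfl fun i _ => (B i).smul_left _ _ _
  C_smul_left c x y := by
    rw [Finset.mul_sum]
    exact Finset.sum_congr rfl fun i _ => (B i).C_smul_left _ _ _
  nondegenerate x h := by
    classical
    refine DFinsupp.ext fun i => (B i).nondegenerate _ fun y => ?_
    have h1 := h (DirectSum.of N i y)
    rw [Finset.sum_eq_single i] at h1
    · rwa [DirectSum.of_eq_same] at h1
    · intro j _ hj
      rw [DirectSum.of_eq_of_ne _ _ _ hj, (B j).symm, (B j).zero_left]
    · exact fun hi => absurd (Finset.mem_univ i) hi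

/-- The top coefficient of the remainder modulo `f` of a product. -/
def topCoeff (f p q : K[X]) : K := ((p * q) % f).coeff (f.natDegree - 1)

theorem topCoeff_add (f p p' q : K[X]) :
    topCoeff f (p + p') q = topCoeff f p q + topCoeff f p' q := by
  rw [topCoeff, add_mul, add_mod, coeff_add, topCoeff, topCoeff]

theorem topCoeff_comm (f p q : K[X]) : topCoeff f p q = topCoeff f q p := by
  rw [topCoeff, mul_comm, topCoeff]

theorem topCoeff_dvd (f p q : K[X]) (h : f ∣ p) : topCoeff f p q = 0 := by
  rw [topCoeff, EuclideanDomain.mod_eq_zero.mpr (h.mul_right q), coeff_zero]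

theorem topCoeff_congr {f p p' : K[X]} (h : f ∣ p - p') (q : K[X]) :
    topCoeff f p q = topCoeff f p' q := by
  rw [← sub_add_cancel p p', topCoeff_add, topCoeff_dvd _ _ _ h, zero_add]

theorem C_mul_mod (c : K) (p f : K[X]) : (C c * p) % f = C c * (p % f) := by
  rw [mod_def, mod_def, ← smul_eq_C_mul, smul_modByMonic, smul_eq_C_mul]

/-- This is the nondegeneracy of the form on `K[X] / f`: a nonzero remainder `r` is multiplied by
the power of `X` that moves its leading term to degree `deg f - 1`, where the form reads it off. -/
theorem dvd_of_topCoeff {f p : K[X]} (hf : f ≠ 0) (h : ∀ q, topCoeff f p q = 0) : f ∣ p := by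
  rw [← EuclideanDomain.mod_eq_zero]
  by_contra hr
  have h1 : (p % f).degree < f.degree := degree_mod_lt p hf
  have h2 : (p % f).natDegree < f.natDegree := natDegree_lt_natDegree hr h1
  have h3 : f ∣ p - p % f := by
    rw [← EuclideanDomain.mod_eq_zero, sub_mod, (mod_eq_self_iff hf).mpr h1, sub_self]
  have h4 := h (X ^ (f.natDegree - 1 - (p % f).natDegree))
  rw [topCoeff_congr h3, topCoeff, (mod_eq_self_iff hf).mpr, coeff_mul_X_pow'] at h4
  · rw [if_pos (by omega), show f.natDegree - 1 - (f.natDegree - 1 - (p % f).natDegree) =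
      (p % f).natDegree by omega, coeff_natDegree, leadingCoeff_eq_zero] at h4
    exact hr h4
  · rw [degree_eq_natDegree (mul_ne_zero hr (pow_ne_zero _ X_ne_zero)), degree_eq_natDegree hf,
      natDegree_mul hr (pow_ne_zero _ X_ne_zero), natDegree_X_pow]
    exact_mod_cast (by omega)

-- On `K[X] / f` the form takes the top coefficient of a product reduced modulo `f`. It is symmetric
-- and multiplication is self-adjoint since the ring is commutative. It is defined by chosen
-- representatives, on which it does not depend.
open Submodule in
theorem exists_quotient {f : K[X]} (hf : f ≠ 0) : Nonempty (SelfDualForm K (K[X] ⧸ K[X] ∙ f)) := by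
  let s : (K[X] ⧸ K[X] ∙ f) → K[X] := Function.surjInv (mkQ_surjective _)
  have hs : ∀ p, f ∣ s (mkQ _ p) - p := fun p => by
    rw [← Ideal.mem_span_singleton]
    exact (Submodule.Quotient.eq _).mp (Function.surjInv_eq (mkQ_surjective (K[X] ∙ f)) _)
  have hB : ∀ p q, topCoeff f (s (mkQ _ p)) (s (mkQ _ q)) = topCoeff f p q := fun p q => by
    rw [topCoeff_congr (hs p), topCoeff_comm, topCoeff_congr (hs q), topCoeff_comm]
  have hsurj := mkQ_surjective (K[X] ∙ f)
  refine ⟨⟨fun x y => topCoeff f (s x) (s y), ?_, fun x y => topCoeff_comm _ _ _, ?_, ?_, ?_⟩⟩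
  · refine hsurj.forall₃.mpr fun x y z => ?_
    rw [← map_add, hB, hB, hB, topCoeff_add]
  · refine fun p => hsurj.forall₂.mpr fun x y => ?_
    rw [← map_smul, ← map_smul, hB, hB, topCoeff, topCoeff, smul_eq_mul, smul_eq_mul,
      mul_left_comm x, mul_assoc]
  · refine fun c => hsurj.forall₂.mpr fun x y => ?_
    rw [← map_smul, hB, hB, topCoeff, topCoeff, smul_eq_mul, mul_assoc, C_mul_mod, coeff_C_mul]
  · refine hsurj.forall.mpr fun x hx => ?_
    rw [mkQ_apply, Submodule.Quotient.mk_eq_zero]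
    refine Ideal.mem_span_singleton.mpr (dvd_of_topCoeff hf fun q => ?_)
    rw [← hB]
    exact hx _

/-- By the structure theorem a finitely generated torsion module is a direct sum of cyclic modules,
whose forms add up orthogonally. -/
theorem exists_of_isTorsion [Module.Finite K[X] N] (h : Module.IsTorsion K[X] N) :
    Nonempty (SelfDualForm K N) := by
  obtain ⟨ι, _, p, hp, e, ⟨E⟩⟩ := Module.equiv_directSum_of_isTorsion h
  exact ⟨(directSum fun i => (exists_quotient (pow_ne_zero (e i) (hp i).ne_zero)).some).congr E⟩

variable [Module K N] [IsScalarTower K K[X] N]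

/-- The bilinear form. -/
def bilin (B : SelfDualForm K N) : LinearMap.BilinForm K N :=
  LinearMap.mk₂ K B.form B.add_left
    (fun c x y => by rw [← algebraMap_smul K[X] c x]; exact B.C_smul_left c x y)
    (fun x y z => by rw [B.symm, B.add_left, B.symm y, B.symm z])
    (fun c x y => by
      rw [← algebraMap_smul K[X] c y, B.symm]
      exact (B.C_smul_left c y x).trans (by rw [B.symm, smul_eq_mul]))

/-- The orthogonal submodule. -/
def orthogonal (B : SelfDualForm K N) (W : Submodule K[X] N) : Submodule K[X] N where
  carrier := {y | ∀ x ∈ W, B.form x y = 0}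
  add_mem' := fun {y z} hy hz x hx => by
    rw [B.symm, B.add_left, B.symm y, B.symm z, hy x hx, hz x hx, add_zero]
  zero_mem' := fun x _ => by rw [B.symm, B.zero_left]
  smul_mem' := fun p y hy x hx => by rw [← B.smul_left]; exact hy _ (W.smul_mem p hx)

theorem restrictScalars_orthogonal (B : SelfDualForm K N) (W : Submodule K[X] N) :
    (B.orthogonal W).restrictScalars K = B.bilin.orthogonal (W.restrictScalars K) := rfl

theorem bilin_isRefl (B : SelfDualForm K N) : B.bilin.IsRefl := fun x y h =>
  (B.symm y x).trans h

theorem bilin_nondegenerate (B : SelfDualForm K N) : B.bilin.Nondegenerate := by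
  refine ⟨fun x h => B.nondegenerate x h, fun x h => B.nondegenerate x fun y => ?_⟩
  rw [B.symm]
  exact h y

variable [FiniteDimensional K N]

theorem orthogonal_orthogonal (B : SelfDualForm K N) (W : Submodule K[X] N) :
    B.orthogonal (B.orthogonal W) = W := by
  apply Submodule.restrictScalars_injective K
  rw [restrictScalars_orthogonal, restrictScalars_orthogonal,
    LinearMap.BilinForm.orthogonal_orthogonal B.bilin_nondegenerate B.bilin_isRefl]

theorem finrank_orthogonal_add (B : SelfDualForm K N) (W : Submodule K[X] N) :
    Module.finrank K (B.orthogonal W) + Module.finrank K W = Module.finrank K N := by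
  have h := LinearMap.BilinForm.finrank_orthogonal B.bilin_nondegenerate (W.restrictScalars K)
  have h1 := Submodule.finrank_le (W.restrictScalars K)
  rw [← restrictScalars_orthogonal] at h
  change Module.finrank K (B.orthogonal W) = _ - Module.finrank K W at h
  change Module.finrank K W ≤ _ at h1
  omega

end SelfDualForm

/-- There are as many submodules of dimension `b` as of codimension `b`. -/
theorem ncard_submodule_finrank {N : Type*} [AddCommGroup N] [Module K[X] N] [Module K N]
    [IsScalarTower K K[X] N] [FiniteDimensional K N] (a b : ℕ) (hab : a + b = Module.finrank K N) :
    {W : Submodule K[X] N | Module.finrank K W = a}.ncard =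
      {W : Submodule K[X] N | Module.finrank K W = b}.ncard := by
  have : Module.Finite K[X] N := Module.Finite.of_restrictScalars_finite K K[X] N
  -- The minimal polynomial of the action of `X` annihilates the module.
  have htor : Module.IsTorsion K[X] N := fun {x} => by
    let φ : K[X] →ₐ[K] Module.End K N := Algebra.lsmul K K N
    have h1 : φ (minpoly K (φ X)) = 0 := by
      have h2 := aeval_algHom_apply φ X (minpoly K (φ X))
      rwa [minpoly.aeval, aeval_X_left_apply, eq_comm] at h2
    exact ⟨⟨_, mem_nonZeroDivisors_of_ne_zero (minpoly.ne_zero_of_finite K (φ X))⟩,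
      LinearMap.congr_fun h1 x⟩
  obtain ⟨B⟩ := SelfDualForm.exists_of_isTorsion htor
  -- Taking orthogonals is an involution on submodules that exchanges dimension and codimension;
  -- self-adjointness keeps orthogonals stable under `K[X]`.
  refine Set.ncard_congr (fun W _ => B.orthogonal W) (fun W hW => ?_) (fun W W' _ _ h => ?_)
    fun W hW => ⟨B.orthogonal W, ?_, B.orthogonal_orthogonal W⟩
  · have := B.finrank_orthogonal_add W
    simp only [Set.mem_ofPred_eq] at hW ⊢
    omega
  · rw [← B.orthogonal_orthogonal W, h, B.orthogonal_orthogonal]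
  · have := B.finrank_orthogonal_add W
    simp only [Set.mem_ofPred_eq] at hW ⊢
    omega

section Interval

variable {N : Type*} [AddCommGroup N] [Module K[X] N] [Module K N] [IsScalarTower K K[X] N]
  [FiniteDimensional K N]

theorem finrank_eq_of_between {W₂ W₁ W : Submodule K[X] N} (h : W₂ ≤ W₁) (h' : W₁ ≤ W) :
    Module.finrank K W₁ = Module.finrank K W₂ + Module.finrank K
      ((W₁.comap W.subtype).map (W₂.comap W.subtype).mkQ) := by
  let f : W₁ →ₗ[K[X]] W ⧸ W₂.comap W.subtype :=
    (W₂.comap W.subtype).mkQ ∘ₗ Submodule.inclusion h'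
  have hker : LinearMap.ker f = W₂.comap W₁.subtype := by
    ext x
    rw [LinearMap.mem_ker, LinearMap.comp_apply, Submodule.mkQ_apply,
      Submodule.Quotient.mk_eq_zero]
    rfl
  have hrange : LinearMap.range f = (W₁.comap W.subtype).map (W₂.comap W.subtype).mkQ := by
    rw [LinearMap.range_comp, Submodule.range_inclusion]
  have : FiniteDimensional K W₁ :=
    FiniteDimensional.finiteDimensional_submodule (W₁.restrictScalars K)
  have h1 := LinearMap.finrank_range_add_finrank_ker (f.restrictScalars K)
  change Module.finrank K (LinearMap.range f) + Module.finrank K (LinearMap.ker f) = _ at h1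
  rw [hker, hrange, ((Submodule.comapSubtypeEquivOfLe h).restrictScalars K).finrank_eq] at h1
  rw [← h1, add_comm]

theorem finrank_quotient_comap {W₂ W : Submodule K[X] N} (h : W₂ ≤ W) :
    Module.finrank K W = Module.finrank K W₂ + Module.finrank K (W ⧸ W₂.comap W.subtype) := by
  have h1 := finrank_eq_of_between h le_rfl
  rwa [Submodule.comap_subtype_self, Submodule.map_top, Submodule.range_mkQ,
    ((Submodule.topEquiv (R := K[X])).restrictScalars K).finrank_eq] at h1

/-- By the correspondence theorem the intermediate submodules are the submodules of `W / W₂`;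
codimension `a` in `W` becomes dimension `b`, because the quotient has dimension `a + b`. -/
theorem ncard_between (W₂ W : Submodule K[X] N) (hW : W₂ ≤ W) (a b : ℕ)
    (hab : Module.finrank K W₂ + a + b = Module.finrank K W) :
    {W₁ : Submodule K[X] N | W₂ ≤ W₁ ∧ W₁ ≤ W ∧ Module.finrank K W₁ + a = Module.finrank K W}.ncard =
      {X : Submodule K[X] (W ⧸ W₂.comap W.subtype) | Module.finrank K X = b}.ncard := by
  refine Set.ncard_congr (fun W₁ _ => (W₁.comap W.subtype).map (W₂.comap W.subtype).mkQ)
    (fun W₁ hW₁ => ?_) (fun W₁ W₁' h h' heq => ?_) fun X hX => ?_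
  · have := finrank_eq_of_between hW₁.1 hW₁.2.1
    have := hW₁.2.2
    rw [Set.mem_ofPred_eq]
    omega
  · have key : ∀ W₁, W₂ ≤ W₁ → W₁ ≤ W →
        (((W₁.comap W.subtype).map (W₂.comap W.subtype).mkQ).comap
          (W₂.comap W.subtype).mkQ).map W.subtype = W₁ := fun W₁ h h' => by
      rw [Submodule.comap_map_eq, Submodule.ker_mkQ,
        sup_eq_left.mpr (Submodule.comap_mono h), Submodule.map_comap_subtype,
        inf_eq_right.mpr h']
    rw [← key W₁ h.1 h.2.1, ← key W₁' h'.1 h'.2.1]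
    exact congrArg (fun X => (Submodule.comap (W₂.comap W.subtype).mkQ X).map W.subtype) heq
  · have h1 : (((X.comap (W₂.comap W.subtype).mkQ).map W.subtype).comap W.subtype).map
        (W₂.comap W.subtype).mkQ = X := by
      rw [Submodule.comap_map_eq, Submodule.ker_subtype, sup_bot_eq, Submodule.map_comap_eq,
        Submodule.range_mkQ, top_inf_eq]
    have h2 : W₂ ≤ (X.comap (W₂.comap W.subtype).mkQ).map W.subtype := fun x hx => by
      refine ⟨⟨x, hW hx⟩, ?_, rfl⟩
      have : (W₂.comap W.subtype).mkQ ⟨x, hW hx⟩ = 0 := by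
        rw [Submodule.mkQ_apply, Submodule.Quotient.mk_eq_zero]
        exact hx
      change (W₂.comap W.subtype).mkQ ⟨x, hW hx⟩ ∈ X
      rw [this]
      exact zero_mem _
    have h3 := Submodule.map_subtype_le W (X.comap (W₂.comap W.subtype).mkQ)
    refine ⟨_, ⟨h2, h3, ?_⟩, h1⟩
    have h4 := finrank_eq_of_between h2 h3
    rw [h1] at h4
    rw [Set.mem_ofPred_eq] at hX
    omega

/-- This is the hypothesis of `chainCount_perm`, obtained from the self-duality of `W / W₂`. -/
theorem ncard_between_comm (W₂ W : Submodule K[X] N) (hW : W₂ ≤ W) (a b : ℕ)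
    (hab : Module.finrank K W₂ + a + b = Module.finrank K W) :
    {W₁ : Submodule K[X] N | W₂ ≤ W₁ ∧ W₁ ≤ W ∧ Module.finrank K W₁ + a = Module.finrank K W}.ncard =
    {W₁ : Submodule K[X] N | W₂ ≤ W₁ ∧ W₁ ≤ W ∧
      Module.finrank K W₁ + b = Module.finrank K W}.ncard := by
  have : FiniteDimensional K W :=
    FiniteDimensional.finiteDimensional_submodule (W.restrictScalars K)
  have : FiniteDimensional K (W ⧸ W₂.comap W.subtype) :=
    Module.Finite.quotient K (W₂.comap W.subtype)
  have h := finrank_quotient_comap hW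
  exact (ncard_between W₂ W hW a b hab).trans ((ncard_submodule_finrank b a (by omega)).trans
    (ncard_between W₂ W hW b a (by omega)).symm)

/-- The number of flags of submodules depends only on the multiset of differences of dimensions. -/
theorem card_rankFlags_submodule [Fintype (Submodule K[X] N)] {c c' : ℕ →₀ ℕ}
    (hc : c.support.val.map c = c'.support.val.map c') :
    Nat.card (rankFlags (fun W : Submodule K[X] N => Module.finrank K W) c ⊤) =
      Nat.card (rankFlags (fun W : Submodule K[X] N => Module.finrank K W) c' ⊤) := by
  classical
  refine card_rankFlags_congr (fun W' W h h' => ?_) (fun W₂ W a b h hab => ?_) hc ⊤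
  · apply Submodule.restrictScalars_injective K
    exact Submodule.eq_of_le_of_finrank_eq h h'
  · have h1 := ncard_between_comm W₂ W h a b hab
    rw [Set.ncard_eq_toFinset_card', Set.ncard_eq_toFinset_card'] at h1
    convert h1 using 2 <;> (ext; simp)

end Interval

end SelfDual

end

/-! ### Burnside's lemma and independence of the order of the dimension drops. -/

noncomputable section

open Polynomial

namespace LinSys

variable {A J ι K : Type*} [Field K] {V W U : Type*} [AddCommGroup V] [Module K V]
  [AddCommGroup W] [Module K W] [AddCommGroup U] [Module K U]

/-- Linear automorphisms act on systems. -/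
instance : MulAction (V ≃ₗ[K] V) (LinSys A J K V) where
  smul e M := M.transport e
  one_smul _ := ext' rfl rfl
  mul_smul _ _ _ := ext' rfl rfl

theorem iso_iff_exists_smul {M N : LinSys A J K V} : M.Iso N ↔ ∃ e : V ≃ₗ[K] V, e • M = N := by
  constructor
  · rintro ⟨e, h1, h2⟩
    refine ⟨e, ext' (funext fun a => LinearMap.ext fun v => ?_) (funext fun j => ?_)⟩
    · change e (M.op a (e.symm v)) = _
      rw [h1, LinearEquiv.apply_symm_apply]
    · ext v
      change e.symm v ∈ M.sub j ↔ _
      rw [h2, LinearEquiv.apply_symm_apply]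
  · rintro ⟨e, rfl⟩
    exact M.iso_transport e

/-- Linear automorphisms act on the systems of a given type. -/
instance (a : ι × ℕ →₀ ℕ) : MulAction (V ≃ₗ[K] V) {M : LinSys A (ι × ℕ) K V // M.HasType a} where
  smul e M := ⟨e • M.1, M.2.of_iso (M.1.iso_transport e)⟩
  one_smul M := Subtype.ext (one_smul _ M.1)
  mul_smul e f M := Subtype.ext (mul_smul e f M.1)

theorem smul_eq_self_iff {e : V ≃ₗ[K] V} {M : LinSys A J K V} : e • M = M ↔
    (∀ a, e.toLinearMap ∘ₗ M.op a ∘ₗ e.symm.toLinearMap = M.op a) ∧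
      ∀ j, (M.sub j).comap e.symm.toLinearMap = M.sub j := by
  constructor
  · intro h
    exact ⟨fun a => congrFun (congrArg LinSys.op h) a, fun j => congrFun (congrArg LinSys.sub h) j⟩
  · rintro ⟨h1, h2⟩
    exact ext' (funext h1) (funext h2)

end LinSys

/-- The subspaces fixed by an automorphism are the submodules over the polynomial ring. -/
theorem exists_fixed_orderIso {K V : Type*} [Field K] [AddCommGroup V] [Module K V]
    [FiniteDimensional K V] (e : V ≃ₗ[K] V) :
    ∃ θ : {S : Submodule K V // S.comap e.symm.toLinearMap = S} ≃o
      Submodule K[X] (Module.AEval' e.toLinearMap),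
      ∀ S, Module.finrank K (θ S) = Module.finrank K S.1 := by
  have hiff : ∀ S : Submodule K V, S.comap e.symm.toLinearMap = S ↔
      S ∈ (Algebra.lsmul K K V e.toLinearMap).invtSubmodule := fun S => by
    rw [Module.End.mem_invtSubmodule]
    constructor
    · intro h v hv
      rw [← h]
      change e.symm (e v) ∈ S
      rwa [LinearEquiv.symm_apply_apply]
    -- Being mapped into itself by the automorphism already means being preserved, for reasons of
    -- dimension.
    · intro h
      have h1 : S.map e.toLinearMap ≤ S := Submodule.map_le_iff_le_comap.mpr h
      have h2 : S.map e.toLinearMap = S :=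
        Submodule.eq_of_le_of_finrank_eq h1 (LinearEquiv.finrank_map_eq e S)
      conv_rhs => rw [← h2]
      exact (Submodule.map_equiv_eq_comap_symm e S).symm
  let θ₀ : {S : Submodule K V // S.comap e.symm.toLinearMap = S} ≃o
      (Algebra.lsmul K K V e.toLinearMap).invtSubmodule :=
    { toFun := fun S => ⟨S.1, (hiff S.1).mp S.2⟩
      invFun := fun S => ⟨S.1, (hiff S.1).mpr S.2⟩
      left_inv := fun S => rfl
      right_inv := fun S => rfl
      map_rel_iff' := Iff.rfl }
  refine ⟨θ₀.trans (Module.AEval.mapSubmodule K V e.toLinearMap), fun S => ?_⟩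
  exact ((Module.AEval.equiv_mapSubmodule e.toLinearMap S.1 ((hiff S.1).mp S.2)).finrank_eq).symm

section Burnside

variable {A ι K V : Type*} [Field K] [AddCommGroup V] [Module K V] [FiniteDimensional K V]

open LinSys MulAction

/-- A system is fixed by `e` when its operators commute with `e` and its subspaces are submodules
for the `K[X]`-structure of `e`. These conditions are independent, so the count is a product in
which only the flag factors involve the type. -/
theorem LinSys.card_fixedBy [Finite ι] (e : V ≃ₗ[K] V) (a : ι × ℕ →₀ ℕ) :
    Nat.card (fixedBy {M : LinSys A (ι × ℕ) K V // M.HasType a} e) =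
      Nat.card {op : A → Module.End K V //
        ∀ x, e.toLinearMap ∘ₗ op x ∘ₗ e.symm.toLinearMap = op x} *
      ∏ᶠ i, Nat.card (rankFlags (fun W : Submodule K[X] (Module.AEval' e.toLinearMap) =>
        Module.finrank K W) (a.curry i) ⊤) := by
  have := Fintype.ofFinite ι
  obtain ⟨θ, hθ⟩ := exists_fixed_orderIso e
  have htop : Module.finrank K (⊤ : Submodule K[X] (Module.AEval' e.toLinearMap)) =
      Module.finrank K V := by
    rw [((Submodule.topEquiv (R := K[X])).restrictScalars K).finrank_eq,
      (Module.AEval.of K V e.toLinearMap).finrank_eq]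
  have hθ' : ∀ W, Module.finrank K (θ.symm W).1 = Module.finrank K W := fun W => by
    rw [← hθ, θ.apply_symm_apply]
  have hM : ∀ M : fixedBy {M : LinSys A (ι × ℕ) K V // M.HasType a} e,
      (∀ x, e.toLinearMap ∘ₗ M.1.1.op x ∘ₗ e.symm.toLinearMap = M.1.1.op x) ∧
      ∀ j, (M.1.1.sub j).comap e.symm.toLinearMap = M.1.1.sub j := fun M =>
    smul_eq_self_iff.mp (congrArg Subtype.val M.2)
  rw [finprod_eq_prod_of_fintype, ← Nat.card_pi, ← Nat.card_prod]
  refine Nat.card_congr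
    { toFun := fun M => ⟨⟨M.1.1.op, (hM M).1⟩, fun i => ⟨fun j => θ ⟨M.1.1.sub (i, j), (hM M).2 _⟩,
        fun j j' hj => θ.monotone (M.1.2.anti i hj), fun j => ?_, ?_, ?_⟩⟩
      invFun := fun x => ⟨⟨⟨x.1.1, fun y => (θ.symm ((x.2 y.1).1 y.2)).1⟩, fun i j j' hj =>
        θ.symm.monotone ((x.2 i).2.1 hj), fun i j => ?_, fun i => ?_⟩, ?_⟩
      left_inv := fun M => ?_
      right_inv := fun x => ?_ }
  · exact (congrArg (· + _) (hθ _)).trans ((M.1.2.finrank_add i j).trans htop.symm)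
  · apply Submodule.restrictScalars_injective K
    apply Submodule.eq_top_of_finrank_eq
    have h1 := M.1.2.finrank_add i 0
    rw [Finset.sum_range_zero, add_zero] at h1
    exact (hθ _).trans (h1.trans (Module.AEval.of K V e.toLinearMap).finrank_eq)
  · obtain ⟨n, hn⟩ := M.1.2.exists_eq_bot i
    exact ⟨n, (hθ _).trans (Submodule.finrank_eq_zero.mpr hn)⟩
  · exact (congrArg (· + _) (hθ' _)).trans (((x.2 i).2.2.1 j).trans htop)
  · obtain ⟨n, hn⟩ := (x.2 i).2.2.2.2
    exact ⟨n, Submodule.finrank_eq_zero.mp ((hθ' _).trans hn)⟩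
  · exact Subtype.ext (smul_eq_self_iff.mpr ⟨x.1.2, fun j => (θ.symm _).2⟩)
  · refine Subtype.ext (Subtype.ext (ext' rfl (funext fun y => ?_)))
    simp only [OrderIso.symm_apply_apply]
  · refine Prod.ext rfl (funext fun i => Subtype.ext (funext fun j => ?_))
    exact θ.apply_symm_apply _

end Burnside

namespace IsoClass

variable {A ι K : Type*} [Field K]

/-- The orbits of the linear automorphisms on the systems of a given type. -/
theorem card_quotient_eq_classCount {n : ℕ} {a : ι × ℕ →₀ ℕ} [Nonempty ι]
    (ha : ∀ i, n = (a.curry i).degree) :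
    Nat.card (MulAction.orbitRel.Quotient ((Fin n → K) ≃ₗ[K] (Fin n → K))
      {M : LinSys A (ι × ℕ) K (Fin n → K) // M.HasType a}) = classCount A K a := by
  have hrel : ∀ M N : {M : LinSys A (ι × ℕ) K (Fin n → K) // M.HasType a},
      (MulAction.orbitRel ((Fin n → K) ≃ₗ[K] (Fin n → K)) _) M N ↔ mk M.1 = mk N.1 := by
    intro M N
    rw [MulAction.orbitRel_apply, eq_comm, mk_eq_mk, LinSys.iso_iff_exists_smul]
    exact exists_congr fun e => Subtype.ext_iff
  rw [classCount, ← Nat.card_coe_set_eq]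
  refine Nat.card_congr (Equiv.ofBijective (Quotient.lift (fun M => ⟨mk M.1, hasType_mk.mpr M.2⟩)
    fun M N h => Subtype.ext ((hrel M N).mp h)) ⟨?_, ?_⟩)
  · rintro ⟨M⟩ ⟨N⟩ h
    exact Quotient.sound ((hrel M N).mpr (congrArg Subtype.val h))
  · rintro ⟨s, m, M, rfl, hM⟩
    obtain ⟨i⟩ := ‹Nonempty ι›
    have hm : m = n := by
      rw [ha i, ← hM.finrank_eq i, Module.finrank_fin_fun]
    subst hm
    exact ⟨Quotient.mk _ ⟨M, hM⟩, rfl⟩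

theorem classCount_eq_zero {a : ι × ℕ →₀ ℕ} {i i' : ι} (h : (a.curry i).degree ≠ (a.curry i').degree) :
    classCount A K a = 0 := by
  have : {s : IsoClass A (ι × ℕ) K | s.HasType a} = ∅ := by
    refine Set.eq_empty_of_forall_notMem ?_
    rintro _ ⟨n, M, rfl, hM⟩
    exact h ((hM.finrank_eq i).symm.trans (hM.finrank_eq i'))
  rw [classCount, this, Set.ncard_empty]

/-- The number of classes depends only on the multisets of differences of dimensions. -/
theorem classCount_eq_of_parts_eq [Finite K] [Finite A] [Finite ι] [Nonempty ι]
    {a a' : ι × ℕ →₀ ℕ} (h : ∀ i, (a.curry i).support.val.map (a.curry i) =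
      (a'.curry i).support.val.map (a'.curry i)) : classCount A K a = classCount A K a' := by
  classical
  have hdeg : ∀ i, (a.curry i).degree = (a'.curry i).degree := fun i =>
    congrArg Multiset.sum (h i)
  -- If the flags for different `i` require different dimensions, there is no system of either type
  -- and both counts are zero.
  by_cases hn : ∃ n, ∀ i, n = (a.curry i).degree
  swap
  · push Not at hn
    obtain ⟨i⟩ := ‹Nonempty ι›
    obtain ⟨i', hi'⟩ := hn (a.curry i).degree
    rw [classCount_eq_zero hi', classCount_eq_zero (by rwa [← hdeg, ← hdeg] : (a'.curry i).degree ≠ (a'.curry i').degree)]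
  obtain ⟨n, hn⟩ := hn
  have hn' : ∀ i, n = (a'.curry i).degree := fun i => (hn i).trans (hdeg i)
  rw [← card_quotient_eq_classCount hn, ← card_quotient_eq_classCount hn']
  set V := Fin n → K
  let G := V ≃ₗ[K] V
  have : Finite G := DFunLike.finite _
  have := Fintype.ofFinite G
  -- By Burnside's lemma it suffices to compare fixed points of each `e`; the factors for the
  -- operators agree, and those for the flags agree by self-duality.
  have hfix : ∀ e : G, Nat.card (MulAction.fixedBy {M : LinSys A (ι × ℕ) K V // M.HasType a} e) =
      Nat.card (MulAction.fixedBy {M : LinSys A (ι × ℕ) K V // M.HasType a'} e) := fun e => by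
    rw [LinSys.card_fixedBy e a, LinSys.card_fixedBy e a']
    congr 1
    have : Finite (Module.AEval' e.toLinearMap) := inferInstanceAs (Finite V)
    have : Finite (Submodule K[X] (Module.AEval' e.toLinearMap)) :=
      Finite.of_injective _ SetLike.coe_injective
    have := Fintype.ofFinite (Submodule K[X] (Module.AEval' e.toLinearMap))
    exact finprod_congr fun i => card_rankFlags_submodule (h i)
  have hcard : ∀ a : ι × ℕ →₀ ℕ, ∑ e : G, Nat.card (MulAction.fixedBy
      {M : LinSys A (ι × ℕ) K V // M.HasType a} e) = Nat.card (MulAction.orbitRel.Quotient G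
      {M : LinSys A (ι × ℕ) K V // M.HasType a}) * Nat.card G := fun a => by
    have := LinSys.finite_hasType (A := A) (V := V) (K := K) a
    have := Fintype.ofFinite {M : LinSys A (ι × ℕ) K V // M.HasType a}
    have := Fintype.ofFinite (MulAction.orbitRel.Quotient G
      {M : LinSys A (ι × ℕ) K V // M.HasType a})
    simp only [Nat.card_eq_fintype_card]
    exact MulAction.sum_card_fixedBy_eq_card_orbits_mul_card_group G _
  have h1 := (hcard a).symm.trans ((Finset.sum_congr rfl fun e _ => hfix e).trans (hcard a'))
  exact Nat.eq_of_mul_eq_mul_right Nat.card_pos h1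

end IsoClass

end

/-! ### Partitions, flag types and `GL_n`-orbits as isomorphism classes. -/

noncomputable section

namespace Nat.Partition

variable {n : ℕ} (lam : n.Partition)

/-- The parts in non-increasing order. -/
def partFun : ℕ →₀ ℕ := (lam.parts.sort (· ≥ ·)).toFinsupp

theorem sum_take_add_tail (j : ℕ) : lam.tail j + ((lam.parts.sort (· ≥ ·)).take j).sum = n := by
  rw [tail, add_comm, List.sum_take_add_sum_drop, ← Multiset.sum_coe, Multiset.sort_eq]
  exact lam.parts_sum

theorem tail_add_sum (j : ℕ) : lam.tail j + ∑ l ∈ Finset.range j, lam.partFun l = n := by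
  refine Eq.trans (congrArg (lam.tail j + ·) ?_) (lam.sum_take_add_tail j)
  induction j with
  | zero => simp
  | succ j ih =>
    rw [Finset.sum_range_succ, ih, partFun, List.toFinsupp_apply, List.take_add_one, List.sum_append]
    congr 1
    rw [List.getD_eq_getElem?_getD]
    cases (lam.parts.sort (· ≥ ·))[j]? <;> simp

theorem length_sort : (lam.parts.sort (· ≥ ·)).length = lam.len := Multiset.length_sort _

theorem partFun_pos_iff (j : ℕ) : 0 < lam.partFun j ↔ j < lam.len := by
  rw [partFun, List.toFinsupp_apply, ← length_sort]
  constructor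
  · intro h
    by_contra hj
    rw [List.getD_eq_default _ _ (not_lt.mp hj)] at h
    exact lt_irrefl _ h
  · intro h
    rw [List.getD_eq_getElem _ _ h]
    exact lam.parts_pos (by rw [← Multiset.mem_sort (r := (· ≥ ·))]; exact List.getElem_mem h)

theorem tail_eq_zero {j : ℕ} (h : lam.len ≤ j) : lam.tail j = 0 := by
  rw [tail, List.drop_eq_nil_of_le (by rwa [length_sort]), List.sum_nil]

theorem tail_zero : lam.tail 0 = n := by
  simpa using lam.tail_add_sum 0

theorem map_partFun : lam.partFun.support.val.map lam.partFun = lam.parts := by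
  have h1 : lam.partFun.support = Finset.range lam.len := by
    ext j
    rw [Finsupp.mem_support_iff, Finset.mem_range, ← partFun_pos_iff, Nat.pos_iff_ne_zero]
  have h2 : (List.range lam.len).map lam.partFun = lam.parts.sort (· ≥ ·) := by
    refine List.ext_getElem (by simp [len]) fun j h h' => ?_
    rw [List.getElem_map, List.getElem_range, partFun, List.toFinsupp_apply,
      List.getD_eq_getElem _ _ h']
  rw [h1, Finset.range_val, Multiset.range, Multiset.map_coe, h2, Multiset.sort_eq]

end Nat.Partition

namespace MultiPartition

variable {k : ℕ} (mu : MultiPartition k)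

/-- The type of a tuple of flags given by a tuple of partitions. -/
def flagType : Fin k × ℕ →₀ ℕ :=
  (Finsupp.equivFunOnFinite.symm fun i => (mu.2 i).partFun).uncurry

theorem curry_flagType (i : Fin k) : (flagType mu).curry i = (mu.2 i).partFun := by
  rw [flagType, Finsupp.curry_uncurry]
  rfl

theorem flagType_apply (i : Fin k) (j : ℕ) : flagType mu (i, j) = (mu.2 i).partFun j := by
  rw [← curry_flagType, Finsupp.curry_apply]

theorem degree_curry_flagType (i : Fin k) : ((flagType mu).curry i).degree = mu.1 := by
  rw [curry_flagType, Finsupp.degree_apply]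
  exact (congrArg Multiset.sum (mu.2 i).map_partFun).trans (mu.2 i).parts_sum

end MultiPartition

namespace FlagConfig

variable {F : Type*} [Field F] {g k : ℕ} {mu : MultiPartition k}

/-- The system of operators and subspaces given by matrices and flags. -/
def toLinSys (X : FlagConfig F g mu) : LinSys (Fin g) (Fin k × ℕ) F (Fin mu.1 → F) where
  op a := (X.mat a).mulVecLin
  -- The finite flag is continued by its last term, which is zero.
  sub y := (X.flag y.1).E ⟨min y.2 (mu.2 y.1).len, Nat.lt_succ_of_le (min_le_right _ _)⟩

theorem hasType_toLinSys (X : FlagConfig F g mu) :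
    X.toLinSys.HasType (MultiPartition.flagType mu) := by
  refine ⟨fun i j j' hj => (X.flag i).antitone (min_le_min_right _ hj), fun i j => ?_, fun i =>
    ⟨(mu.2 i).len, ?_⟩⟩
  · change Module.finrank F ((X.flag i).E _) + _ = _
    rw [(X.flag i).finrank_eq, Module.finrank_fin_fun]
    refine Eq.trans (congrArg₂ (· + ·) ?_ ?_) ((mu.2 i).tail_add_sum j)
    · rcases le_total j (mu.2 i).len with h | h
      · simp only [min_eq_left h]
      · simp only [min_eq_right h]
        rw [(mu.2 i).tail_eq_zero le_rfl, (mu.2 i).tail_eq_zero h]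
    · exact Finset.sum_congr rfl fun l _ => MultiPartition.flagType_apply mu i l
  · apply Submodule.finrank_eq_zero.mp
    refine ((X.flag i).finrank_eq _).trans ((mu.2 i).tail_eq_zero ?_)
    simp

theorem toLinSys_injective : Function.Injective (toLinSys : FlagConfig F g mu → _) := by
  intro X Y h
  refine FlagConfig.ext (funext fun a => ?_) (funext fun i => PartialFlag.ext (funext fun j => ?_))
  · exact Matrix.toLin'.injective (congrFun (congrArg LinSys.op h) a)
  · have h1 := congrFun (congrArg LinSys.sub h) (i, j.1)
    have hj : min j.1 (mu.2 i).len = j.1 := min_eq_left (Nat.le_of_lt_succ j.2)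
    simpa only [toLinSys, hj] using h1

theorem exists_toLinSys_eq {M : LinSys (Fin g) (Fin k × ℕ) F (Fin mu.1 → F)}
    (hM : M.HasType (MultiPartition.flagType mu)) : ∃ X : FlagConfig F g mu, X.toLinSys = M := by
  have hfin : ∀ i j, Module.finrank F (M.sub (i, j)) = (mu.2 i).tail j := fun i j => by
    have h1 := hM.finrank_add i j
    rw [Module.finrank_fin_fun] at h1
    simp only [MultiPartition.flagType_apply] at h1
    exact Nat.add_right_cancel (h1.trans ((mu.2 i).tail_add_sum j).symm)
  refine ⟨⟨fun a => LinearMap.toMatrix' (M.op a), fun i => ⟨fun j => M.sub (i, j),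
    fun j j' hj => hM.anti i hj, fun j => hfin i j⟩⟩, LinSys.ext' (funext fun a => ?_)
    (funext fun y => ?_)⟩
  · exact Matrix.toLin'_toMatrix' _
  · rcases y with ⟨i, j⟩
    change M.sub (i, min j (mu.2 i).len) = M.sub (i, j)
    rcases le_total j (mu.2 i).len with h | h
    · rw [min_eq_left h]
    · rw [min_eq_right h, Submodule.finrank_eq_zero.mp ((hfin i j).trans ((mu.2 i).tail_eq_zero h)),
        Submodule.finrank_eq_zero.mp ((hfin i _).trans ((mu.2 i).tail_eq_zero le_rfl))]

theorem orbitRel_iff {X Y : FlagConfig F g mu} :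
    MulAction.orbitRel (GL (Fin mu.1) F) (FlagConfig F g mu) X Y ↔
      X.toLinSys.Iso Y.toLinSys := by
  rw [MulAction.orbitRel_apply]
  have hsmul : ∀ (h : GL (Fin mu.1) F) (e : (Fin mu.1 → F) ≃ₗ[F] (Fin mu.1 → F)),
      e.toLinearMap = h.val.mulVecLin → e.symm.toLinearMap = (h⁻¹).val.mulVecLin →
      (h • Y).toLinSys = e • Y.toLinSys := fun h e he he' => by
    refine LinSys.ext' (funext fun a => ?_) (funext fun y => ?_)
    · change (h.val * Y.mat a * (h⁻¹).val).mulVecLin = e.toLinearMap ∘ₗ _ ∘ₗ e.symm.toLinearMap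
      rw [he, he', Matrix.mulVecLin_mul, Matrix.mulVecLin_mul]
      rfl
    · change ((Y.flag y.1).E _).map h.val.mulVecLin = ((Y.flag y.1).E _).comap e.symm.toLinearMap
      rw [← he]
      exact Submodule.map_equiv_eq_comap_symm e _
  constructor
  · rintro ⟨h, rfl⟩
    have h1 : h.val * (h⁻¹).val = 1 := h.mul_inv
    have h2 : (h⁻¹).val * h.val = 1 := h.inv_mul
    let e : (Fin mu.1 → F) ≃ₗ[F] (Fin mu.1 → F) :=
      LinearEquiv.ofLinearMap h.val.mulVecLin (h⁻¹).val.mulVecLin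
        (by rw [← Matrix.mulVecLin_mul, h1, Matrix.mulVecLin_one])
        (by rw [← Matrix.mulVecLin_mul, h2, Matrix.mulVecLin_one])
    have := hsmul h e rfl rfl
    change LinSys.Iso (h • Y).toLinSys _
    rw [this]
    exact (Y.toLinSys.iso_transport e).symm
  · intro h
    obtain ⟨e, he⟩ := LinSys.iso_iff_exists_smul.mp h.symm
    have h1 : LinearMap.toMatrix' e.toLinearMap * LinearMap.toMatrix' e.symm.toLinearMap = 1 := by
      rw [← LinearMap.toMatrix'_comp, LinearEquiv.comp_symm, LinearMap.toMatrix'_id]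
    have h2 : LinearMap.toMatrix' e.symm.toLinearMap * LinearMap.toMatrix' e.toLinearMap = 1 := by
      rw [← LinearMap.toMatrix'_comp, LinearEquiv.symm_comp, LinearMap.toMatrix'_id]
    refine ⟨⟨_, _, h1, h2⟩, toLinSys_injective ?_⟩
    rw [← he]
    exact hsmul ⟨_, _, h1, h2⟩ e (Matrix.toLin'_toMatrix' _).symm (Matrix.toLin'_toMatrix' _).symm

end FlagConfig

/-- Matrices with flags are the systems of type `flagType mu` on `F ^ n`, and orbits are isomorphism
classes. Since `k > 0`, the type determines `n`, so every class of this type is realized on `F ^ n`.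
-/
theorem orbitCount_eq_classCount (F : Type*) [Field F] (g : ℕ) {k : ℕ} (hk : 0 < k)
    (mu : MultiPartition k) :
    orbitCount F g mu = IsoClass.classCount (Fin g) F (MultiPartition.flagType mu) := by
  rw [orbitCount, IsoClass.classCount, ← Nat.card_coe_set_eq]
  refine Nat.card_congr (Equiv.ofBijective (Quotient.lift (fun X => ⟨IsoClass.mk X.toLinSys,
    IsoClass.hasType_mk.mpr X.hasType_toLinSys⟩)
    fun X Y h => Subtype.ext (IsoClass.mk_eq_mk.mpr (FlagConfig.orbitRel_iff.mp h))) ⟨?_, ?_⟩)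
  · rintro ⟨X⟩ ⟨Y⟩ h
    exact Quotient.sound (FlagConfig.orbitRel_iff.mpr (IsoClass.mk_eq_mk.mp
      (congrArg Subtype.val h)))
  · rintro ⟨s, m, M, rfl, hM⟩
    have hm : m = mu.1 := by
      rw [← MultiPartition.degree_curry_flagType mu ⟨0, hk⟩, ← hM.finrank_eq,
        Module.finrank_fin_fun]
    subst hm
    obtain ⟨X, rfl⟩ := FlagConfig.exists_toLinSys_eq hM
    exact ⟨Quotient.mk _ X, rfl⟩

end

/-! ### Indecomposability of quiver representations through idempotents. -/

noncomputable section

open scoped Matrix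

namespace QuiverRep

variable {K : Type*} [Field K] {V : Type*} [Quiver V] {v v₁ v₂ : V → ℕ}

/-- The decomposition of a sum of coordinate spaces. -/
def splitEquiv (K : Type*) [Field K] (m n : ℕ) :
    (Fin (m + n) → K) ≃ₗ[K] (Fin m → K) × (Fin n → K) :=
  (LinearEquiv.funCongrLeft K K finSumFinEquiv).trans (LinearEquiv.sumArrowLequivProdArrow _ _ K K)

theorem splitEquiv_directSum (φ₁ : QuiverRep K v₁) (φ₂ : QuiverRep K v₂) {x y : V} (a : x ⟶ y)
    (u : Fin ((v₁ + v₂) x) → K) :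
    splitEquiv K (v₁ y) (v₂ y) (φ₁.directSum φ₂ a *ᵥ u) =
      (φ₁ a *ᵥ (splitEquiv K (v₁ x) (v₂ x) u).1, φ₂ a *ᵥ (splitEquiv K (v₁ x) (v₂ x) u).2) := by
  have h : (φ₁.directSum φ₂ a *ᵥ u) ∘ finSumFinEquiv =
      Matrix.fromBlocks (φ₁ a) 0 0 (φ₂ a) *ᵥ (u ∘ finSumFinEquiv) := by
    rw [directSum, Matrix.reindex_apply, Matrix.submatrix_mulVec_equiv]
    funext i
    simp [Function.comp_def]
  have h1 : (φ₁.directSum φ₂ a *ᵥ u) ∘ finSumFinEquiv =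
      Sum.elim (φ₁ a *ᵥ (splitEquiv K (v₁ x) (v₂ x) u).1)
        (φ₂ a *ᵥ (splitEquiv K (v₁ x) (v₂ x) u).2) := by
    rw [h, Matrix.fromBlocks_mulVec]
    simp only [Matrix.zero_mulVec, add_zero, zero_add]
    rfl
  exact Prod.ext (funext fun i => congrFun h1 (Sum.inl i)) (funext fun i => congrFun h1 (Sum.inr i))

/-- An endomorphism of a representation. -/
def IsEndo (φ : QuiverRep K v) (e : ∀ x, Module.End K (Fin (v x) → K)) : Prop :=
  ∀ ⦃x y : V⦄ (a : x ⟶ y) u, e y (φ a *ᵥ u) = φ a *ᵥ e x u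

/-- The splitting of idempotents for systems is reused, with `e` as the only operator and no
subspaces; `e` is then an endomorphism of its own system. -/
theorem exists_split {W : Type*} [AddCommGroup W] [Module K W] [FiniteDimensional K W]
    {e : Module.End K W} (he : e * e = e) : ∃ (m n : ℕ) (r : W ≃ₗ[K] (Fin m → K) × (Fin n → K)),
      ∀ w, r (e w) = ((r w).1, 0) := by
  let M : LinSys Unit Empty K W := ⟨fun _ => e, fun j => j.elim⟩
  have hmem : e ∈ LinSys.endo M := ⟨fun _ _ => rfl, fun j => j.elim⟩
  obtain ⟨θ, h1, -⟩ := LinSys.exists_iso_prod_of_idem hmem he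
  refine ⟨_, _, θ.trans (LinearEquiv.prodCongr (Module.finBasis K _).equivFun
    (Module.finBasis K _).equivFun), fun w => ?_⟩
  have h2 : θ (e w) = ((θ w).1, 0) := by
    refine (h1 () w).trans (Prod.ext (Subtype.ext ?_) (Subtype.ext ?_))
    · have h3 := LinearMap.mem_ker.mp (θ w).1.2
      rw [LinearMap.sub_apply, Module.End.one_apply, sub_eq_zero] at h3
      exact h3.symm
    · exact LinearMap.mem_ker.mp (θ w).2.2
  simp only [LinearEquiv.trans_apply, h2, LinearEquiv.prodCongr_apply, map_zero]

/-- A representation is indecomposable if and only if it has no nontrivial idempotent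
endomorphisms. -/
theorem indecomposable_iff {φ : QuiverRep K v} : φ.Indecomposable ↔ v ≠ 0 ∧
    ∀ e, φ.IsEndo e → (∀ x, e x * e x = e x) → (∀ x, e x = 0) ∨ (∀ x, e x = 1) := by
  refine and_congr_right fun _ => ⟨fun h e he hee => ?_, fun h v₁ v₂ φ₁ φ₂ hiso => ?_⟩
  · choose d₁ d₂ r hr using fun x => exists_split (hee x)
    let φ₁ : QuiverRep K d₁ := fun x y a => LinearMap.toMatrix'
      (LinearMap.fst K _ _ ∘ₗ (r y).toLinearMap ∘ₗ (φ a).mulVecLin ∘ₗ (r x).symm.toLinearMap ∘ₗ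
        LinearMap.inl K _ _)
    let φ₂ : QuiverRep K d₂ := fun x y a => LinearMap.toMatrix'
      (LinearMap.snd K _ _ ∘ₗ (r y).toLinearMap ∘ₗ (φ a).mulVecLin ∘ₗ (r x).symm.toLinearMap ∘ₗ
        LinearMap.inr K _ _)
    have hφ₁ : ∀ {x y} (a : x ⟶ y) u, φ₁ a *ᵥ u = (r y (φ a *ᵥ (r x).symm (u, 0))).1 := fun a u => by
      rw [← Matrix.toLin'_apply, Matrix.toLin'_toMatrix']
      rfl
    have hφ₂ : ∀ {x y} (a : x ⟶ y) u, φ₂ a *ᵥ u = (r y (φ a *ᵥ (r x).symm (0, u))).2 := fun a u => by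
      rw [← Matrix.toLin'_apply, Matrix.toLin'_toMatrix']
      rfl
    have hr' : ∀ x u, e x ((r x).symm u) = (r x).symm (u.1, 0) := fun x u => by
      rw [LinearEquiv.eq_symm_apply, hr, LinearEquiv.apply_symm_apply]
    -- Maps that commute with the idempotent have no off-diagonal blocks.
    have h1 : ∀ {x y} (a : x ⟶ y) u, r y (φ a *ᵥ (r x).symm (u, 0)) = (φ₁ a *ᵥ u, 0) :=
      fun {x y} a u => by
        have h2 := hr y (φ a *ᵥ (r x).symm (u, 0))
        rw [he a, hr'] at h2
        rw [hφ₁]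
        exact h2
    have h2 : ∀ {x y} (a : x ⟶ y) u, r y (φ a *ᵥ (r x).symm (0, u)) = (0, φ₂ a *ᵥ u) :=
      fun {x y} a u => by
        have h2 := hr y (φ a *ᵥ (r x).symm (0, u))
        rw [he a, hr'] at h2
        have h3 : ((0 : Fin (d₁ x) → K), (0 : Fin (d₂ x) → K)) = 0 := rfl
        simp only [h3, map_zero, Matrix.mulVec_zero] at h2
        rw [hφ₂]
        exact Prod.ext (congrArg Prod.fst h2).symm rfl
    have hiso : φ.Iso (φ₁.directSum φ₂) := by
      refine ⟨fun x => (r x).trans (splitEquiv K _ _).symm, fun x y a u => ?_⟩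
      apply (splitEquiv K (d₁ y) (d₂ y)).injective
      rw [splitEquiv_directSum]
      simp only [LinearEquiv.trans_apply, LinearEquiv.apply_symm_apply]
      have h3 : u = (r x).symm ((r x u).1, 0) + (r x).symm (0, (r x u).2) := by
        rw [← map_add, Prod.mk_add_mk, add_zero, zero_add, LinearEquiv.symm_apply_apply]
      conv_lhs => rw [h3, Matrix.mulVec_add, map_add, h1, h2, Prod.mk_add_mk, add_zero, zero_add]
    rcases h d₁ d₂ φ₁ φ₂ hiso with h0 | h0
    · left
      intro x
      refine LinearMap.ext fun u => ?_
      have : IsEmpty (Fin (d₁ x)) := by rw [h0]; exact Fin.isEmpty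
      apply (r x).injective
      rw [hr, LinearMap.zero_apply, map_zero]
      exact Prod.ext (Subsingleton.elim _ _) rfl
    · right
      intro x
      refine LinearMap.ext fun u => ?_
      have : IsEmpty (Fin (d₂ x)) := by rw [h0]; exact Fin.isEmpty
      apply (r x).injective
      rw [hr, Module.End.one_apply]
      exact Prod.ext rfl (Subsingleton.elim _ _)
  · obtain ⟨f, hf⟩ := hiso
    let t : ∀ x, (Fin (v x) → K) ≃ₗ[K] (Fin (v₁ x) → K) × (Fin (v₂ x) → K) := fun x =>
      (f x).trans (splitEquiv K _ _)
    have ht : ∀ {x y} (a : x ⟶ y) u, t y (φ a *ᵥ u) = (φ₁ a *ᵥ (t x u).1, φ₂ a *ᵥ (t x u).2) :=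
      fun a u => by
        simp only [t, LinearEquiv.trans_apply]
        rw [hf, splitEquiv_directSum]
    let e : ∀ x, Module.End K (Fin (v x) → K) := fun x =>
      (t x).symm.toLinearMap ∘ₗ LinearMap.inl K _ _ ∘ₗ LinearMap.fst K _ _ ∘ₗ (t x).toLinearMap
    have he : ∀ x u, t x (e x u) = ((t x u).1, 0) := fun x u => by simp [e]
    have hendo : φ.IsEndo e := fun x y a u => (t y).injective (by
      rw [he, ht, ht, he, Matrix.mulVec_zero])
    have hidem : ∀ x, e x * e x = e x := fun x => LinearMap.ext fun u => (t x).injective (by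
      rw [Module.End.mul_apply, he, he])
    rcases h e hendo hidem with h0 | h0
    · left
      funext x
      by_contra hx
      have hpos : 0 < v₁ x := Nat.pos_of_ne_zero hx
      have h1 := he x ((t x).symm (Pi.single ⟨0, hpos⟩ 1, 0))
      rw [h0, LinearMap.zero_apply, map_zero, LinearEquiv.apply_symm_apply] at h1
      have h2 := congrFun (congrArg Prod.fst h1) ⟨0, hpos⟩
      simp at h2
    · right
      funext x
      by_contra hx
      have hpos : 0 < v₂ x := Nat.pos_of_ne_zero hx
      have h1 := he x ((t x).symm (0, Pi.single ⟨0, hpos⟩ 1))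
      rw [h0, Module.End.one_apply, LinearEquiv.apply_symm_apply] at h1
      have h2 := congrFun (congrArg Prod.snd h1) ⟨0, hpos⟩
      simp at h2

end QuiverRep

end

/-! ### Representations of comet-shaped quivers as systems of operators and flags. -/

noncomputable section

open scoped Matrix TensorProduct

theorem LinearMap.exists_lift_of_injective {K V V' U U' : Type*} [Field K] [AddCommGroup V]
    [Module K V] [AddCommGroup V'] [Module K V'] [AddCommGroup U] [Module K U] [AddCommGroup U']
    [Module K U'] (p : V →ₗ[K] U) {q : V' →ₗ[K] U'} (hq : Function.Injective q) (e : U →ₗ[K] U')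
    (h : ∀ v, e (p v) ∈ LinearMap.range q) : ∃ F : V →ₗ[K] V', ∀ v, q (F v) = e (p v) := by
  refine ⟨(LinearEquiv.ofInjective q hq).symm.toLinearMap ∘ₗ
    LinearMap.codRestrict _ (e ∘ₗ p) h, fun v => ?_⟩
  exact congrArg Subtype.val ((LinearEquiv.ofInjective q hq).apply_symm_apply ⟨e (p v), h v⟩)

namespace QuiverRep

variable {K : Type*} [Field K] {g k : ℕ} {s : Fin k → ℕ} {v w : CometVertex g s → ℕ}

open CometVertex

/-- The composite of the maps along a leg. -/
def legMap (φ : QuiverRep K v) (i : Fin k) : ∀ (j : ℕ) (hj : j < s i),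
    (Fin (v (leg i ⟨j, hj⟩)) → K) →ₗ[K] (Fin (v center) → K)
  | 0, hj => Matrix.mulVecLin (φ (show (leg i ⟨0, hj⟩ : CometVertex g s) ⟶ center from ⟨rfl⟩))
  | j + 1, hj => legMap φ i j (Nat.lt_of_succ_lt hj) ∘ₗ
      Matrix.mulVecLin (φ (show (leg i ⟨j + 1, hj⟩ : CometVertex g s) ⟶
        leg i ⟨j, Nat.lt_of_succ_lt hj⟩ from ⟨rfl, rfl⟩))

/-- The map to the space at the center. -/
def toCenter (φ : QuiverRep K v) : ∀ x, (Fin (v x) → K) →ₗ[K] (Fin (v center) → K)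
  | center => LinearMap.id
  | leg i j => legMap φ i j.1 j.2

/-- The operators that the arrows induce at the center. -/
def arrowOp {V : Type*} [AddCommGroup V] [Module K V] (T : Fin g → Module.End K V) :
    ∀ {x y : CometVertex g s}, (x ⟶ y) → Module.End K V
  | .center, .center, a => T a
  | .leg _ _, _, _ => LinearMap.id
  | .center, .leg _ _, _ => LinearMap.id

/-- The loops. -/
def loops (φ : QuiverRep K v) (a : Fin g) : Module.End K (Fin (v center) → K) :=
  Matrix.mulVecLin (φ (show (center : CometVertex g s) ⟶ center from a))

theorem toCenter_arrow (φ : QuiverRep K v) {x y : CometVertex g s} (a : x ⟶ y) (u) :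
    toCenter φ y (φ a *ᵥ u) = arrowOp φ.loops a (toCenter φ x u) := by
  match x, y, a with
  | center, center, a => rfl
  | leg i ⟨j, hj⟩, center, ⟨h⟩ =>
    change j = 0 at h
    subst h
    rfl
  | leg i ⟨j, hj⟩, leg i' ⟨j', hj'⟩, ⟨h, h'⟩ =>
    change j = j' + 1 at h'
    subst h h'
    rfl

/-- A family of maps that is compatible with the arrows is compatible with the maps to the
center. -/
theorem toCenter_unique (φ : QuiverRep K v) {U : Type*} [AddCommGroup U] [Module K U]
    (T : Fin g → Module.End K U) (ι : ∀ x, (Fin (v x) → K) →ₗ[K] U)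
    (hι : ∀ {x y : CometVertex g s} (a : x ⟶ y) u, ι y (φ a *ᵥ u) = arrowOp T a (ι x u)) (x) (u) :
    ι x u = ι center (toCenter φ x u) := by
  revert u
  match x with
  | center => exact fun u => rfl
  | leg i ⟨j, hj⟩ =>
    induction j with
    | zero =>
      intro u
      exact (hι (show (leg i ⟨0, hj⟩ : CometVertex g s) ⟶ center from ⟨rfl⟩) u).symm
    | succ j ih =>
      intro u
      have h := hι (show (leg i ⟨j + 1, hj⟩ : CometVertex g s) ⟶
        leg i ⟨j, Nat.lt_of_succ_lt hj⟩ from ⟨rfl, rfl⟩) u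
      exact h.symm.trans (ih _ _)

/-- The system of operators and subspaces given by the loops and the images of the maps to the
center. -/
def toLinSys (φ : QuiverRep K v) : LinSys (Fin g) (Fin k × ℕ) K (Fin (v center) → K) where
  op := φ.loops
  sub y := if y.2 = 0 then ⊤ else if h : y.2 - 1 < s y.1 then
    LinearMap.range (toCenter φ (leg y.1 ⟨y.2 - 1, h⟩)) else ⊥

theorem toLinSys_sub_zero (φ : QuiverRep K v) (i : Fin k) : φ.toLinSys.sub (i, 0) = ⊤ := by
  simp only [toLinSys]
  exact if_pos trivial

theorem toLinSys_sub_succ (φ : QuiverRep K v) (i : Fin k) (j : Fin (s i)) :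
    φ.toLinSys.sub (i, j + 1) = LinearMap.range (toCenter φ (leg i j)) := by
  simp only [toLinSys]
  rw [if_neg (Nat.succ_ne_zero _), dif_pos (show j.1 + 1 - 1 < s i from j.2)]
  rfl

theorem toLinSys_sub_of_le (φ : QuiverRep K v) (i : Fin k) {j : ℕ} (hj : s i ≤ j) :
    φ.toLinSys.sub (i, j + 1) = ⊥ := by
  simp only [toLinSys]
  rw [if_neg (Nat.succ_ne_zero _), dif_neg (show ¬ j + 1 - 1 < s i from not_lt.mpr hj)]

/-- All maps to the center are injective. -/
def LegsInjective (φ : QuiverRep K v) : Prop := ∀ x, Function.Injective (toCenter φ x)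

/-- Induction on the positions in the legs, and beyond their ends. -/
theorem legs_induction (s : Fin k → ℕ) {P : Fin k × ℕ → Prop} (h0 : ∀ i, P (i, 0))
    (h1 : ∀ i (j : Fin (s i)), P (i, j + 1)) (h2 : ∀ i j, s i ≤ j → P (i, j + 1)) : ∀ y, P y := by
  rintro ⟨i, j⟩
  cases j with
  | zero => exact h0 i
  | succ j =>
    by_cases hj : j < s i
    · exact h1 i ⟨j, hj⟩
    · exact h2 i j (not_lt.mp hj)

theorem arrowOp_comm {U U' : Type*} [AddCommGroup U] [Module K U] {L : Type*} [Field L]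
    [AddCommGroup U'] [Module L U'] {T : Fin g → Module.End K U} {T' : Fin g → Module.End L U'}
    {e : U → U'} (he : ∀ a u, e (T a u) = T' a (e u)) {x y : CometVertex g s} (a : x ⟶ y) (u : U) :
    e (arrowOp T a u) = arrowOp T' a (e u) := by
  match x, y, a with
  | center, center, a => exact he a u
  | leg _ _, _, _ => rfl

theorem map_mem_range {φ : QuiverRep K v} {ψ : QuiverRep K w}
    {f : (Fin (v center) → K) →ₗ[K] (Fin (w center) → K)}
    (hf : ∀ y, ∀ u ∈ φ.toLinSys.sub y, f u ∈ ψ.toLinSys.sub y) (x u) :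
    f (toCenter φ x u) ∈ LinearMap.range (toCenter ψ x) := by
  match x with
  | center => exact ⟨f u, rfl⟩
  | leg i j =>
    rw [← toLinSys_sub_succ]
    refine hf _ _ ?_
    rw [toLinSys_sub_succ]
    exact ⟨u, rfl⟩

/-- Morphisms are compatible with the maps to the center. -/
theorem toCenter_naturality {φ : QuiverRep K v} {ψ : QuiverRep K w}
    {F : ∀ x, (Fin (v x) → K) →ₗ[K] (Fin (w x) → K)}
    (hF : ∀ {x y : CometVertex g s} (a : x ⟶ y) u, F y (φ a *ᵥ u) = ψ a *ᵥ F x u) (x u) :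
    toCenter ψ x (F x u) = F center (toCenter φ x u) := by
  refine toCenter_unique φ ψ.loops (fun x => toCenter ψ x ∘ₗ F x) (fun a u => ?_) x u
  rw [LinearMap.comp_apply, hF, toCenter_arrow, LinearMap.comp_apply]

theorem map_mem_sub {φ : QuiverRep K v} {ψ : QuiverRep K w}
    {F : ∀ x, (Fin (v x) → K) →ₗ[K] (Fin (w x) → K)}
    (hF : ∀ {x y : CometVertex g s} (a : x ⟶ y) u, F y (φ a *ᵥ u) = ψ a *ᵥ F x u) :
    ∀ y, ∀ u ∈ φ.toLinSys.sub y, F center u ∈ ψ.toLinSys.sub y := by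
  refine legs_induction s (fun i u _ => ?_) (fun i j u hu => ?_) fun i j hj u hu => ?_
  · rw [toLinSys_sub_zero]
    trivial
  · rw [toLinSys_sub_succ] at hu ⊢
    obtain ⟨u, rfl⟩ := hu
    exact ⟨F _ u, toCenter_naturality hF _ u⟩
  · rw [toLinSys_sub_of_le _ _ hj, Submodule.mem_bot] at hu
    rw [hu, map_zero]
    exact zero_mem _

theorem Iso.toLinSys {φ : QuiverRep K v} {ψ : QuiverRep K w} (h : φ.Iso ψ) :
    φ.toLinSys.Iso ψ.toLinSys := by
  obtain ⟨f, hf⟩ := h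
  have hf' : ∀ {x y : CometVertex g s} (a : x ⟶ y) u, (f y).symm (ψ a *ᵥ u) = φ a *ᵥ (f x).symm u :=
    fun {x y} a u => by
      rw [LinearEquiv.symm_apply_eq, hf, LinearEquiv.apply_symm_apply]
  refine ⟨f center, fun a u => hf _ u, fun y u => ⟨?_, fun hu => ?_⟩⟩
  · exact map_mem_sub (F := fun x => (f x).toLinearMap) (fun a u => hf a u) y u
  · have h1 := map_mem_sub (F := fun x => (f x).symm.toLinearMap) (fun a u => hf' a u) y _ hu
    simpa using h1

/-- When the maps to the center are injective, each space on a leg is its image at the center, so an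
isomorphism there that matches the images lifts uniquely to all vertices. -/
theorem iso_of_toLinSys {φ : QuiverRep K v} {ψ : QuiverRep K w} (hφ : φ.LegsInjective)
    (hψ : ψ.LegsInjective) (h : φ.toLinSys.Iso ψ.toLinSys) : φ.Iso ψ := by
  obtain ⟨e, h1, h2⟩ := h
  choose F hF using fun x => LinearMap.exists_lift_of_injective (toCenter φ x) (hψ x) e.toLinearMap
    (map_mem_range (fun y u hu => (h2 y u).mp hu) x)
  choose G hG using fun x => LinearMap.exists_lift_of_injective (toCenter ψ x) (hφ x)
    e.symm.toLinearMap (map_mem_range (fun y u hu => (h2 y _).mpr (by simpa using hu)) x)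
  refine ⟨fun x => LinearEquiv.ofLinearMap (F x) (G x) (LinearMap.ext fun u => hψ x ?_)
    (LinearMap.ext fun u => hφ x ?_), fun x y a u => hψ y ?_⟩
  · simp [hF, hG]
  · simp [hF, hG]
  · have h3 := arrowOp_comm (T := φ.loops) (T' := ψ.loops) (e := e) h1 a (toCenter φ x u)
    rw [toCenter_arrow]
    change toCenter ψ y (F y _) = arrowOp _ a (toCenter ψ x (F x u))
    rw [hF, hF, toCenter_arrow]
    exact h3

/-- With injective maps to the center, an endomorphism of the representation is determined by its
component at the center, and every endomorphism of the system lifts. Idempotents therefore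
correspond. -/
theorem indecomposable_iff_toLinSys {φ : QuiverRep K v} (hφ : φ.LegsInjective)
    (h0 : v center ≠ 0) : φ.Indecomposable ↔ φ.toLinSys.Indec := by
  have h1 : v ≠ 0 := fun h => h0 (congrFun h center)
  have h2 : Nontrivial (Fin (v center) → K) :=
    have : NeZero (v center) := ⟨h0⟩
    inferInstance
  rw [indecomposable_iff, LinSys.Indec, and_iff_right h1, and_iff_right h2]
  constructor
  · intro h e he hee
    choose F hF using fun x => LinearMap.exists_lift_of_injective (toCenter φ x) (hφ x) e
      (map_mem_range he.2 x)
    have hFe : F center = e := LinearMap.ext fun u => hF center u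
    have hendo : φ.IsEndo F := fun x y a u => hφ y (by
      rw [hF, toCenter_arrow, toCenter_arrow, hF]
      exact arrowOp_comm (e := e) he.1 a _)
    have hidem : ∀ x, F x * F x = F x := fun x => LinearMap.ext fun u => hφ x (by
      rw [Module.End.mul_apply, hF, hF]
      exact LinearMap.congr_fun hee _)
    rcases h F hendo hidem with h3 | h3
    · exact Or.inl (hFe.symm.trans (h3 center))
    · exact Or.inr (hFe.symm.trans (h3 center))
  · intro h F hF hFF
    have hnat := toCenter_naturality (F := F) (φ := φ) (ψ := φ) (fun a u => hF a u)
    rcases h (F center) ⟨fun a u => hF _ u, map_mem_sub (fun a u => hF a u)⟩ (hFF center) with h3 | h3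
    · exact Or.inl fun x => LinearMap.ext fun u => hφ x (by
        rw [hnat, h3, LinearMap.zero_apply, LinearMap.zero_apply, map_zero])
    · exact Or.inr fun x => LinearMap.ext fun u => hφ x (by
        rw [hnat, h3, Module.End.one_apply, Module.End.one_apply])

/-- Complements of the kernels of the maps to the center that form a subrepresentation. -/
theorem exists_complement (φ : QuiverRep K v) : ∃ C : ∀ x, Submodule K (Fin (v x) → K),
    (∀ x, IsCompl (LinearMap.ker (toCenter φ x)) (C x)) ∧
      ∀ {x y : CometVertex g s} (a : x ⟶ y), ∀ u ∈ C x, φ a *ᵥ u ∈ C y := by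
  classical
  -- The complements are built from the outer end of the leg towards the center; `d` is the number
  -- of vertices treated so far. For `d = 0` the condition is empty.
  have key : ∀ i (d : ℕ), ∃ C : ∀ j : Fin (s i), Submodule K (Fin (v (leg i j)) → K),
      ∀ j : Fin (s i), s i ≤ j + d → IsCompl (LinearMap.ker (toCenter φ (leg i j))) (C j) ∧
        ∀ (j' : Fin (s i)) (a : (leg i j' : CometVertex g s) ⟶ leg i j), ∀ u ∈ C j',
          φ a *ᵥ u ∈ C j := by
    intro i d
    induction d with
    | zero => exact ⟨fun _ => ⊤, fun j hj => absurd j.2 (by omega)⟩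
    | succ d ih =>
      obtain ⟨C, hC⟩ := ih
      by_cases hd : d + 1 ≤ s i
      swap
      · exact ⟨C, fun j hj => hC j (by omega)⟩
      let j₀ : Fin (s i) := ⟨s i - (d + 1), by omega⟩
      -- The image of the complement at the next outer vertex must be contained in the new one. It
      -- meets the kernel trivially because the map to the center of the outer vertex factors
      -- through this arrow, so it can be enlarged to a complement. At the end of the leg there is
      -- no incoming arrow and `⊥` is used.
      obtain ⟨D, hD, hD'⟩ : ∃ D : Submodule K (Fin (v (leg i j₀)) → K),
          Disjoint D (LinearMap.ker (toCenter φ (leg i j₀))) ∧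
          ∀ (j' : Fin (s i)) (a : (leg i j' : CometVertex g s) ⟶ leg i j₀), ∀ u ∈ C j',
            φ a *ᵥ u ∈ D := by
        by_cases h1 : j₀.1 + 1 < s i
        · let a₁ : (leg i ⟨j₀ + 1, h1⟩ : CometVertex g s) ⟶ leg i j₀ := ⟨rfl, rfl⟩
          refine ⟨(C ⟨j₀ + 1, h1⟩).map (φ a₁).mulVecLin, ?_, ?_⟩
          · rw [Submodule.disjoint_def]
            rintro _ ⟨u, hu, rfl⟩ hu'
            have h2 : u ∈ LinearMap.ker (toCenter φ (leg i ⟨j₀ + 1, h1⟩)) :=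
              (toCenter_arrow φ a₁ u).symm.trans hu'
            have h3 := (hC ⟨j₀ + 1, h1⟩ (by simp only [j₀]; omega)).1.disjoint
            rw [Submodule.disjoint_def.mp h3 u h2 hu, map_zero]
          · rintro ⟨j', hj'⟩ ⟨_, h2⟩ u hu
            change j' = j₀.1 + 1 at h2
            subst h2
            exact ⟨u, hu, rfl⟩
        · refine ⟨⊥, disjoint_bot_left, ?_⟩
          rintro ⟨j', hj'⟩ ⟨_, h2⟩ u hu
          change j' = j₀.1 + 1 at h2
          omega
      obtain ⟨C', hC', hcompl⟩ := hD.exists_isCompl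
      refine ⟨Function.update C j₀ C', fun j hj => ?_⟩
      by_cases hj₀ : j = j₀
      · subst hj₀
        rw [Function.update_self]
        refine ⟨hcompl.symm, fun j' a u hu => hC' (hD' j' a u ?_)⟩
        rwa [Function.update_of_ne] at hu
        rintro rfl
        have := a.down.2
        omega
      · have hj₀' : j.1 ≠ s i - (d + 1) := fun h => hj₀ (Fin.ext h)
        rw [Function.update_of_ne hj₀]
        have h3 := hC j (by omega)
        refine ⟨h3.1, fun j' a u hu => h3.2 j' a u ?_⟩
        rwa [Function.update_of_ne] at hu
        rintro rfl
        have : s i - (d + 1) = j.1 + 1 := a.down.2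
        omega
  choose C hC using fun i => key i (s i)
  refine ⟨fun x => match x with
    | center => ⊤
    | leg i j => C i j, fun x => ?_, fun {x y} a u hu => ?_⟩
  · match x with
    | center =>
      change IsCompl (LinearMap.ker LinearMap.id) _
      rw [LinearMap.ker_id]
      exact isCompl_bot_top
    | leg i j => exact (hC i j (Nat.le_add_left _ _)).1
  · match x, y, a with
    | center, center, a => trivial
    | leg _ _, center, _ => trivial
    | leg i j, leg i' j', a =>
      obtain rfl : i = i' := a.down.1
      exact (hC i j' (Nat.le_add_left _ _)).2 j a u hu

/-- The kernels of the maps to the center form a subrepresentation with a complement, and the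
projection to the complement is an idempotent endomorphism. At the nonzero center it is the
identity, so it is the identity everywhere and the kernels vanish. -/
theorem Indecomposable.legsInjective {φ : QuiverRep K v} (h : φ.Indecomposable)
    (h0 : v center ≠ 0) : φ.LegsInjective := by
  obtain ⟨C, hC, hC'⟩ := exists_complement φ
  let e : ∀ x, Module.End K (Fin (v x) → K) := fun x => (C x).projection _ (hC x).symm
  have he0 : ∀ x u, toCenter φ x u = 0 → e x u = 0 := fun x u hu =>
    (Submodule.projection_apply_eq_zero_iff (hC x).symm).mpr hu
  have he1 : ∀ x, ∀ u ∈ C x, e x u = u := fun x u hu =>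
    Submodule.projection_apply_of_mem_left (hC x).symm hu
  have hdec : ∀ x u, ∃ a b, a ∈ LinearMap.ker (toCenter φ x) ∧ b ∈ C x ∧ a + b = u := fun x u => by
    have h1 : u ∈ LinearMap.ker (toCenter φ x) ⊔ C x := by
      rw [(hC x).sup_eq_top]
      trivial
    obtain ⟨a, ha, b, hb, hab⟩ := Submodule.mem_sup.mp h1
    exact ⟨a, b, ha, hb, hab⟩
  have hendo : φ.IsEndo e := fun x y a u => by
    obtain ⟨b, c, hb, hc, rfl⟩ := hdec x u
    have h1 : toCenter φ y (φ a *ᵥ b) = 0 := by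
      rw [toCenter_arrow, LinearMap.mem_ker.mp hb, map_zero]
    rw [Matrix.mulVec_add, map_add, map_add, Matrix.mulVec_add, he0 _ _ h1, he0 _ _ hb, he1 _ _ hc,
      he1 _ _ (hC' a c hc), Matrix.mulVec_zero]
  have hidem : ∀ x, e x * e x = e x := fun x => LinearMap.ext fun u => by
    obtain ⟨b, c, hb, hc, rfl⟩ := hdec x u
    rw [Module.End.mul_apply, map_add, he0 _ _ hb, he1 _ _ hc, zero_add, he1 _ _ hc]
  rcases (indecomposable_iff.mp h).2 e hendo hidem with h1 | h1
  · exfalso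
    have hC0 : C center = ⊤ := by
      have h2 := (hC center).sup_eq_top
      have h3 : LinearMap.ker (toCenter φ center) = ⊥ := LinearMap.ker_id
      rwa [h3, bot_sup_eq] at h2
    have h2 := he1 center (Pi.single ⟨0, Nat.pos_of_ne_zero h0⟩ 1) (hC0 ▸ Submodule.mem_top)
    rw [h1, LinearMap.zero_apply] at h2
    have h3 := congrFun h2 ⟨0, Nat.pos_of_ne_zero h0⟩
    simp at h3
  · intro x
    rw [← LinearMap.ker_eq_bot, Submodule.eq_bot_iff]
    intro u hu
    have h2 := he0 x u hu
    rwa [h1, Module.End.one_apply] at h2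

/-- Every system of operators and flags arises from a representation. -/
theorem exists_toLinSys_eq (M : LinSys (Fin g) (Fin k × ℕ) K (Fin (v center) → K))
    (htop : ∀ i, M.sub (i, 0) = ⊤) (hanti : ∀ i j, M.sub (i, j + 1) ≤ M.sub (i, j))
    (hdim : ∀ i (j : Fin (s i)), Module.finrank K (M.sub (i, j + 1)) = v (leg i j))
    (hbot : ∀ i j, s i ≤ j → M.sub (i, j + 1) = ⊥) :
    ∃ φ : QuiverRep K v, φ.LegsInjective ∧ φ.toLinSys = M := by
  -- Each leg vertex carries the prescribed subspace in arbitrary coordinates; the arrows are then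
  -- forced, as restrictions of the operators and inclusions.
  let ι : ∀ x, (Fin (v x) → K) →ₗ[K] (Fin (v center) → K) := fun x => match x with
    | center => LinearMap.id
    | leg i j => (M.sub (i, j + 1)).subtype ∘ₗ
      (LinearEquiv.ofFinrankEq (Fin (v (leg i j)) → K) (M.sub (i, j + 1))
        ((Module.finrank_fin_fun K).trans (hdim i j).symm)).toLinearMap
  have hι : ∀ x, Function.Injective (ι x) := fun x => match x with
    | center => Function.injective_id
    | leg i j => Subtype.val_injective.comp (LinearEquiv.injective _)
  have hrange : ∀ i j, LinearMap.range (ι (leg i j)) = M.sub (i, j + 1) := fun i j => by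
    change LinearMap.range ((M.sub (i, j + 1)).subtype ∘ₗ _) = _
    rw [LinearMap.range_comp, LinearEquiv.range, Submodule.map_top, Submodule.range_subtype]
  have hmem : ∀ {x y : CometVertex g s} (a : x ⟶ y) u,
      arrowOp M.op a (ι x u) ∈ LinearMap.range (ι y) := fun {x y} a u => by
    match x, y, a with
    | center, center, a => exact ⟨_, rfl⟩
    | leg i j, center, a => exact ⟨_, rfl⟩
    | leg i j, leg i' j', a =>
      obtain rfl : i = i' := a.down.1
      have hj : j.1 = j'.1 + 1 := a.down.2
      rw [hrange, ← hj]
      have h1 : ι (leg i j) u ∈ M.sub (i, j + 1) := by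
        rw [← hrange]
        exact ⟨u, rfl⟩
      exact hanti i j h1
  choose F hF using fun (x y : CometVertex g s) (a : x ⟶ y) =>
    LinearMap.exists_lift_of_injective (ι x) (hι y) (arrowOp M.op a) (hmem a)
  let φ : QuiverRep K v := fun x y a => LinearMap.toMatrix' (F x y a)
  have hφ : ∀ {x y : CometVertex g s} (a : x ⟶ y) u, φ a *ᵥ u = F x y a u := fun a u => by
    rw [← Matrix.toLin'_apply, Matrix.toLin'_toMatrix']
  have hcenter : ∀ x, toCenter φ x = ι x := fun x => LinearMap.ext fun u => by
    refine (toCenter_unique φ M.op ι (fun a u => ?_) x u).symm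
    rw [hφ, hF]
  refine ⟨φ, fun x => by rw [hcenter]; exact hι x, LinSys.ext' (funext fun a => ?_) (funext ?_)⟩
  · refine LinearMap.ext fun u => (hφ _ u).trans ?_
    exact hF center center a u
  · refine legs_induction s (fun i => ?_) (fun i j => ?_) fun i j hj => ?_
    · rw [toLinSys_sub_zero, htop]
    · rw [toLinSys_sub_succ, hcenter, hrange]
    · rw [toLinSys_sub_of_le _ _ hj, hbot i j hj]

end QuiverRep

end

/-! ### Extension of scalars and absolutely indecomposable representations of comets. -/

noncomputable section

open scoped Matrix TensorProduct

theorem LinearMap.range_baseChange_eq {K L V W : Type*} [Field K] [Field L] [Algebra K L]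
    [AddCommGroup V] [Module K V] [AddCommGroup W] [Module K W] (f : V →ₗ[K] W) :
    (LinearMap.range f).baseChange L = LinearMap.range (f.baseChange L) := by
  have h0 : (LinearMap.range f).subtype ∘ₗ f.rangeRestrict = f := rfl
  have h : f.baseChange L = (LinearMap.range f).subtype.baseChange L ∘ₗ
      f.rangeRestrict.baseChange L := by rw [← LinearMap.baseChange_comp, h0]
  have h1 : Function.Surjective (f.rangeRestrict.baseChange L) :=
    LinearMap.lTensor_surjective L f.surjective_rangeRestrict
  rw [h, LinearMap.range_comp, LinearMap.range_eq_top.mpr h1, Submodule.map_top]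
  rfl

namespace QuiverRep

open CometVertex

variable {K L : Type*} [Field K] [Field L] [Algebra K L] {g k : ℕ} {s : Fin k → ℕ}
  {v : CometVertex g s → ℕ}

theorem piScalarRight_mulVec {m n : ℕ} (B : Matrix (Fin m) (Fin n) K) (u : L ⊗[K] (Fin n → K)) :
    TensorProduct.piScalarRight K L L (Fin m) (B.mulVecLin.baseChange L u) =
      B.map (algebraMap K L) *ᵥ TensorProduct.piScalarRight K L L (Fin n) u := by
  induction u using TensorProduct.induction_on with
  | zero => simp
  | add x y hx hy => rw [map_add, map_add, hx, hy, map_add, Matrix.mulVec_add]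
  | tmul l w =>
    funext i
    simp only [LinearMap.baseChange_tmul, TensorProduct.piScalarRight_apply,
      TensorProduct.piScalarRightHom_tmul, Matrix.mulVecLin_apply, Matrix.mulVec, dotProduct,
      Matrix.map_apply, Finset.sum_smul, mul_smul, ← Algebra.smul_def]

/-- The extended maps are compatible with all arrows and are the identity at the center, so
`toCenter_unique` identifies them without following the legs. -/
theorem toCenter_baseChange (φ : QuiverRep K v) (x) (u : L ⊗[K] (Fin (v x) → K)) :
    toCenter (φ.baseChange L) x (TensorProduct.piScalarRight K L L _ u) =
      TensorProduct.piScalarRight K L L _ ((toCenter φ x).baseChange L u) := by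
  let θ : ∀ x, L ⊗[K] (Fin (v x) → K) ≃ₗ[L] (Fin (v x) → L) := fun x =>
    TensorProduct.piScalarRight K L L _
  have h := toCenter_unique (φ.baseChange L) (φ.baseChange L).loops
    (fun x => (θ center).toLinearMap ∘ₗ (toCenter φ x).baseChange L ∘ₗ (θ x).symm.toLinearMap)
    (fun {x y} a w => ?_) x (θ x u)
  · have h1 : (toCenter φ center).baseChange L = LinearMap.id := LinearMap.baseChange_id
    simp only [LinearMap.comp_apply, LinearEquiv.coe_coe, LinearEquiv.symm_apply_apply, h1,
      LinearMap.id_apply, LinearEquiv.apply_symm_apply] at h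
    exact h.symm
  · obtain ⟨w, rfl⟩ := (θ x).surjective w
    have h1 : φ.baseChange L a *ᵥ θ x w = θ y ((φ a).mulVecLin.baseChange L w) :=
      (piScalarRight_mulVec _ _).symm
    have h2 : ∀ w, (toCenter φ y).baseChange L ((φ a).mulVecLin.baseChange L w) =
        (arrowOp φ.loops a).baseChange L ((toCenter φ x).baseChange L w) := fun w => by
      rw [← LinearMap.comp_apply, ← LinearMap.comp_apply, ← LinearMap.baseChange_comp,
        ← LinearMap.baseChange_comp]
      congr 2
      exact LinearMap.ext fun u => toCenter_arrow φ a u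
    have h3 : ∀ z, θ center ((arrowOp φ.loops a).baseChange L z) =
        arrowOp (φ.baseChange L).loops a (θ center z) := fun z => by
      match x, y, a with
      | center, center, a => exact piScalarRight_mulVec _ _
      | leg _ _, _, _ =>
        change θ center (LinearMap.id.baseChange L z) = _
        rw [LinearMap.baseChange_id]
        rfl
    simp only [LinearMap.comp_apply, LinearEquiv.coe_coe, h1, LinearEquiv.symm_apply_apply, h2, h3]

theorem LegsInjective.baseChange {φ : QuiverRep K v} (h : φ.LegsInjective) :
    (φ.baseChange L).LegsInjective := fun x => by
  intro u u' hu
  obtain ⟨u, rfl⟩ := (TensorProduct.piScalarRight K L L _).surjective u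
  obtain ⟨u', rfl⟩ := (TensorProduct.piScalarRight K L L _).surjective u'
  rw [toCenter_baseChange, toCenter_baseChange] at hu
  have h1 : Function.Injective ((toCenter φ x).baseChange L) :=
    Module.Flat.lTensor_preserves_injective_linearMap (M := L) _ (h x)
  rw [h1 ((TensorProduct.piScalarRight K L L _).injective hu)]

theorem toLinSys_baseChange_iso (φ : QuiverRep K v) :
    (φ.toLinSys.baseChange L).Iso (φ.baseChange L).toLinSys := by
  refine ⟨TensorProduct.piScalarRight K L L _, fun a u => piScalarRight_mulVec _ _,
    legs_induction s (fun i u => ?_) (fun i j u => ?_) fun i j hj u => ?_⟩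
  · rw [toLinSys_sub_zero]
    change u ∈ (φ.toLinSys.sub (i, 0)).baseChange L ↔ _
    rw [toLinSys_sub_zero, Submodule.baseChange_top]
    exact iff_of_true trivial trivial
  · rw [toLinSys_sub_succ]
    change u ∈ (φ.toLinSys.sub (i, j + 1)).baseChange L ↔ _
    rw [toLinSys_sub_succ, LinearMap.range_baseChange_eq]
    constructor
    · rintro ⟨w, rfl⟩
      exact ⟨_, toCenter_baseChange φ _ w⟩
    · rintro ⟨w, hw⟩
      obtain ⟨w, rfl⟩ := (TensorProduct.piScalarRight K L L _).surjective w
      rw [toCenter_baseChange] at hw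
      exact ⟨w, (TensorProduct.piScalarRight K L L _).injective hw⟩
  · rw [toLinSys_sub_of_le _ _ hj]
    change u ∈ (φ.toLinSys.sub (i, j + 1)).baseChange L ↔ _
    rw [toLinSys_sub_of_le _ _ hj, Submodule.baseChange_bot, Submodule.mem_bot, Submodule.mem_bot,
      LinearEquiv.map_eq_zero_iff]

end QuiverRep

section

open CometVertex MultiPartition

variable {g k : ℕ} {mu : MultiPartition k}

theorem QuiverRep.LegsInjective.hasType {K : Type*} [Field K] {φ : QuiverRep K (cometDim g mu)}
    (h : φ.LegsInjective) : φ.toLinSys.HasType (flagType mu) := by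
  have hfin : ∀ i j, Module.finrank K (φ.toLinSys.sub (i, j)) = (mu.2 i).tail j := fun i j => by
    cases j with
    | zero =>
      rw [φ.toLinSys_sub_zero, (mu.2 i).tail_zero, finrank_top, Module.finrank_fin_fun]
      rfl
    | succ j =>
      by_cases hj : j < (mu.2 i).len - 1
      · rw [φ.toLinSys_sub_succ i ⟨j, hj⟩, LinearMap.finrank_range_of_inj (h _),
          Module.finrank_fin_fun]
        rfl
      · rw [φ.toLinSys_sub_of_le i (not_lt.mp hj), finrank_bot, (mu.2 i).tail_eq_zero (by omega)]
  refine ⟨fun i => antitone_nat_of_succ_le fun j => ?_, fun i j => ?_, fun i =>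
    ⟨(mu.2 i).len - 1 + 1, φ.toLinSys_sub_of_le i le_rfl⟩⟩
  · by_cases hj : j < (mu.2 i).len - 1
    · rw [φ.toLinSys_sub_succ i ⟨j, hj⟩]
      cases j with
      | zero => rw [φ.toLinSys_sub_zero]; exact le_top
      | succ j =>
        rw [φ.toLinSys_sub_succ i ⟨j, Nat.lt_of_succ_lt hj⟩]
        rintro _ ⟨u, rfl⟩
        exact ⟨_, φ.toCenter_arrow (show (leg i ⟨j + 1, hj⟩ : CometQuiver g mu) ⟶
          leg i ⟨j, Nat.lt_of_succ_lt hj⟩ from ⟨rfl, rfl⟩) u⟩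
    · rw [φ.toLinSys_sub_of_le i (not_lt.mp hj)]
      exact bot_le
  · rw [hfin, Module.finrank_fin_fun]
    simp only [flagType_apply]
    exact (mu.2 i).tail_add_sum j

theorem QuiverRep.exists_of_hasType {K : Type*} [Field K]
    {M : LinSys (Fin g) (Fin k × ℕ) K (Fin (cometDim g mu center) → K)}
    (hM : M.HasType (flagType mu)) :
    ∃ φ : QuiverRep K (cometDim g mu), φ.LegsInjective ∧ φ.toLinSys = M := by
  have hfin : ∀ i j, Module.finrank K (M.sub (i, j)) = (mu.2 i).tail j := fun i j => by
    have h1 := hM.finrank_add i j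
    rw [Module.finrank_fin_fun] at h1
    simp only [flagType_apply] at h1
    exact Nat.add_right_cancel (h1.trans ((mu.2 i).tail_add_sum j).symm)
  refine exists_toLinSys_eq M (fun i => ?_) (fun i j => hM.anti i (Nat.le_succ j))
    (fun i j => hfin i _) fun i j hj => ?_
  · apply Submodule.eq_top_of_finrank_eq
    rw [hfin, (mu.2 i).tail_zero, Module.finrank_fin_fun]
    rfl
  · exact Submodule.finrank_eq_zero.mp ((hfin i _).trans ((mu.2 i).tail_eq_zero (by omega)))

/-- The trivial extension gives injectivity of the legs. A nontrivial idempotent over the algebraic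
closure would already appear over a finite extension. Conversely, every finite extension embeds in
the closure, and indecomposability descends. -/
theorem absolutelyIndecomposable_iff {K : Type} [Field K] {φ : QuiverRep K (cometDim g mu)}
    (h0 : mu.1 ≠ 0) : φ.AbsolutelyIndecomposable ↔ φ.LegsInjective ∧
      (φ.toLinSys.baseChange (AlgebraicClosure K)).Indec := by
  constructor
  · intro h
    have h1 : (φ.baseChange K).Indecomposable := h K
    have h2 : φ.baseChange K = φ := funext fun x => funext fun y => funext fun a =>
      Matrix.map_id _
    rw [h2] at h1
    have hinj := h1.legsInjective h0
    refine ⟨hinj, by_contra fun hn => ?_⟩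
    obtain ⟨L, hL, hn⟩ := LinSys.exists_finite_not_indec hn
    have h3 := h L
    rw [QuiverRep.indecomposable_iff_toLinSys hinj.baseChange h0] at h3
    exact hn (h3.of_iso φ.toLinSys_baseChange_iso.symm)
  · rintro ⟨hinj, h⟩ L _ _ _
    rw [QuiverRep.indecomposable_iff_toLinSys hinj.baseChange h0]
    exact (h.of_baseChange (IsAlgClosed.lift : L →ₐ[K] AlgebraicClosure K)).of_iso
      φ.toLinSys_baseChange_iso

/-- Absolutely indecomposable representations have injective legs, so they are recovered up to
isomorphism from their systems. As `k > 0`, the type fixes the dimension at the center. -/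
theorem absIndecCount_eq_absCount (K : Type) [Field K] (hk : 0 < k) (h0 : mu.1 ≠ 0) :
    absIndecCount K (cometDim g mu) = IsoClass.absCount (Fin g) K (flagType mu) := by
  have habs : ∀ φ : QuiverRep K (cometDim g mu), φ.AbsolutelyIndecomposable ↔ φ.LegsInjective ∧
      (IsoClass.baseChange (AlgebraicClosure K) (IsoClass.mk φ.toLinSys)).IsIndec := fun φ => by
    rw [absolutelyIndecomposable_iff h0, IsoClass.baseChange_mk, IsoClass.isIndec_mk]
  rw [absIndecCount, IsoClass.absCount, ← Nat.card_coe_set_eq]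
  refine Nat.card_congr (Equiv.ofBijective (Quotient.lift (fun φ => ⟨IsoClass.mk φ.1.toLinSys,
    ((habs _).mp φ.2).2, IsoClass.hasType_mk.mpr ((habs _).mp φ.2).1.hasType⟩)
    fun φ ψ h => Subtype.ext (IsoClass.mk_eq_mk.mpr (QuiverRep.Iso.toLinSys h))) ⟨?_, ?_⟩)
  · rintro ⟨φ⟩ ⟨ψ⟩ h
    exact Quotient.sound (QuiverRep.iso_of_toLinSys ((habs _).mp φ.2).1 ((habs _).mp ψ.2).1
      (IsoClass.mk_eq_mk.mp (congrArg Subtype.val h)))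
  · rintro ⟨s, hs, m, M, rfl, hM⟩
    have hm : m = cometDim g mu center := by
      change m = mu.1
      rw [← degree_curry_flagType mu ⟨0, hk⟩, ← hM.finrank_eq, Module.finrank_fin_fun]
    subst hm
    obtain ⟨φ, hφ, rfl⟩ := QuiverRep.exists_of_hasType hM
    exact ⟨Quotient.mk _ ⟨φ, (habs φ).mpr ⟨hφ, hs⟩⟩, rfl⟩

end

end

/-! ### The plethystic logarithm commutes with permutations of the variables. -/

noncomputable section

namespace Plethysm

open MvPowerSeries

variable {R σ : Type*} [CommRing R]

theorem coeff_mapDomain_rename (e : Equiv.Perm σ) (f : MvPowerSeries σ R) (a : σ →₀ ℕ) :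
    coeff (a.mapDomain e) (rename e f) = coeff a f := by
  have h := coeff_embDomain_rename e.toEmbedding f a
  rwa [Finsupp.embDomain_eq_mapDomain] at h

theorem mapDomain_perm_surjective (e : Equiv.Perm σ) (a : σ →₀ ℕ) :
    ∃ b : σ →₀ ℕ, b.mapDomain e = a :=
  ⟨a.mapDomain e.symm, by rw [← Finsupp.mapDomain_comp, e.self_comp_symm, Finsupp.mapDomain_id]⟩

theorem rename_adams (ψ : ℕ+ → R →+* R) (n : ℕ+) (e : Equiv.Perm σ) (f : MvPowerSeries σ R) :
    rename e (adams ψ n f) = adams ψ n (rename e f) := by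
  ext a
  obtain ⟨a, rfl⟩ := mapDomain_perm_surjective e a
  rw [coeff_mapDomain_rename]
  by_cases h : ∀ x, (n : ℕ) ∣ a x
  · obtain ⟨b, rfl⟩ : ∃ b, (n : ℕ) • b = a :=
      ⟨a.mapRange (fun i => i / n) (Nat.zero_div _), Finsupp.ext fun x => Nat.mul_div_cancel' (h x)⟩
    rw [coeff_smul_adams, Finsupp.mapDomain_smul, coeff_smul_adams, coeff_mapDomain_rename]
  · push Not at h
    obtain ⟨x, hx⟩ := h
    have hx' : ¬(n : ℕ) ∣ a.mapDomain e (e x) := by rwa [Finsupp.mapDomain_apply e.injective]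
    rw [adams, adams, coeff_expand_of_not_dvd _ _ _ hx, coeff_expand_of_not_dvd _ _ _ hx']

variable [Algebra ℚ R]

theorem Log_rename {ψ : ℕ+ → R →+* R} (hψ : IsAdams ψ) (e : Equiv.Perm σ)
    {f : MvPowerSeries σ R} (hf : constantCoeff f = 1) :
    Log ψ (rename e f) = rename e (Log ψ f) := by
  have hdeg : ∀ a : σ →₀ ℕ, (a.mapDomain e).degree = a.degree := fun a =>
    Finsupp.degree_mapDomain e a
  have h1 : ∀ g : MvPowerSeries σ R, rename e (euler g) = euler (rename e g) := fun g => by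
    ext a
    obtain ⟨a, rfl⟩ := mapDomain_perm_surjective e a
    rw [coeff_mapDomain_rename, coeff_euler, coeff_euler, coeff_mapDomain_rename, hdeg]
  have h2 : ∀ g : MvPowerSeries σ R, rename e (euler (psi ψ g)) = euler (psi ψ (rename e g)) :=
    fun g => by
      ext a
      obtain ⟨a, rfl⟩ := mapDomain_perm_surjective e a
      rw [coeff_mapDomain_rename, coeff_euler_psi, coeff_euler_psi, hdeg]
      refine Finset.sum_congr rfl fun n _ => ?_
      rw [← rename_adams, coeff_mapDomain_rename]
  refine (Log_eq_iff hψ ((constantCoeff_rename _ f).trans hf)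
    ((constantCoeff_rename _ _).trans (constantCoeff_Log ψ f))).mpr ?_
  rw [← h2, ← map_mul, (Log_eq_iff hψ hf (constantCoeff_Log ψ f)).mp rfl, h1]

end Plethysm

/-! ### Series that are symmetric in each set of variables -/

namespace MvPowerSeries

variable {R ι : Type*} [CommRing R]

/-- A series in the variables `x_{i,j}` is multisymmetric if the coefficients of its monomials depend
only on the multisets of exponents for each `i`, and it only has terms of the same degree in each set
of variables. -/
structure IsMultiSymmetric (f : MvPowerSeries (ι × ℕ) R) : Prop where
  coeff_eq : ∀ a a' : ι × ℕ →₀ ℕ, (∀ i, (a.curry i).support.val.map (a.curry i) =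
    (a'.curry i).support.val.map (a'.curry i)) → coeff a f = coeff a' f
  coeff_eq_zero : ∀ (a : ι × ℕ →₀ ℕ) (i i' : ι), (a.curry i).degree ≠ (a.curry i').degree →
    coeff a f = 0

theorem IsMultiSymmetric.of_map {S : Type*} [CommRing S] {φ : R →+* S}
    (hφ : Function.Injective φ) {f : MvPowerSeries (ι × ℕ) R} (h : (map φ f).IsMultiSymmetric) :
    f.IsMultiSymmetric where
  coeff_eq a a' haa := hφ (by simpa only [coeff_map] using h.coeff_eq a a' haa)
  coeff_eq_zero a i i' hi := hφ (by
    simpa only [coeff_map, map_zero] using h.coeff_eq_zero a i i' hi)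

end MvPowerSeries

/-- Finitely supported functions with the same multiset of nonzero values differ by a permutation. -/
theorem Finsupp.exists_perm_of_map_support_eq {b b' : ℕ →₀ ℕ}
    (h : b.support.val.map b = b'.support.val.map b') : ∃ e : Equiv.Perm ℕ, b.mapDomain e = b' := by
  classical
  -- The two functions have equinumerous fibres: over a nonzero value by comparing multiplicities,
  -- over `0` because both fibres are countably infinite.
  have hE : ∀ v, Nonempty ({j // b j = v} ≃ {j // b' j = v}) := fun v => by
    by_cases hv : v = 0
    · subst hv
      have hinf : ∀ b : ℕ →₀ ℕ, Infinite {j // b j = 0} := fun b => by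
        have : {j | b j = 0} = (b.support : Set ℕ)ᶜ := by ext; simp
        exact (this ▸ b.support.finite_toSet.infinite_compl : {j | b j = 0}.Infinite).to_subtype
      have := hinf b
      have := hinf b'
      exact nonempty_equiv_of_countable
    · have hcard : ∀ b : ℕ →₀ ℕ, (b.support.val.map b).count v = (b.support.filter (b · = v)).card :=
        fun b => by
          rw [Multiset.count_map, Finset.card, Finset.filter_val]
          simp only [eq_comm]
      have heq : ∀ (b : ℕ →₀ ℕ) j, j ∈ b.support.filter (b · = v) ↔ b j = v := fun b j => by
        rw [Finset.mem_filter, Finsupp.mem_support_iff]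
        exact ⟨And.right, fun hj => ⟨hj ▸ hv, hj⟩⟩
      have hc := (hcard b).symm.trans ((congrArg (Multiset.count v) h).trans (hcard b'))
      exact ⟨((Equiv.subtypeEquivRight fun j => (heq b j).symm).trans
        (Finset.equivOfCardEq hc)).trans (Equiv.subtypeEquivRight fun j => heq b' j)⟩
  let e : Equiv.Perm ℕ := Equiv.ofFiberEquiv (f := b) (g := b') fun v => (hE v).some
  refine ⟨e, Finsupp.ext fun j => ?_⟩
  obtain ⟨j, rfl⟩ := e.surjective j
  rw [Finsupp.mapDomain_apply e.injective]
  exact (Equiv.ofFiberEquiv_map (f := b) (g := b') (fun v => (hE v).some) j).symm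

theorem Finsupp.exists_perm_of_map_support_curry_eq {ι : Type*} {a a' : ι × ℕ →₀ ℕ}
    (h : ∀ i, (a.curry i).support.val.map (a.curry i) =
      (a'.curry i).support.val.map (a'.curry i)) :
    ∃ e : Equiv.Perm (ι × ℕ), a.mapDomain e = a' ∧ ∀ (c : ι × ℕ →₀ ℕ) i,
      ((c.mapDomain e).curry i).support.val.map ((c.mapDomain e).curry i) =
        (c.curry i).support.val.map (c.curry i) := by
  classical
  choose E hE using fun i => Finsupp.exists_perm_of_map_support_eq (h i)
  let e : Equiv.Perm (ι × ℕ) := Equiv.prodShear (Equiv.refl ι) E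
  have hc : ∀ (c : ι × ℕ →₀ ℕ) i, (c.mapDomain e).curry i = (c.curry i).mapDomain (E i) :=
    fun c i => Finsupp.ext fun j => by
      obtain ⟨j, rfl⟩ := (E i).surjective j
      rw [Finsupp.mapDomain_apply (E i).injective, Finsupp.curry_apply, Finsupp.curry_apply]
      exact Finsupp.mapDomain_apply e.injective c (i, j)
  refine ⟨e, Finsupp.ext fun ⟨i, j⟩ => ?_, fun c i => ?_⟩
  · rw [← Finsupp.curry_apply, ← Finsupp.curry_apply, hc, hE]
  · rw [hc, Finsupp.mapDomain_support_of_injective (E i).injective,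
      Finset.image_val_of_injOn (E i).injective.injOn, Multiset.map_map]
    exact Multiset.map_congr rfl fun j _ => Finsupp.mapDomain_apply (E i).injective _ j

namespace IsoClass

open MvPowerSeries Plethysm

theorem absCount_eq_zero {A ι K : Type*} [Field K] {a : ι × ℕ →₀ ℕ} {i i' : ι}
    (h : (a.curry i).degree ≠ (a.curry i').degree) : absCount A K a = 0 := by
  have : {s : IsoClass A (ι × ℕ) K |
      (baseChange (AlgebraicClosure K) s).IsIndec ∧ s.HasType a} = ∅ := by
    refine Set.eq_empty_of_forall_notMem ?_
    rintro _ ⟨-, n, M, rfl, hM⟩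
    exact h ((hM.finrank_eq i).symm.trans (hM.finrank_eq i'))
  rw [absCount, this, Set.ncard_empty]

variable (A ι : Type*) [Nonempty ι]

theorem constantCoeff_classSeries : constantCoeff (classSeries A ι) = 1 := by
  ext q
  change ((classCount A q.Fq 0 : ℕ) : ℚ) = 1
  rw [classCount_zero, Nat.cast_one]

variable [Finite A] [Finite ι]

theorem isMultiSymmetric_classSeries : (classSeries A ι).IsMultiSymmetric where
  coeff_eq _ _ h := funext fun _ => congrArg Nat.cast (classCount_eq_of_parts_eq h)
  coeff_eq_zero _ _ _ h := funext fun _ =>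
    (congrArg Nat.cast (classCount_eq_zero h)).trans Nat.cast_zero

/-- No direct count is made. The permutations of variables in question fix the series of all
classes, hence also its plethystic logarithm. -/
theorem isMultiSymmetric_absSeries : (absSeries A ι).IsMultiSymmetric where
  coeff_eq a a' h := by
    classical
    obtain ⟨e, rfl, he⟩ := Finsupp.exists_perm_of_map_support_curry_eq h
    have h1 : rename e (classSeries A ι) = classSeries A ι := by
      ext1 c
      obtain ⟨c, rfl⟩ := mapDomain_perm_surjective e c
      rw [coeff_mapDomain_rename]
      exact (isMultiSymmetric_classSeries A ι).coeff_eq _ _ fun i => (he c i).symm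
    have h2 := Log_rename isAdams_adams e (constantCoeff_classSeries A ι)
    rw [h1, Log_classSeries] at h2
    conv_rhs => rw [h2]
    rw [coeff_mapDomain_rename]
  coeff_eq_zero _ _ _ h := funext fun _ =>
    (congrArg Nat.cast (absCount_eq_zero h)).trans Nat.cast_zero

end IsoClass

namespace MultiPartition

open MvPowerSeries

variable {R : Type*} [CommRing R] {k : ℕ}

theorem coeff_multiMonomialSymm (mu : MultiPartition k) (a : Fin k × ℕ →₀ ℕ) [Decidable
    (∀ i, (a.curry i).support.val.map (a.curry i) = (mu.2 i).parts)] :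
    coeff a (multiMonomialSymm R mu) =
      if ∀ i, (a.curry i).support.val.map (a.curry i) = (mu.2 i).parts then 1 else 0 := by
  change ∏ i, (if (a.curry i).support.val.map (a.curry i) = (mu.2 i).parts then (1 : R) else 0) = _
  split_ifs with h
  · exact Finset.prod_eq_one fun i _ => if_pos (h i)
  · push Not at h
    obtain ⟨i, hi⟩ := h
    exact Finset.prod_eq_zero (Finset.mem_univ i) (if_neg hi)

theorem eq_of_parts_eq (hk : 0 < k) {mu nu : MultiPartition k}
    (h : ∀ i, (mu.2 i).parts = (nu.2 i).parts) : mu = nu := by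
  obtain ⟨n, mu⟩ := mu
  obtain ⟨m, nu⟩ := nu
  obtain rfl : n = m := by
    have := congrArg Multiset.sum (h ⟨0, hk⟩)
    rwa [(mu _).parts_sum, (nu _).parts_sum] at this
  exact congrArg (Sigma.mk n) (funext fun i => Nat.Partition.ext (h i))

theorem coeff_multiMonomialSeries (hk : 0 < k) (c : MultiPartition k → R) {mu : MultiPartition k}
    {a : Fin k × ℕ →₀ ℕ}
    (h : ∀ i, (a.curry i).support.val.map (a.curry i) = (mu.2 i).parts) :
    coeff a (multiMonomialSeries c) = c mu := by
  classical
  change ∑ᶠ nu, c nu * coeff a (multiMonomialSymm R nu) = _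
  rw [finsum_eq_single _ mu, coeff_multiMonomialSymm, if_pos h, mul_one]
  intro nu hne
  rw [coeff_multiMonomialSymm, if_neg, mul_zero]
  exact fun h' => hne (eq_of_parts_eq hk fun i => (h' i).symm.trans (h i))

theorem coeff_multiMonomialSeries_eq_zero (c : MultiPartition k → R) {a : Fin k × ℕ →₀ ℕ}
    {i i' : Fin k} (h : (a.curry i).degree ≠ (a.curry i').degree) :
    coeff a (multiMonomialSeries c) = 0 := by
  classical
  change ∑ᶠ nu, c nu * coeff a (multiMonomialSymm R nu) = 0
  refine finsum_eq_zero_of_forall_eq_zero fun nu => ?_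
  rw [coeff_multiMonomialSymm, if_neg, mul_zero]
  intro h'
  have hd : ∀ i, (a.curry i).degree = nu.1 := fun i =>
    (congrArg Multiset.sum (h' i)).trans (nu.2 i).parts_sum
  exact h ((hd i).trans (hd i').symm)

theorem exists_parts_eq (hk : 0 < k) {a : Fin k × ℕ →₀ ℕ}
    (h : ∀ i i', (a.curry i).degree = (a.curry i').degree) :
    ∃ mu : MultiPartition k, ∀ i,
      (a.curry i).support.val.map (a.curry i) = (mu.2 i).parts :=
  ⟨⟨(a.curry ⟨0, hk⟩).degree, fun i => ⟨(a.curry i).support.val.map (a.curry i), fun hm => by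
    obtain ⟨j, hj, rfl⟩ := Multiset.mem_map.mp hm
    exact Nat.pos_of_ne_zero (Finsupp.mem_support_iff.mp hj), h i ⟨0, hk⟩⟩⟩, fun _ => rfl⟩

/-- A multisymmetric series is determined by its coefficients at the exponents `flagType mu`. -/
theorem multiMonomialSeries_eq (hk : 0 < k) {c : MultiPartition k → R}
    {f : MvPowerSeries (Fin k × ℕ) R} (hf : f.IsMultiSymmetric)
    (h : ∀ mu, c mu = coeff (flagType mu) f) : multiMonomialSeries c = f := by
  ext a
  by_cases hd : ∀ i i', (a.curry i).degree = (a.curry i').degree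
  · obtain ⟨mu, hmu⟩ := exists_parts_eq hk hd
    rw [coeff_multiMonomialSeries hk c hmu, h]
    refine hf.coeff_eq _ _ fun i => ?_
    rw [curry_flagType, Nat.Partition.map_partFun, hmu]
  · push Not at hd
    obtain ⟨i, i', hi⟩ := hd
    rw [coeff_multiMonomialSeries_eq_zero c hi, hf.coeff_eq_zero a i i' hi]

theorem map_multiMonomialSeries (hk : 0 < k) {S : Type*} [CommRing S] (φ : R →+* S)
    (c : MultiPartition k → R) :
    map φ (multiMonomialSeries c) = multiMonomialSeries fun mu => φ (c mu) := by
  ext a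
  rw [coeff_map]
  by_cases hd : ∀ i i', (a.curry i).degree = (a.curry i').degree
  · obtain ⟨mu, hmu⟩ := exists_parts_eq hk hd
    rw [coeff_multiMonomialSeries hk _ hmu, coeff_multiMonomialSeries hk _ hmu]
  · push Not at hd
    obtain ⟨i, i', hi⟩ := hd
    rw [coeff_multiMonomialSeries_eq_zero _ hi, coeff_multiMonomialSeries_eq_zero _ hi, map_zero]

theorem multiMonomialSeries_GFun (g : ℕ) (hk : 0 < k) :
    multiMonomialSeries (fun mu : MultiPartition k => GFun g mu) =
      IsoClass.classSeries (Fin g) (Fin k) := by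
  have : Nonempty (Fin k) := ⟨⟨0, hk⟩⟩
  exact multiMonomialSeries_eq hk (IsoClass.isMultiSymmetric_classSeries _ _) fun mu =>
    funext fun q => congrArg Nat.cast (orbitCount_eq_classCount q.Fq g hk mu)

/-- For `n = 0` the type is zero and no indecomposable class has it, which matches the omission of
the empty multipartition. -/
theorem multiMonomialSeries_AFun (g : ℕ) (hk : 0 < k) :
    multiMonomialSeries (fun mu : MultiPartition k => if mu.1 = 0 then 0 else AFun g mu) =
      IsoClass.absSeries (Fin g) (Fin k) := by
  have : Nonempty (Fin k) := ⟨⟨0, hk⟩⟩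
  refine multiMonomialSeries_eq hk (IsoClass.isMultiSymmetric_absSeries _ _) fun mu =>
    funext fun q => ?_
  change _ = (IsoClass.absCount (Fin g) q.Fq (flagType mu) : ℚ)
  split_ifs with h
  · have h0 : flagType mu = 0 := Finsupp.ext fun ⟨i, j⟩ => by
      rw [← Finsupp.curry_apply, (Finsupp.degree_eq_zero_iff _).mp ((degree_curry_flagType mu i).trans h)]
      rfl
    rw [h0, IsoClass.absCount_zero]
    exact Nat.cast_zero.symm
  · exact congrArg Nat.cast (absIndecCount_eq_absCount q.Fq hk h)

end MultiPartition

/-! ### Polynomials as functions on the prime powers -/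

/-- The function on prime powers defined by a polynomial. -/
def polyEval : Polynomial ℚ →+* (PrimePower → ℚ) :=
  RingHom.pi fun q => Polynomial.evalRingHom (q.1 : ℚ)

theorem polyEval_apply (P : Polynomial ℚ) (q : PrimePower) : polyEval P q = P.eval (q.1 : ℚ) := rfl

/-- A polynomial is determined by its values at the infinitely many primes. -/
theorem polyEval_injective : Function.Injective polyEval := fun P Q h => by
  refine Polynomial.eq_of_infinite_eval_eq P Q (Set.Infinite.mono ?_
    (Nat.infinite_setOfPred_prime.image (Nat.cast_injective (R := ℚ)).injOn))
  rintro _ ⟨p, hp, rfl⟩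
  exact congrFun h ⟨p, Nat.Prime.isPrimePow hp⟩

theorem polyEval_polyAdams (n : ℕ+) (P : Polynomial ℚ) :
    polyEval (polyAdams n P) = PrimePower.adams n (polyEval P) := funext fun q => by
  change (Polynomial.expand ℚ (n : ℕ) P).eval (q.1 : ℚ) = P.eval ((q.1 ^ (n : ℕ) : ℕ) : ℚ)
  rw [Polynomial.expand_eval, Nat.cast_pow]

theorem isAdams_polyAdams : Plethysm.IsAdams polyAdams where
  one x := Polynomial.expand_one x
  mul m n x := by
    change Polynomial.expand ℚ (m : ℕ) (Polynomial.expand ℚ (n : ℕ) x) = _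
    rw [Polynomial.expand_expand]
    rfl

namespace MultiPartition

open MvPowerSeries Plethysm IsoClass

/-- The polynomials are the coefficients of the plethystic exponential `f`, over `ℚ[q]`, of the
series of the `A`-polynomials. Evaluation sends `f` to a series with the same `Log` as the class
series, hence to the class series itself. Multisymmetry of `f` follows by injectivity of evaluation.
-/
theorem exists_polynomial_Log_eq (g : ℕ) {k : ℕ} (hk : 0 < k) {A : MultiPartition k → Polynomial ℤ}
    (hA : ∀ mu, IsAPolynomial (cometDim g mu) (A mu)) :
    ∃ G : MultiPartition k → Polynomial ℚ,
      (∀ (mu : MultiPartition k) (F : Type) [Field F] [Finite F],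
        (G mu).eval (Nat.card F : ℚ) = orbitCount F g mu) ∧
      Log polyAdams (multiMonomialSeries G) = multiMonomialSeries fun mu : MultiPartition k =>
        if mu.1 = 0 then 0 else (A mu).map (Int.castRingHom ℚ) := by
  have : Nonempty (Fin k) := ⟨⟨0, hk⟩⟩
  set a : MvPowerSeries (Fin k × ℕ) (Polynomial ℚ) := multiMonomialSeries fun mu =>
    if mu.1 = 0 then 0 else (A mu).map (Int.castRingHom ℚ) with ha
  have hmap : map polyEval a = absSeries (Fin g) (Fin k) := by
    rw [ha, map_multiMonomialSeries hk, ← multiMonomialSeries_AFun g hk]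
    congr 1
    funext mu
    split_ifs
    · exact map_zero _
    · funext q
      have h := congrArg (Int.cast : ℤ → ℚ) (hA mu q.Fq)
      rw [PrimePower.card_Fq] at h
      rw [polyEval_apply, ← Int.cast_natCast (R := ℚ) q.1, Polynomial.eval_intCast_map]
      exact h.trans (Int.cast_natCast _)
  have ha0 : constantCoeff a = 0 := polyEval_injective (by
    rw [← constantCoeff_map, hmap, ← Log_classSeries, constantCoeff_Log, map_zero])
  obtain ⟨f, hf, hLog⟩ := exists_Log_eq isAdams_polyAdams ha0
  have hfmap : map polyEval f = classSeries (Fin g) (Fin k) := by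
    refine eq_of_Log_eq isAdams_adams ?_ (constantCoeff_classSeries _ _) ?_
    · rw [constantCoeff_map, hf, map_one]
    · rw [Log_map isAdams_polyAdams isAdams_adams polyEval polyEval_polyAdams hf, hLog, hmap,
        Log_classSeries]
  have hsym : f.IsMultiSymmetric := IsMultiSymmetric.of_map polyEval_injective
    (hfmap ▸ isMultiSymmetric_classSeries (Fin g) (Fin k))
  refine ⟨fun mu => coeff (flagType mu) f, fun mu F _ _ => ?_, ?_⟩
  · have := Fintype.ofFinite F
    have hq : IsPrimePow (Nat.card F) := by
      rw [Nat.card_eq_fintype_card]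
      exact FiniteField.isPrimePow_card F
    have h := congrFun (congrArg (coeff (flagType mu)) hfmap) ⟨Nat.card F, hq⟩
    rw [coeff_map, polyEval_apply] at h
    rw [h, orbitCount_eq_classCount F g hk mu]
    -- The functions of `q` are evaluated at one chosen field for each prime power; the count is the
    -- same for every field of that cardinality.
    exact congrArg Nat.cast (classCount_congr (PrimePower.card_Fq ⟨Nat.card F, hq⟩) _)
  · rw [multiMonomialSeries_eq hk hsym fun _ => rfl, hLog]

end MultiPartition

end

theorem theorem3p5 (g k : ℕ) (hk : 0 < k) :
    Plethysm.Log PrimePower.adams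
        (multiMonomialSeries fun mu : MultiPartition k => GFun g mu) =
      multiMonomialSeries (fun mu : MultiPartition k => if mu.1 = 0 then 0 else AFun g mu) ∧
    ∀ A : MultiPartition k → Polynomial ℤ, (∀ mu, IsAPolynomial (cometDim g mu) (A mu)) →
      ∃ G : MultiPartition k → Polynomial ℚ,
        (∀ (mu : MultiPartition k) (F : Type) [Field F] [Finite F],
          (G mu).eval (Nat.card F : ℚ) = orbitCount F g mu) ∧
        Plethysm.Log polyAdams (multiMonomialSeries G) =
          multiMonomialSeries fun mu : MultiPartition k =>
            if mu.1 = 0 then 0 else (A mu).map (Int.castRingHom ℚ) := by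
  have : Nonempty (Fin k) := ⟨⟨0, hk⟩⟩
  refine ⟨?_, fun A hA => MultiPartition.exists_polynomial_Log_eq g hk hA⟩
  rw [MultiPartition.multiMonomialSeries_GFun g hk, MultiPartition.multiMonomialSeries_AFun g hk]
  exact IsoClass.Log_classSeries
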